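/- **Setting.** Write $e(z)=e^{2\pi i z}$, and let $\sqrt{\cdot}$ be the principal branch of the square root. Let $\mathbb H$ be the upper half plane, $\tau=x+iy\in\mathbb H$. Let $\operatorname{Mp}_2(\mathbb Z)$ be the group of pairs $(M,\phi)$ with $M=\begin{pmatrix}a&b\\c&d\end{pmatrix}\in\operatorname{SL}_2(\mathbb Z)$ and $\phi:\mathbb H\to\mathbb C$ holomorphic with $\phi(\tau)^2=c\tau+d$, with multiplication $(M,\phi(\tau))(N,\psi(\tau))=(MN,\phi(N\tau)\psi(\tau))$. Put $\widetilde M=(M,\sqrt{c\tau+d})$, $T=\left(\begin{pmatrix}1&1\\0&1\end{pmatrix},1\right)$, $S=\left(\begin{pmatrix}0&-1\\1&0\end{pmatrix},\sqrt\tau\right)$, $\tilde\Gamma_\infty=\{T^n:\ n\in\mathbb Z\}$, $\Gamma_1=\operatorname{SL}_2(\mathbb Z)$ and $\Gamma_\infty=\left\{\begin{pmatrix}1&n\\0&1\end{pmatrix}:\ n\in\mathbb Z\right\}$. Let $(V,q)$ be a non-degenerate real quadratic space of signature $(b^+,b^-)$ with bilinear form $(x,y)=q(x+y)-q(x)-q(y)$,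 let $L\subset V$ be an even lattice of full rank and $L'$ its dual lattice. Let $\rho_L$ be the Weil representation, i.e. the unitary representation of $\operatorname{Mp}_2(\mathbb Z)$ on $\mathbb C[L'/L]$ (with standard basis $(\mathfrak e_\gamma)_{\gamma\in L'/L}$) given by $$\rho_L(T)\mathfrak e_\gamma=e(q(\gamma))\mathfrak e_\gamma,\qquad \rho_L(S)\mathfrak e_\gamma=\frac{\sqrt i^{\,b^--b^+}}{\sqrt{|L'/L|}}\sum_{\delta\in L'/L}e(-(\gamma,\delta))\mathfrak e_\delta ,$$ let $\rho_{\beta\gamma}(M,\phi)$ be the $\mathfrak e_\beta$-coefficient of $\rho_L(M,\phi)\mathfrak e_\gamma$, and let $\rho_L^*$ be the dual representation. Let $\kappa\in\frac12\mathbb Z$ with $\kappa\ge 2$ and $2\kappa-b^-+b^+\equiv0\pmod 4$. For $f:\mathbb H\to\mathbb C[L'/L]$ put $(f\mid_\kappa^*(M,\phi))(\tau)=\phi(\tau)^{-2\kappa}\rho_L^*(M,\phi)^{-1}f(M\tau)$. For $\beta\in L'/L$ with $q(\beta)\in\mathbb Z$ and $s\in\mathbb C$ with $\Re(s)>1-\kappa/2$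 put $$E_\beta(\tau,s)=\frac12\sum_{(M,\phi)\in\tilde\Gamma_\infty\backslash\operatorname{Mp}_2(\mathbb Z)}(\mathfrak e_\beta y^s)\mid_\kappa^*(M,\phi).$$ For $c\in\mathbb Z\setminus\{0\}$ put $$H_c^*(\beta,m,\gamma,n)=\frac{e^{-\pi i\operatorname{sgn}(c)\kappa/2}}{|c|}\sum_{\substack{d\;(c)^*\\ \left(\begin{smallmatrix}a&b\\c&d\end{smallmatrix}\right)\in\Gamma_\infty\backslash\Gamma_1/\Gamma_\infty}}\rho_{\beta\gamma}\widetilde{\begin{pmatrix}a&b\\c&d\end{pmatrix}}\;e\!\left(\frac{ma+nd}{c}\right),$$ the sum running over the primitive residues $d$ modulo $c$, with a matrix in $\Gamma_1$ with lower row $(c\;d)$ chosen for each. Finally put $\mathcal W_s(y)=|y|^{-\kappa/2}W_{\operatorname{sgn}(y)\kappa/2,\,(1-\kappa)/2-s}(|y|)$ for real $y\ne0$, where $W_{\nu,\mu}$ is the usual $W$-Whittaker function. **Proposition.** The series defining $E_\beta(\tau,s)$ and the series over $c$ below converge absolutely, and $E_\beta$ has the (absolutely convergent) Fourier expansion $$E_\beta(\tau,s)=\sum_{\gamma\in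 L'/L}\ \sum_{n\in\mathbb Z-q(\gamma)}c_\beta(\gamma,n,s,y)\,e(nx)\,\mathfrak e_\gamma ,$$ where the coefficients $c_\beta(\gamma,n,s,y)$ are equal to $$\begin{cases} \displaystyle(\delta_{\beta,\gamma}+\delta_{-\beta,\gamma})y^s+2\pi y^{1-\kappa-s}\frac{\Gamma(\kappa+2s-1)}{\Gamma(\kappa+s)\Gamma(s)}\sum_{c\in\mathbb Z\setminus\{0\}}|2c|^{1-\kappa-2s}H_c^*(\beta,0,\gamma,0),& n=0,\\[2ex] \displaystyle\frac{2^\kappa\pi^{s+\kappa}|n|^{s+\kappa-1}}{\Gamma(s+\kappa)}\mathcal W_s(4\pi ny)\sum_{c\in\mathbb Z\setminus\{0\}}|c|^{1-\kappa-2s}H_c^*(\beta,0,\gamma,n),& n>0,\\[2ex] \displaystyle\frac{2^\kappa\pi^{s+\kappa}|n|^{s+\kappa-1}}{\Gamma(s)}\mathcal W_s(4\pi ny)\sum_{c\in\mathbb Z\setminus\{0\}}|c|^{1-\kappa-2s}H_c^*(\beta,0,\gamma,n),& n<0, \end{cases}$$ with the convention $1/\Gamma(s)=0$ for $s\in\{0,-1,-2,\dots\}$.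 -/

import Mathlib

open UpperHalfPlane
open scoped MatrixGroups Manifold
noncomputable section

/-! ## The metaplectic group -/

/-- `e(z) = exp(2πiz)`. -/
def e (z : ℂ) : ℂ := Complex.exp (2 * Real.pi * Complex.I * z)

/-- The automorphy factor `cτ + d` of `M = (a b; c d)`. -/
def autFactor (M : SL(2, ℤ)) (τ : ℍ) : ℂ := ((M 1 0 : ℤ) : ℂ) * τ + ((M 1 1 : ℤ) : ℂ)

theorem autFactor_eq_denom (M : SL(2, ℤ)) (τ : ℍ) : autFactor M τ = denom M τ := by
  simp [autFactor, ModularGroup.denom_apply]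

theorem autFactor_ne_zero (M : SL(2, ℤ)) (τ : ℍ) : autFactor M τ ≠ 0 := by
  rw [autFactor_eq_denom]; exact denom_ne_zero _ _

theorem autFactor_mul (M N : SL(2, ℤ)) (τ : ℍ) :
    autFactor (M * N) τ = autFactor M (N • τ) * autFactor N τ := by
  have h := autFactor_ne_zero N τ
  unfold autFactor at *
  rw [UpperHalfPlane.coe_specialLinearGroup_apply]
  simp [Matrix.mul_apply, Fin.sum_univ_two]
  field_simp
  ring

/-- `Mp₂(ℤ)`: pairs `(M, φ)` with `M = (a b; c d) ∈ SL₂(ℤ)` and `φ : ℍ → ℂ` a holomorphic square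
root of `τ ↦ cτ + d`. -/
@[ext]
structure Mp2Z where
  mat : SL(2, ℤ)
  root : ℍ → ℂ
  holo : MDifferentiable 𝓘(ℂ) 𝓘(ℂ) root
  sq : ∀ τ, root τ ^ 2 = autFactor mat τ

namespace Mp2Z

theorem root_ne_zero (g : Mp2Z) (τ : ℍ) : g.root τ ≠ 0 := by
  intro h
  have := g.sq τ
  rw [h] at this
  exact autFactor_ne_zero g.mat τ (by simpa using this.symm)

theorem mdiff_smul (M : SL(2, ℤ)) : MDifferentiable 𝓘(ℂ) 𝓘(ℂ) (fun τ : ℍ => M • τ) :=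
  UpperHalfPlane.mdifferentiable_smul (g := (M : GL (Fin 2) ℝ)) (by simp)

instance : One Mp2Z := ⟨1, fun _ => 1, mdifferentiable_const, by simp [autFactor]⟩

/-- `(M, φ)(N, ψ) = (MN, φ(Nτ)ψ(τ))`. -/
instance : Mul Mp2Z := ⟨fun g h =>
  ⟨g.mat * h.mat, fun τ => g.root (h.mat • τ) * h.root τ,
    (g.holo.comp (mdiff_smul h.mat)).mul h.holo, fun τ => by
      rw [autFactor_mul, mul_pow, g.sq, h.sq]⟩⟩


instance : Inv Mp2Z := ⟨fun g =>
  ⟨g.mat⁻¹, fun τ => (g.root (g.mat⁻¹ • τ))⁻¹,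
    UpperHalfPlane.mdifferentiable_iff.mpr
      ((UpperHalfPlane.mdifferentiable_iff.mp (g.holo.comp (mdiff_smul g.mat⁻¹))).inv
        fun _ _ => g.root_ne_zero _),
    fun τ => by
      have h := autFactor_mul g.mat g.mat⁻¹ τ
      have h1 : autFactor (1 : SL(2, ℤ)) τ = 1 := by simp [autFactor]
      rw [mul_inv_cancel, h1] at h
      rw [inv_pow, g.sq]
      rw [inv_eq_iff_eq_inv]; exact eq_inv_of_mul_eq_one_left h.symm⟩⟩

@[simp] theorem one_mat : (1 : Mp2Z).mat = 1 := rfl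
@[simp] theorem one_root (τ : ℍ) : (1 : Mp2Z).root τ = 1 := rfl
@[simp] theorem mul_mat (g h : Mp2Z) : (g * h).mat = g.mat * h.mat := rfl
@[simp] theorem mul_root (g h : Mp2Z) (τ : ℍ) :
    (g * h).root τ = g.root (h.mat • τ) * h.root τ := rfl
@[simp] theorem inv_mat (g : Mp2Z) : (g⁻¹).mat = g.mat⁻¹ := rfl
@[simp] theorem inv_root (g : Mp2Z) (τ : ℍ) : (g⁻¹).root τ = (g.root (g.mat⁻¹ • τ))⁻¹ := rfl

instance : Group Mp2Z := Group.ofLeftAxioms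
  (fun a b c => Mp2Z.ext (mul_assoc _ _ _) (by ext τ; simp [mul_smul, mul_assoc]))
  (fun a => Mp2Z.ext (one_mul _) (by ext τ; simp))
  (fun a => Mp2Z.ext (inv_mul_cancel _) (by
    ext τ
    have := a.root_ne_zero τ
    simp [this]))

theorem autFactor_mem_slitPlane {M : SL(2, ℤ)} (h : M 1 0 ≠ 0) (τ : ℍ) :
    autFactor M τ ∈ Complex.slitPlane := by
  rw [Complex.mem_slitPlane_iff]
  right
  have := τ.im_pos.ne'
  simp [autFactor, h, this]

/-- `M ↦ M̃ = (M, √(cτ + d))`, with the principal branch of the square root. -/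
def lift (M : SL(2, ℤ)) : Mp2Z where
  mat := M
  root τ := autFactor M τ ^ (1 / 2 : ℂ)
  holo := by
    rw [UpperHalfPlane.mdifferentiable_iff]
    by_cases h : M 1 0 = 0
    · refine (differentiableOn_const (((M 1 1 : ℤ) : ℂ) ^ (1 / 2 : ℂ))).congr fun z _ => ?_
      simp [autFactor, h]
    · have h1 : DifferentiableOn ℂ (fun z : ℂ => ((M 1 0 : ℤ) : ℂ) * z + ((M 1 1 : ℤ) : ℂ))
          {z | 0 < z.im} := by fun_prop
      refine (h1.cpow_const (c := 1 / 2) fun z hz => ?_).congr fun z hz => ?_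
      · exact autFactor_mem_slitPlane h ⟨z, hz⟩
      · simp [autFactor, UpperHalfPlane.ofComplex_apply_of_im_pos hz]
  sq τ := by
    rw [← Complex.cpow_nat_mul]
    simp

/-- `S = ((0 -1; 1 0), √τ)`. -/
def S : Mp2Z := lift ModularGroup.S
/-- `T = ((1 1; 0 1), 1)`. -/
def T : Mp2Z := lift ModularGroup.T

theorem root_T (τ : ℍ) : T.root τ = 1 := by
  simp [T, lift, autFactor, ModularGroup.T]

theorem root_S (τ : ℍ) : S.root τ = (τ : ℂ) ^ (1 / 2 : ℂ) := by
  simp [S, lift, autFactor, ModularGroup.S]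

/-- The fibres of `Mp₂(ℤ) → SL₂(ℤ)`. -/
theorem eq_or_neg {g h : Mp2Z} (hm : g.mat = h.mat) :
    g = h ∨ ∀ τ, g.root τ = - h.root τ := by
  have hs : ∀ τ, (g.root τ - h.root τ) * (g.root τ + h.root τ) = 0 := fun τ => by
    have := g.sq τ
    have h2 := h.sq τ
    rw [hm] at this
    linear_combination this - h2
  have := (UpperHalfPlane.mul_eq_zero_iff (f := g.root - h.root) (g := g.root + h.root)
    (g.holo.sub h.holo) (g.holo.add h.holo)).mp (funext hs)
  rcases this with h1 | h1
  · left
    exact Mp2Z.ext hm (sub_eq_zero.mp h1)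
  · right
    intro τ
    exact eq_neg_of_add_eq_zero_left (congrFun h1 τ)

theorem S_pow_four_mat : (S ^ 4).mat = 1 := by
  have : ModularGroup.S * ModularGroup.S * ModularGroup.S * ModularGroup.S = 1 := by decide
  simp only [pow_succ, pow_zero, one_mul]; exact this

theorem S_pow_four_root (τ : ℍ) : (S ^ 4).root τ = -1 := by
  have h2 : (S ^ 2).mat = -1 := by
    have : ModularGroup.S * ModularGroup.S = -1 := by decide
    rw [pow_two]; exact this
  have h1 : S ^ 4 = S ^ 2 * S ^ 2 := by rw [← pow_add]
  rw [h1, mul_root, h2]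
  have h3 : (-1 : SL(2, ℤ)) • τ = τ := by simp
  have h4 := (S ^ 2).sq τ
  rw [h3, ← pow_two, h4, h2]
  simp [autFactor]

/-- The projection `Mp₂(ℤ) → SL₂(ℤ)`. -/
def matHom : Mp2Z →* SL(2, ℤ) where
  toFun := mat
  map_one' := rfl
  map_mul' _ _ := rfl

theorem closure_S_T : Subgroup.closure {S, T} = ⊤ := by
  rw [eq_top_iff]
  intro g _
  have h1 : g.mat ∈ (Subgroup.closure {S, T}).map matHom := by
    rw [MonoidHom.map_closure]
    have : matHom '' {S, T} = {ModularGroup.S, ModularGroup.T} := by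
      rw [Set.image_pair]; rfl
    rw [this, SpecialLinearGroup.SL2Z_generators]
    trivial
  obtain ⟨h, hh, hm⟩ := h1
  rcases eq_or_neg (g := g) (h := h) hm.symm with rfl | hr
  · exact hh
  · have : g = h * S ^ 4 := by
      refine Mp2Z.ext ?_ ?_
      · rw [mul_mat, S_pow_four_mat, mul_one]; exact hm.symm
      · ext τ
        rw [mul_root, S_pow_four_root, S_pow_four_mat, hr]
        simp
    rw [this]
    exact mul_mem hh (pow_mem (Subgroup.subset_closure (by simp)) _)


theorem pow_two_eq_one_of_mat {g : Mp2Z} (h : g.mat = 1) : g ^ 2 = 1 := by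
  rcases eq_or_neg (g := g) (h := 1) h with rfl | hr
  · simp
  · refine Mp2Z.ext (by rw [pow_two, mul_mat, h]; simp) ?_
    ext τ
    rw [pow_two, mul_root, hr, hr]
    simp

theorem S_pow_eight : S ^ 8 = 1 := by
  have := pow_two_eq_one_of_mat S_pow_four_mat
  rwa [← pow_mul] at this

theorem ST_pow_twelve : (S * T) ^ 12 = 1 := by
  have h : ((S * T) ^ 6).mat = 1 := by
    have h6 : (ModularGroup.S * ModularGroup.T) ^ 6 = 1 := by decide
    have : ((S * T) ^ 6).mat = matHom ((S * T) ^ 6) := rfl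
    rw [this, map_pow]
    exact h6
  have := pow_two_eq_one_of_mat h
  rwa [← pow_mul] at this

theorem submonoid_eq_top (P : Submonoid Mp2Z) (hS : S ∈ P) (hT : T ∈ P) : P = ⊤ := by
  have hSi : S⁻¹ ∈ P := by
    have : S⁻¹ = S ^ 7 := inv_eq_of_mul_eq_one_right (by rw [← pow_succ', S_pow_eight])
    rw [this]; exact pow_mem hS _
  have hTi : T⁻¹ ∈ P := by
    have : T⁻¹ = (S * T) ^ 11 * S := by
      have h := ST_pow_twelve
      rw [pow_succ', mul_assoc] at h
      apply inv_eq_of_mul_eq_one_right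
      rw [← mul_assoc]
      exact (mul_eq_one_iff_eq_inv.mpr (eq_inv_of_mul_eq_one_right h))
    rw [this]; exact mul_mem (pow_mem (mul_mem hS hT) _) hS
  rw [eq_top_iff]
  intro g _
  have hg : g ∈ Subgroup.closure {S, T} := by rw [closure_S_T]; trivial
  induction hg using Subgroup.closure_induction'' with
  | one => exact one_mem _
  | mem x hx => rcases hx with rfl | rfl <;> assumption
  | inv_mem x hx => rcases hx with rfl | rfl <;> assumption
  | mul x y _ _ hx hy => exact mul_mem (hx trivial) (hy trivial)

/-- A functional relation stable under products that relates something to both generators is the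
graph of a homomorphism. -/
theorem exists_hom {U : Type*} [Monoid U] (R : Submonoid (Mp2Z × U))
    (huniq : ∀ g u u', (g, u) ∈ R → (g, u') ∈ R → u = u') {s t : U}
    (hS : (S, s) ∈ R) (hT : (T, t) ∈ R) :
    ∃ ρ : Mp2Z →* U, ρ S = s ∧ ρ T = t ∧ ∀ g, (g, ρ g) ∈ R := by
  have hex : ∀ g : Mp2Z, ∃ u, (g, u) ∈ R := by
    have := submonoid_eq_top (R.map (MonoidHom.fst Mp2Z U)) ⟨_, hS, rfl⟩ ⟨_, hT, rfl⟩
    intro g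
    have hg : g ∈ R.map (MonoidHom.fst Mp2Z U) := by rw [this]; trivial
    obtain ⟨⟨g', u⟩, hu, rfl⟩ := hg
    exact ⟨u, hu⟩
  choose f hf using hex
  exact ⟨⟨⟨f, huniq _ _ _ (hf 1) (one_mem R)⟩,
    fun g h => huniq _ _ _ (hf _) (mul_mem (hf g) (hf h))⟩,
    huniq _ _ _ (hf _) hS, huniq _ _ _ (hf _) hT, hf⟩

end Mp2Z

/-! ## Even lattices and discriminant forms -/

/-- An even lattice `L` of full rank in a non-degenerate real quadratic space `(V, q)`. The bilinear
form is `(x, y) = q(x + y) - q(x) - q(y)` (Mathlib's `polarBilin`), so that `q(x) = (x, x) / 2`. -/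
structure EvenLattice (V : Type*) [AddCommGroup V] [Module ℝ V] where
  /-- the quadratic form `q` -/
  form : QuadraticForm ℝ V
  nondeg : form.polarBilin.Nondegenerate
  /-- the lattice `L` -/
  lat : Submodule ℤ V
  exists_basis : ∃ (r : ℕ) (b : Module.Basis (Fin r) ℝ V), lat = Submodule.span ℤ (Set.range b)
  even : ∀ x ∈ lat, ∃ n : ℤ, form x = n

namespace EvenLattice
variable {V : Type*} [AddCommGroup V] [Module ℝ V] (Λ : EvenLattice V)

/-- The dual lattice `L'` of all `x` with `(x, y) ∈ ℤ` for all `y ∈ L`. -/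
def dual : Submodule ℤ V := LinearMap.BilinForm.dualSubmodule Λ.form.polarBilin Λ.lat

/-- The discriminant group `L'/L`. -/
def Disc : Type _ := Λ.dual ⧸ Λ.lat.submoduleOf Λ.dual

instance : AddCommGroup Λ.Disc :=
  inferInstanceAs (AddCommGroup (Λ.dual ⧸ Λ.lat.submoduleOf Λ.dual))

/-- The projection `L' → L'/L`. -/
def toDisc : Λ.dual →+ Λ.Disc := (Submodule.mkQ (Λ.lat.submoduleOf Λ.dual)).toAddMonoidHom

theorem toDisc_surjective : Function.Surjective Λ.toDisc := Submodule.mkQ_surjective _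

theorem toDisc_eq {x y : Λ.dual} : Λ.toDisc x = Λ.toDisc y ↔ (x - y : V) ∈ Λ.lat := by
  change Submodule.Quotient.mk x = Submodule.Quotient.mk y ↔ _
  rw [Submodule.Quotient.eq]
  simp [Submodule.submoduleOf]

theorem mem_dual {x : V} : x ∈ Λ.dual ↔ ∀ y ∈ Λ.lat, ∃ n : ℤ, Λ.form.polarBilin x y = n := by
  rw [dual, LinearMap.BilinForm.mem_dualSubmodule]
  refine forall₂_congr fun y _ => ?_
  rw [Submodule.mem_one]
  simp [eq_comm]

theorem lat_le_dual : Λ.lat ≤ Λ.dual := by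
  intro x hx
  rw [mem_dual]
  intro y hy
  obtain ⟨a, ha⟩ := Λ.even _ (add_mem hx hy)
  obtain ⟨b, hb⟩ := Λ.even _ hx
  obtain ⟨c, hc⟩ := Λ.even _ hy
  exact ⟨a - b - c, by simp [QuadraticMap.polar, ha, hb, hc]⟩

theorem form_congr (x y : Λ.dual) (h : (x - y : V) ∈ Λ.lat) :
    ((Λ.form x : ℝ) : UnitAddCircle) = ((Λ.form y : ℝ) : UnitAddCircle) := by
  obtain ⟨n, hn⟩ := Λ.even _ h
  obtain ⟨m, hm⟩ := Λ.mem_dual.mp y.2 _ h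
  have h1 : Λ.form x = Λ.form y + (n + m : ℤ) := by
    have := QuadraticMap.map_add Λ.form (y : V) (x - y : V)
    rw [add_sub_cancel, hn] at this
    rw [this]
    have hm' : QuadraticMap.polar Λ.form (y : V) (x - y : V) = m := hm
    rw [hm']; push_cast; ring
  rw [h1, AddCircle.coe_add]
  have : ((n + m : ℤ) : ℝ) = (n + m : ℤ) • (1 : ℝ) := by simp
  rw [this, AddCircle.coe_zsmul, AddCircle.coe_period, smul_zero, add_zero]

/-- The `ℝ/ℤ`-valued quadratic form `x + L ↦ q(x) mod ℤ` on `L'/L`. -/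
def discForm (γ : Λ.Disc) : UnitAddCircle :=
  Quotient.liftOn' γ (fun x : Λ.dual => ((Λ.form x : ℝ) : UnitAddCircle)) fun x y h =>
    Λ.form_congr x y (by
      have : Submodule.Quotient.mk (p := Λ.lat.submoduleOf Λ.dual) x = Submodule.Quotient.mk y :=
        Quotient.sound' h
      exact Λ.toDisc_eq.mp this)

theorem discForm_mk (x : Λ.dual) : Λ.discForm (Λ.toDisc x) = ((Λ.form x : ℝ) : UnitAddCircle) := rfl

/-- The `ℝ/ℤ`-valued pairing `(x + L, y + L) ↦ (x, y) mod ℤ` on `L'/L`. -/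
def discPairing (γ δ : Λ.Disc) : UnitAddCircle := QuadraticMap.polar Λ.discForm γ δ

theorem discPairing_mk (x y : Λ.dual) :
    Λ.discPairing (Λ.toDisc x) (Λ.toDisc y) = ((Λ.form.polarBilin x y : ℝ) : UnitAddCircle) := by
  rw [discPairing, QuadraticMap.polar, ← map_add, discForm_mk, discForm_mk, discForm_mk,
    ← AddCircle.coe_sub, ← AddCircle.coe_sub]
  rfl

/-- The signature is `(b⁺, b⁻)`. -/
def bPos : ℕ := sigPos Λ.form

/-- The signature is `(b⁺, b⁻)`. -/
def bNeg : ℕ := sigNeg Λ.form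

/-- `b⁺ - b⁻`. -/
def signature : ℤ := Λ.bPos - Λ.bNeg

end EvenLattice

/-! ## Existence of the Weil representation

The rest of this part proves that the operators that define `ρ_L(T)` and `ρ_L(S)` extend to a
representation of `Mp₂(ℤ)`: first for lattices of rank one, by the transformation behaviour of
Jacobi theta functions, then for diagonal lattices, by tensor products, then in general, by
restriction along a diagonal sublattice. -/

namespace Mp2Z

/-- Auxiliary: the Jacobi slash operator of weight one half and index `a`. -/
def thetaSlash (a : ℕ) (g : Mp2Z) (f : ℍ × ℂ → ℂ) : ℍ × ℂ → ℂ := fun p =>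
  (g.root p.1)⁻¹ * e (-(a * (g.mat 1 0 : ℤ) * p.2 ^ 2 / autFactor g.mat p.1)) *
    f (g.mat • p.1, p.2 / autFactor g.mat p.1)

theorem e_add (x y : ℂ) : e (x + y) = e x * e y := by
  rw [e, e, e, ← Complex.exp_add]; ring_nf

theorem e_int (n : ℤ) : e n = 1 := by
  rw [e, mul_comm]; exact Complex.exp_int_mul_two_pi_mul_I n

theorem thetaSlash_one (a : ℕ) (f : ℍ × ℂ → ℂ) : thetaSlash a 1 f = f := by
  funext p
  simp [thetaSlash, autFactor, e]

theorem thetaSlash_mul (a : ℕ) (g h : Mp2Z) (f : ℍ × ℂ → ℂ) :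
    thetaSlash a (g * h) f = thetaSlash a h (thetaSlash a g f) := by
  funext p
  obtain ⟨τ, z⟩ := p
  have h1 := autFactor_ne_zero h.mat τ
  have h2 := autFactor_ne_zero g.mat (h.mat • τ)
  have h3 := autFactor_mul g.mat h.mat τ
  have h4 : (((g * h).mat 1 0 : ℤ) : ℂ) * autFactor h.mat τ =
      (g.mat 1 0 : ℤ) + (h.mat 1 0 : ℤ) * autFactor (g.mat * h.mat) τ := by
    have hd : ((h.mat 0 0 : ℤ) : ℂ) * (h.mat 1 1 : ℤ) - (h.mat 0 1 : ℤ) * (h.mat 1 0 : ℤ) = 1 := by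
      have := h.mat.det_coe
      rw [Matrix.det_fin_two] at this
      exact_mod_cast this
    simp only [mul_mat, autFactor, Matrix.SpecialLinearGroup.coe_mul, Matrix.mul_apply,
      Fin.sum_univ_two, Int.cast_add, Int.cast_mul]
    linear_combination ((g.mat 1 0 : ℤ) : ℂ) * hd
  simp only [thetaSlash]
  have h5 : -(a * ((g * h).mat 1 0 : ℤ) * z ^ 2 / autFactor (g * h).mat τ) =
      -(a * (h.mat 1 0 : ℤ) * z ^ 2 / autFactor h.mat τ) +
      -(a * (g.mat 1 0 : ℤ) * (z / autFactor h.mat τ) ^ 2 / autFactor g.mat (h.mat • τ)) := by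
    rw [mul_mat] at h4 ⊢
    rw [h3] at h4 ⊢
    field_simp
    linear_combination (-(a * z ^ 2) : ℂ) * h4
  rw [h5, e_add, mul_root, mul_mat, mul_smul, h3, div_div, mul_inv, mul_comm (autFactor g.mat _)]
  ring

/-- Auxiliary: the Jacobi theta functions of rank one lattices. -/
def theta (N : ℕ) (k : ZMod N) : ℍ × ℂ → ℂ := fun p =>
  ∑' m : ℤ, if (m : ZMod N) = k then e (m ^ 2 * p.1 / (2 * N) + m * p.2) else 0

theorem e_eq_theta_term (N : ℕ) (hN : 0 < N) (m : ℤ) (τ z : ℂ) :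
    e (m ^ 2 * τ / (2 * N) + m * z) = jacobiTheta₂_term m z (τ / N) := by
  rw [e, jacobiTheta₂_term]
  congr 1
  have : (N : ℂ) ≠ 0 := by exact_mod_cast hN.ne'
  field_simp
  ring

theorem summable_theta (N : ℕ) (hN : 0 < N) (k : ZMod N) (p : ℍ × ℂ) :
    Summable fun m : ℤ =>
      if (m : ZMod N) = k then e (m ^ 2 * p.1 / (2 * N) + m * p.2) else 0 := by
  have h : Summable fun m : ℤ => e (m ^ 2 * p.1 / (2 * N) + m * p.2) := by
    simp_rw [e_eq_theta_term N hN]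
    rw [summable_jacobiTheta₂_term_iff]
    have := p.1.im_pos
    simp only [Complex.div_natCast_im, coe_im]
    positivity
  refine (h.norm.of_norm_bounded fun m => ?_)
  split_ifs <;> simp

theorem theta_T {a : ℕ} (k : ZMod (2 * a)) (ha : 0 < a) :
    thetaSlash a T (theta (2 * a) k) = fun p => e (k.val ^ 2 / (4 * a)) * theta (2 * a) k p := by
  have : NeZero (2 * a) := ⟨by omega⟩
  have ha' : (a : ℂ) ≠ 0 := by exact_mod_cast ha.ne'
  funext ⟨τ, z⟩
  have hT : T.mat = ModularGroup.T := rfl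
  have h1 : autFactor ModularGroup.T τ = 1 := by simp [autFactor, ModularGroup.T]
  have h10 : ModularGroup.T 1 0 = 0 := by simp [ModularGroup.T]
  simp only [thetaSlash, root_T, hT, h1, h10, theta]
  simp only [← tsum_mul_left]
  simp only [Int.cast_zero, mul_zero, zero_mul, neg_zero, inv_one, one_mul, div_one]
  rw [show e 0 = 1 by simp [e]]
  simp only [one_mul]
  refine tsum_congr fun m => ?_
  split_ifs with hm
  · rw [← e_add]
    have : ((ModularGroup.T • τ : ℍ) : ℂ) = 1 + τ := by
      rw [UpperHalfPlane.modular_T_smul]; simp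
    rw [this]
    obtain ⟨c, hc⟩ : ∃ c : ℤ, m = k.val + (2 * a : ℕ) * c := by
      have : ((m : ℤ) : ZMod (2 * a)) = ((k.val : ℤ) : ZMod (2 * a)) := by simp [hm]
      rw [ZMod.intCast_eq_intCast_iff_dvd_sub] at this
      obtain ⟨c, hc⟩ := this
      exact ⟨-c, by linear_combination -hc⟩
    have h2 : (m ^ 2 * (1 + τ) / (2 * (2 * a : ℕ)) + m * z : ℂ) =
        (k.val ^ 2 / (4 * a) + (m ^ 2 * τ / (2 * (2 * a : ℕ)) + m * z)) +
          ((k.val * c + a * c ^ 2 : ℤ) : ℂ) := by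
      rw [hc]
      push_cast
      field_simp
      ring
    rw [h2, e_add, e_int, mul_one]
  · simp


theorem theta_eq {N : ℕ} (hN : 0 < N) (k : ZMod N) (τ : ℍ) (z : ℂ) :
    theta N k (τ, z) = e (k.val ^ 2 * τ / (2 * N) + k.val * z) *
      jacobiTheta₂ (k.val * τ + N * z) (N * τ) := by
  have : NeZero N := ⟨hN.ne'⟩
  have hN' : (N : ℂ) ≠ 0 := by exact_mod_cast hN.ne'
  let i : ℤ → ℤ := fun n => k.val + N * n
  have hi : Function.Injective i := by
    intro x y h
    simpa [i, hN.ne'] using h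
  rw [theta, ← hi.tsum_eq, jacobiTheta₂, ← tsum_mul_left]
  · refine tsum_congr fun n => ?_
    rw [if_pos (by simp [i]), jacobiTheta₂_term, e, e, ← Complex.exp_add]
    congr 1
    simp only [i]
    push_cast
    field_simp
    ring
  · intro m hm
    simp only [Function.mem_support, ne_eq, ite_eq_right_iff, Classical.not_imp] at hm
    have : ((m : ℤ) : ZMod N) = ((k.val : ℤ) : ZMod N) := by simp [hm.1]
    rw [ZMod.intCast_eq_intCast_iff_dvd_sub] at this
    obtain ⟨c, hc⟩ := this
    exact ⟨-c, by simp only [i]; linear_combination hc⟩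

theorem sum_theta {N : ℕ} (hN : 0 < N) [NeZero N] (k : ℤ) (τ : ℍ) (z : ℂ) :
    ∑ l : ZMod N, e (-(k * l.val / N)) * theta N l (τ, z) = jacobiTheta₂ (z - k / N) (τ / N) := by
  have hN' : (N : ℂ) ≠ 0 := by exact_mod_cast hN.ne'
  simp_rw [theta, ← tsum_mul_left]
  rw [← Summable.tsum_finsetSum fun l _ => (summable_theta N hN l (τ, z)).mul_left _]
  refine tsum_congr fun m => ?_
  simp only [mul_ite, mul_zero]
  rw [Finset.sum_ite_eq]
  simp only [Finset.mem_univ, if_true]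
  obtain ⟨c, hc⟩ : ∃ c : ℤ, m = ((m : ZMod N).val : ℤ) + N * c := by
    have : ((m : ℤ) : ZMod N) = ((((m : ZMod N).val : ℤ) : ℤ) : ZMod N) := by simp
    rw [ZMod.intCast_eq_intCast_iff_dvd_sub] at this
    obtain ⟨c, hc⟩ := this
    exact ⟨-c, by linear_combination -hc⟩
  have h1 : -(k * (m : ZMod N).val / N : ℂ) = -(k * m / N) + ((k * c : ℤ) : ℂ) := by
    have : (m : ℂ) = ((m : ZMod N).val : ℂ) + N * c := by exact_mod_cast hc
    rw [this]
    push_cast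
    field_simp
    ring
  rw [h1, e_add, e_int, mul_one, ← e_add, e, jacobiTheta₂_term]
  congr 1
  field_simp
  ring

theorem sqrt_aux {N : ℕ} (hN : 0 < N) (τ : ℍ) :
    (τ : ℂ) ^ (1 / 2 : ℂ) = (-Complex.I * (τ / N)) ^ (1 / 2 : ℂ) *
      (Complex.I ^ (1 / 2 : ℂ) * (Real.sqrt N : ℝ)) := by
  have hNr : (0 : ℝ) < N := by exact_mod_cast hN
  have hN' : (N : ℂ) ≠ 0 := by exact_mod_cast hN.ne'
  set w : ℂ := -Complex.I * (τ / N) with hw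
  have hre : 0 < w.re := by
    have : w.re = τ.im / N := by simp [hw]
    rw [this]
    exact div_pos τ.im_pos hNr
  have hw0 : w ≠ 0 := fun h => by simp [h] at hre
  have harg := abs_lt.mp (Complex.abs_arg_lt_pi_div_two_iff.mpr (Or.inl hre))
  have h1 : (τ : ℂ) = (N : ℝ) * (Complex.I * w) := by
    rw [hw, Complex.ofReal_natCast]
    field_simp
    simp
  have hpi := Real.pi_pos
  have h2 : Complex.log (Complex.I * w) = Complex.log Complex.I + Complex.log w := by
    refine Complex.log_mul Complex.I_ne_zero hw0 ?_
    rw [Complex.arg_I]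
    constructor <;> linarith
  rw [h1, Complex.cpow_def_of_ne_zero (mul_ne_zero (by simpa using hN') (by simp [hw0])),
    Complex.log_ofReal_mul hNr (by simp [hw0]), h2, Complex.cpow_def_of_ne_zero hw0,
    Complex.cpow_def_of_ne_zero Complex.I_ne_zero, Real.sqrt_eq_rpow, Complex.ofReal_cpow hNr.le,
    Complex.cpow_def_of_ne_zero (by simpa using hN'), Complex.ofReal_log hNr.le,
    ← Complex.exp_add, ← Complex.exp_add]
  congr 1
  push_cast
  ring

theorem theta_S {a : ℕ} (ha : 0 < a) [NeZero (2 * a)] (k : ZMod (2 * a)) :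
    thetaSlash a S (theta (2 * a) k) = fun p => ∑ l : ZMod (2 * a),
      ((Complex.I ^ (1 / 2 : ℂ))⁻¹ / (Real.sqrt (2 * a : ℕ) : ℝ) *
        e (-(k.val * l.val / (2 * a : ℕ)))) * theta (2 * a) l p := by
  have ha' : (a : ℂ) ≠ 0 := by exact_mod_cast ha.ne'
  have hN : 0 < 2 * a := by omega
  funext ⟨τ, z⟩
  have hτ : (τ : ℂ) ≠ 0 := τ.ne_zero
  have hS : S.mat = ModularGroup.S := rfl
  have h1 : autFactor ModularGroup.S τ = τ := by simp [autFactor, ModularGroup.S]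
  have h10 : ModularGroup.S 1 0 = 1 := by simp [ModularGroup.S]
  have hsm : ((ModularGroup.S • τ : ℍ) : ℂ) = -1 / τ := by
    rw [UpperHalfPlane.modular_S_smul]; simp [neg_div, inv_neg]
  have h2 := sum_theta hN (k.val : ℤ) τ z
  simp_rw [mul_assoc, ← Finset.mul_sum]
  simp only [Int.cast_natCast] at h2
  rw [h2, jacobiTheta₂_functional_equation]
  simp only [thetaSlash, root_S, hS, h1, h10]
  rw [theta_eq hN, hsm, sqrt_aux hN τ]
  have h3 : (k.val * (-1 / τ) + (2 * a : ℕ) * (z / τ) : ℂ) =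
      (z - k.val / (2 * a : ℕ)) / (τ / (2 * a : ℕ)) := by
    push_cast; field_simp; ring
  have h4 : ((2 * a : ℕ) * (-1 / τ) : ℂ) = -1 / (τ / (2 * a : ℕ)) := by
    push_cast; field_simp
  have h5 : Complex.exp (-Real.pi * Complex.I * (z - k.val / (2 * a : ℕ)) ^ 2 / (τ / (2 * a : ℕ))) =
      e (-(a * (1 : ℤ) * z ^ 2 / τ)) * e (k.val ^ 2 * (-1 / τ) / (2 * (2 * a : ℕ)) + k.val * (z / τ)) := by
    rw [← e_add, e]
    congr 1
    push_cast; field_simp; ring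
  rw [h3, h4, h5]
  ring

theorem theta_ne_zero {N : ℕ} (hN : 0 < N) (k : ZMod N) : theta N k ≠ 0 := by
  intro h
  have hN' : (N : ℂ) ≠ 0 := by exact_mod_cast hN.ne'
  have h1 := congrFun h (UpperHalfPlane.I, -(k.val * UpperHalfPlane.I / N))
  rw [theta_eq hN] at h1
  have h2 : (k.val * UpperHalfPlane.I + N * (-(k.val * UpperHalfPlane.I / N)) : ℂ) = 0 := by
    field_simp; ring
  rw [h2] at h1
  have h3 : ∀ n : ℤ, jacobiTheta₂_term n 0 (N * UpperHalfPlane.I) =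
      ((Real.exp (-Real.pi * n ^ 2 * N) : ℝ) : ℂ) := by
    intro n
    rw [jacobiTheta₂_term]
    push_cast
    congr 1
    simp
    ring_nf
    simp
  have h4 : Summable fun n : ℤ => Real.exp (-Real.pi * n ^ 2 * N) := by
    have : Summable fun n : ℤ => jacobiTheta₂_term n 0 (N * UpperHalfPlane.I) := by
      rw [summable_jacobiTheta₂_term_iff]; simp [hN]
    simp_rw [h3] at this
    exact_mod_cast this
  have h5 : jacobiTheta₂ 0 (N * UpperHalfPlane.I) ≠ 0 := by
    rw [jacobiTheta₂]
    simp_rw [h3]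
    rw [← Complex.ofReal_tsum]
    exact_mod_cast (h4.tsum_pos (fun _ => (Real.exp_pos _).le) 0 (Real.exp_pos _)).ne'
  rcases mul_eq_zero.mp h1 with h6 | h6
  · exact Complex.exp_ne_zero _ h6
  · exact h5 h6

theorem theta_linearIndependent {N : ℕ} (hN : 0 < N) : LinearIndependent ℂ (theta N) := by
  have : NeZero N := ⟨hN.ne'⟩
  have hN' : (N : ℂ) ≠ 0 := by exact_mod_cast hN.ne'
  let φ : Module.End ℂ (ℍ × ℂ → ℂ) :=
    LinearMap.funLeft ℂ ℂ (fun p : ℍ × ℂ => (p.1, p.2 + 1 / N))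
  refine Module.End.eigenvectors_linearIndependent' φ (fun k : ZMod N => ZMod.stdAddChar k)
    ZMod.injective_stdAddChar _ fun k => ⟨?_, theta_ne_zero hN k⟩
  rw [Module.End.mem_eigenspace_iff]
  funext p
  simp only [φ, LinearMap.funLeft_apply, theta, Pi.smul_apply, smul_eq_mul]
  rw [← tsum_mul_left]
  refine tsum_congr fun m => ?_
  split_ifs with hm
  · rw [← hm, ZMod.stdAddChar_coe, e, e, ← Complex.exp_add]
    congr 1
    field_simp
    ring
  · simp

theorem exists_weil_rankOne {a : ℕ} (ha : 0 < a) [NeZero (2 * a)] :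
    ∃ ρ : Mp2Z →* Matrix (ZMod (2 * a)) (ZMod (2 * a)) ℂ,
      ρ S = Matrix.of (fun k l => (Complex.I ^ (1 / 2 : ℂ))⁻¹ / (Real.sqrt (2 * a : ℕ) : ℝ) *
        e (-(k.val * l.val / (2 * a : ℕ)))) ∧
      ρ T = Matrix.diagonal (fun k => e (k.val ^ 2 / (4 * a))) := by
  let R : Submonoid (Mp2Z × Matrix (ZMod (2 * a)) (ZMod (2 * a)) ℂ) :=
    { carrier := {x | ∀ k, thetaSlash a x.1 (theta (2 * a) k) =
        fun p => ∑ l, x.2 k l * theta (2 * a) l p}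
      one_mem' := fun k => by
        funext p
        simp [thetaSlash_one, Matrix.one_apply]
      mul_mem' := fun {x y} hx hy k => by
        rw [Prod.fst_mul, thetaSlash_mul, hx k]
        funext p
        have h : ∀ l, thetaSlash a y.1 (theta (2 * a) l) p = _ := fun l => congrFun (hy l) p
        have h' : thetaSlash a y.1 (fun p => ∑ l, x.2 k l * theta (2 * a) l p) p =
            ∑ l, x.2 k l * thetaSlash a y.1 (theta (2 * a) l) p := by
          simp only [thetaSlash, Finset.mul_sum]
          exact Finset.sum_congr rfl fun l _ => by ring
        rw [h']
        simp_rw [h, Prod.snd_mul, Matrix.mul_apply, Finset.mul_sum, Finset.sum_mul]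
        rw [Finset.sum_comm]
        simp only [mul_assoc] }
  obtain ⟨ρ, h1, h2, -⟩ := exists_hom R (fun g u u' hu hu' => by
      ext k l
      have h := (hu k).symm.trans (hu' k)
      have hli := Fintype.linearIndependent_iff.mp
        (theta_linearIndependent (show 0 < 2 * a by omega)) (fun l => u k l - u' k l) (by
          funext p
          have := congrFun h p
          simp only [Finset.sum_apply, Pi.smul_apply, smul_eq_mul, sub_mul, Finset.sum_sub_distrib,
            Pi.zero_apply]
          exact sub_eq_zero.mpr this) l
      exact sub_eq_zero.mp hli)
    (s := Matrix.of (fun k l => (Complex.I ^ (1 / 2 : ℂ))⁻¹ / (Real.sqrt (2 * a : ℕ) : ℝ) *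
        e (-(k.val * l.val / (2 * a : ℕ)))))
    (t := Matrix.diagonal (fun k => e (k.val ^ 2 / (4 * a))))
    (fun k => by rw [theta_S ha]; rfl)
    (fun k => by
      rw [theta_T k ha]
      funext p
      simp [Matrix.diagonal_apply])
  exact ⟨ρ, h1, h2⟩

end Mp2Z

namespace EvenLattice
variable {V : Type*} [AddCommGroup V] [Module ℝ V] (Λ : EvenLattice V)

theorem exists_orthogonal_basis : ∃ (r : ℕ) (v : Module.Basis (Fin r) ℝ V) (a : Fin r → ℤ),
    (∀ i, v i ∈ Λ.lat) ∧ (∀ i, a i ≠ 0) ∧ (∀ i, Λ.form (v i) = a i) ∧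
    (∀ i j, i ≠ j → Λ.form.polarBilin (v i) (v j) = 0) := by
  obtain ⟨r, b, hb⟩ := Λ.exists_basis
  have hbm : ∀ i, b i ∈ Λ.lat := fun i => by rw [hb]; exact Submodule.subset_span ⟨i, rfl⟩
  have hG : ∀ i j, ∃ n : ℤ, Λ.form.polarBilin (b i) (b j) = n := fun i j =>
    Λ.mem_dual.mp (Λ.lat_le_dual (hbm i)) _ (hbm j)
  choose G hG using hG
  have hsymm : ∀ x y, Λ.form.polarBilin x y = Λ.form.polarBilin y x := fun x y => by
    simp [QuadraticMap.polar_comm]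
  have hGs : ∀ i j, G i j = G j i := fun i j => by
    have := hsymm (b i) (b j)
    rw [hG, hG] at this
    exact_mod_cast this
  let B : LinearMap.BilinForm ℚ (Fin r → ℚ) := Matrix.toBilin' (Matrix.of fun i j => (G i j : ℚ))

  have hBs : LinearMap.IsSymm B := by
    refine ⟨fun x y => ?_⟩
    simp only [B, Matrix.toBilin'_apply, Matrix.of_apply, RingHom.id_apply]
    rw [Finset.sum_comm]
    refine Finset.sum_congr rfl fun i _ => Finset.sum_congr rfl fun j _ => ?_
    rw [hGs]; ring
  have : Invertible (2 : ℚ) := invertibleOfNonzero (by norm_num)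
  obtain ⟨w', hw'⟩ := LinearMap.BilinForm.exists_orthogonal_basis hBs
  obtain ⟨w, hw⟩ : ∃ w : Module.Basis (Fin r) ℚ (Fin r → ℚ), ∀ i j, i ≠ j → B (w i) (w j) = 0 := by
    refine ⟨w'.reindex (finCongr (Module.finrank_fin_fun ℚ)), fun i j hij => ?_⟩
    simp only [Module.Basis.reindex_apply]
    exact hw' (fun h => hij (by simpa using h))
  obtain ⟨m, hm⟩ := IsLocalization.exist_integer_multiples_of_finite (nonZeroDivisors ℤ)
    (fun p : Fin r × Fin r => w p.1 p.2)
  choose Z hZ using fun i j => hm (i, j)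
  have hm0 : ((m : ℤ) : ℚ) ≠ 0 := by exact_mod_cast nonZeroDivisors.ne_zero m.2
  have hZ' : ∀ i j, (Z i j : ℚ) = (m : ℤ) * w i j := fun i j => by
    have := hZ i j
    rw [Algebra.smul_def] at this
    simpa using this
  have hdet : (Matrix.of fun i j => (Z i j : ℚ)).det ≠ 0 := by
    have h1 : (Matrix.of fun i j => (Z i j : ℚ)) = ((m : ℤ) : ℚ) • Matrix.of fun i j => w i j := by
      ext i j; simp [hZ']
    have h2 : IsUnit (Matrix.of fun i j => w i j) := by
      rw [← Matrix.linearIndependent_rows_iff_isUnit]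
      exact w.linearIndependent
    rw [h1, Matrix.det_smul]
    exact mul_ne_zero (pow_ne_zero _ hm0) ((Matrix.isUnit_iff_isUnit_det _).mp h2).ne_zero
  have hdetR : IsUnit (Matrix.of fun i j => (Z i j : ℝ)) := by
    rw [Matrix.isUnit_iff_isUnit_det, isUnit_iff_ne_zero]
    have h1 : (Matrix.of fun i j => (Z i j : ℚ)).det = ((Matrix.of fun i j => Z i j).det : ℤ) := by
      rw [Int.cast_det]; rfl
    have h2 : (Matrix.of fun i j => (Z i j : ℝ)).det = ((Matrix.of fun i j => Z i j).det : ℤ) := by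
      rw [Int.cast_det]; rfl
    rw [h2]
    rw [h1] at hdet
    exact_mod_cast hdet
  let u : Fin r → V := fun i => ∑ j, (Z i j : ℝ) • b j
  have hu : LinearIndependent ℝ u := by
    have := (Matrix.linearIndependent_rows_iff_isUnit.mpr hdetR).map' b.equivFun.symm.toLinearMap
      (LinearEquiv.ker _)
    have h : u = b.equivFun.symm.toLinearMap ∘ (Matrix.of fun i j => (Z i j : ℝ)).row := by
      funext i
      simp only [Function.comp_apply, LinearEquiv.coe_coe, Module.Basis.equivFun_symm_apply]
      rfl
    rw [h]
    exact this
  have hul : ∀ i, u i ∈ Λ.lat := fun i => sum_mem fun j _ => by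
    rw [Int.cast_smul_eq_zsmul]
    exact zsmul_mem (hbm j) _
  have huo : ∀ i j, i ≠ j → Λ.form.polarBilin (u i) (u j) = 0 := fun i j hij => by
    have h1 : Λ.form.polarBilin (u i) (u j) =
        ((∑ k, ∑ l, (Z i k : ℚ) * G k l * Z j l : ℚ) : ℝ) := by
      simp only [u, map_sum, map_smul, LinearMap.sum_apply, LinearMap.smul_apply, hG,
        smul_eq_mul]
      push_cast
      rw [Finset.sum_comm]
      simp only [Finset.mul_sum]
      exact Finset.sum_congr rfl fun k _ => Finset.sum_congr rfl fun l _ => by ring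
    have h2 : (∑ k, ∑ l, (Z i k : ℚ) * G k l * Z j l : ℚ) = (m : ℤ) * (m : ℤ) * B (w i) (w j) := by
      simp only [B, Matrix.toBilin'_apply, Matrix.of_apply, hZ', Finset.mul_sum]
      exact Finset.sum_congr rfl fun k _ => Finset.sum_congr rfl fun l _ => by ring
    rw [h1, h2, hw i j hij]
    simp
  have : FiniteDimensional ℝ V := Module.Basis.finiteDimensional_of_finite b
  let v : Module.Basis (Fin r) ℝ V :=
    basisOfLinearIndependentOfCardEqFinrank' u hu (Module.finrank_eq_card_basis b).symm
  have hv : ∀ i, v i = u i := fun i => by simp [v]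
  choose a ha using fun i => Λ.even _ (hul i)
  refine ⟨r, v, a, fun i => hv i ▸ hul i, fun i hi => ?_, fun i => by rw [hv]; exact ha i,
    fun i j hij => by rw [hv, hv]; exact huo i j hij⟩
  refine v.ne_zero i (Λ.nondeg.1 _ fun y => ?_)
  have h0 : Λ.form.polarBilin (v i) = 0 := by
    refine v.ext fun j => ?_
    by_cases hij : i = j
    · subst hij
      rw [hv, QuadraticMap.polarBilin_apply_apply, QuadraticMap.polar_self, ha, hi]
      simp
    · rw [hv, hv, huo i j hij]; rfl
  rw [h0]; rfl

end EvenLattice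

/-- `e(x) = exp(2πix)` for `x ∈ ℝ/ℤ`. -/
def eMod (x : UnitAddCircle) : ℂ := (AddCircle.toCircle x : ℂ)

theorem eMod_coe (x : ℝ) : eMod (x : UnitAddCircle) = e x := by
  rw [eMod, AddCircle.toCircle_apply_mk, Circle.coe_exp, e]
  congr 1
  push_cast
  ring

theorem eMod_add (x y : UnitAddCircle) : eMod (x + y) = eMod x * eMod y := by
  simp [eMod, AddCircle.toCircle_add]

namespace Mp2Z

theorem conj_e (x : ℝ) : (starRingEnd ℂ) (e x) = e (-x) := by
  rw [e, e, ← Complex.exp_conj]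
  congr 1
  simp [map_ofNat]

theorem norm_sqrt_I : ‖Complex.I ^ (1 / 2 : ℂ)‖ = 1 := by
  rw [Complex.norm_cpow_of_ne_zero Complex.I_ne_zero]
  simp

theorem exists_weil_rankOne' (a : ℤ) (ha : a ≠ 0) [NeZero (2 * a.natAbs)] :
    ∃ ρ : Mp2Z →* Matrix (ZMod (2 * a.natAbs)) (ZMod (2 * a.natAbs)) ℂ,
      ρ S = Matrix.of (fun k l => (Complex.I ^ (1 / 2 : ℂ)) ^ (-a.sign) /
        (Real.sqrt (2 * a.natAbs : ℕ) : ℝ) * ZMod.stdAddChar (-((a.sign : ZMod (2 * a.natAbs)) * (k * l)))) ∧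
      ρ T = Matrix.diagonal (fun k => e (k.val ^ 2 / (4 * a))) := by
  obtain ⟨ρ, h1, h2⟩ := exists_weil_rankOne (a := a.natAbs) (by omega)
  have hval : ∀ k l : ZMod (2 * a.natAbs), ∀ s : ℤ,
      ZMod.stdAddChar (-((s : ZMod (2 * a.natAbs)) * (k * l))) =
        e ((-(s * (k.val * l.val) / (2 * a.natAbs : ℕ)) : ℝ)) := by
    intro k l s
    have : -((s : ZMod (2 * a.natAbs)) * (k * l)) = ((-(s * (k.val * l.val)) : ℤ) :
        ZMod (2 * a.natAbs)) := by
      push_cast; simp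
    rw [this, ZMod.stdAddChar_coe, e]
    congr 1
    push_cast
    ring
  rcases lt_or_gt_of_ne ha with hneg | hpos
  · refine ⟨((RingHom.mapMatrix (starRingEnd ℂ)).toMonoidHom).comp ρ, ?_, ?_⟩
    · ext k l
      have hI : (starRingEnd ℂ) ((Complex.I ^ (1 / 2 : ℂ))⁻¹) = Complex.I ^ (1 / 2 : ℂ) := by
        rw [Complex.inv_eq_conj norm_sqrt_I, Complex.conj_conj]
      have he : (starRingEnd ℂ) (e (-(k.val * l.val / (2 * a.natAbs : ℕ)))) =
          ZMod.stdAddChar (-((a.sign : ZMod (2 * a.natAbs)) * (k * l))) := by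
        rw [hval, Int.sign_eq_neg_one_of_neg hneg]
        have := conj_e (-(k.val * l.val / (2 * a.natAbs : ℕ)))
        push_cast at this ⊢
        rw [this]
        congr 1
        ring
      change (starRingEnd ℂ) (ρ S k l) = _
      rw [h1, Matrix.of_apply, map_mul, map_div₀, he, hI, Matrix.of_apply,
        Int.sign_eq_neg_one_of_neg hneg, Complex.conj_ofReal]
      simp
    · ext k l
      change (starRingEnd ℂ) (ρ T k l) = _
      rw [h2, Matrix.diagonal_apply, Matrix.diagonal_apply]
      split_ifs with h
      · have := conj_e (k.val ^ 2 / (4 * a.natAbs))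
        push_cast at this ⊢
        rw [this]
        have : (a : ℂ) = -(a.natAbs : ℂ) := by
          have : a = -(a.natAbs : ℤ) := by omega
          exact_mod_cast congrArg (Int.cast : ℤ → ℂ) this
        rw [this]
        congr 1
        ring
      · simp
  · refine ⟨ρ, ?_, ?_⟩
    · rw [h1]
      ext k l
      rw [Matrix.of_apply, Matrix.of_apply, hval, Int.sign_eq_one_of_pos hpos]
      push_cast
      simp
    · rw [h2]
      have : (a : ℂ) = (a.natAbs : ℂ) := by
        have : a = (a.natAbs : ℤ) := by omega
        exact (congrArg (Int.cast : ℤ → ℂ) this).trans (Int.cast_natCast _)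
      rw [this]

/-- Tensor products of matrix representations. -/
theorem exists_prod {r : ℕ} {κ : Fin r → Type} [∀ i, Fintype (κ i)] [∀ i, DecidableEq (κ i)]
    (ρ : ∀ i, Mp2Z →* Matrix (κ i) (κ i) ℂ) :
    ∃ P : Mp2Z →* Matrix (∀ i, κ i) (∀ i, κ i) ℂ,
      ∀ g k l, P g k l = ∏ i, ρ i g (k i) (l i) := by
  refine ⟨⟨⟨fun g => Matrix.of fun k l => ∏ i, ρ i g (k i) (l i), ?_⟩, ?_⟩, fun _ _ _ => rfl⟩
  · ext k l
    simp only [map_one, Matrix.one_apply, Matrix.of_apply]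
    rw [Finset.prod_ite_zero]
    simp [funext_iff]
  · intro g h
    ext k l
    simp only [map_mul, Matrix.mul_apply, Matrix.of_apply]
    rw [Finset.prod_univ_sum, Fintype.piFinset_univ]
    exact Finset.sum_congr rfl fun m _ => Finset.prod_mul_distrib

end Mp2Z

namespace EvenLattice
variable {V : Type*} [AddCommGroup V] [Module ℝ V] (Λ : EvenLattice V)

/-- Auxiliary: an orthogonal basis of `V` consisting of vectors of `L`. -/
structure Frame where
  r : ℕ
  v : Module.Basis (Fin r) ℝ V
  a : Fin r → ℤ
  mem : ∀ i, v i ∈ Λ.lat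
  ne : ∀ i, a i ≠ 0
  form : ∀ i, Λ.form (v i) = a i
  orth : ∀ i j, i ≠ j → Λ.form.polarBilin (v i) (v j) = 0

theorem nonempty_frame : Nonempty Λ.Frame := by
  obtain ⟨r, v, a, h1, h2, h3, h4⟩ := Λ.exists_orthogonal_basis
  exact ⟨⟨r, v, a, h1, h2, h3, h4⟩⟩

namespace Frame
variable {Λ} (F : Λ.Frame)

/-- Auxiliary: the discriminant group of the sublattice spanned by a frame. -/
abbrev K : Type := ∀ i : Fin F.r, ZMod (2 * (F.a i).natAbs)

instance (i : Fin F.r) : NeZero (2 * (F.a i).natAbs) :=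
  ⟨by have := F.ne i; omega⟩

theorem exists_coord (y : Λ.dual) (i : Fin F.r) :
    ∃ n : ℤ, Λ.form.polarBilin y (F.v i) = n := Λ.mem_dual.mp y.2 _ (F.mem i)

/-- Auxiliary: coordinates with respect to a frame. -/
def coord (y : Λ.dual) (i : Fin F.r) : ℤ := (F.exists_coord y i).choose

theorem coord_spec (y : Λ.dual) (i : Fin F.r) :
    Λ.form.polarBilin y (F.v i) = F.coord y i := (F.exists_coord y i).choose_spec

/-- Auxiliary: the map from `L'` to the discriminant group of a diagonal sublattice. -/
def φ : Λ.dual →+ F.K where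
  toFun y i := (F.coord y i : ZMod (2 * (F.a i).natAbs))
  map_zero' := by
    funext i
    have : F.coord 0 i = 0 := by
      have := F.coord_spec 0 i
      simp only [ZeroMemClass.coe_zero, map_zero, LinearMap.zero_apply] at this
      exact_mod_cast this.symm
    simp [this]
  map_add' x y := by
    funext i
    have : F.coord (x + y) i = F.coord x i + F.coord y i := by
      have := F.coord_spec (x + y) i
      simp only [Submodule.coe_add, map_add, LinearMap.add_apply, coord_spec] at this
      exact_mod_cast this.symm
    simp [this]

theorem polar_v (i j : Fin F.r) :
    Λ.form.polarBilin (F.v i) (F.v j) = if i = j then 2 * (F.a i : ℝ) else 0 := by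
  split_ifs with h
  · subst h
    rw [QuadraticMap.polarBilin_apply_apply, QuadraticMap.polar_self, F.form]
    simp
  · exact F.orth i j h

theorem polar_comb (c : Fin F.r → ℝ) (j : Fin F.r) :
    Λ.form.polarBilin (∑ i, c i • F.v i) (F.v j) = c j * (2 * F.a j) := by
  simp only [map_sum, map_smul, LinearMap.sum_apply, LinearMap.smul_apply, polar_v, smul_eq_mul,
    mul_ite, mul_zero, Finset.sum_ite_eq', Finset.mem_univ, if_true]

theorem ane (i : Fin F.r) : (F.a i : ℝ) ≠ 0 := by exact_mod_cast F.ne i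

theorem expand (y : V) : y = ∑ i, (Λ.form.polarBilin y (F.v i) / (2 * F.a i)) • F.v i := by
  have h : ∀ j, Λ.form.polarBilin y (F.v j) = F.v.repr y j * (2 * F.a j) := fun j => by
    conv_lhs => rw [← F.v.sum_repr y]
    exact F.polar_comb _ j
  conv_lhs => rw [← F.v.sum_repr y]
  refine Finset.sum_congr rfl fun i _ => ?_
  rw [h, mul_div_assoc, div_self (mul_ne_zero two_ne_zero (F.ane i)), mul_one]

theorem polar_eq (x y : V) : Λ.form.polarBilin x y =
    ∑ i, Λ.form.polarBilin x (F.v i) * Λ.form.polarBilin y (F.v i) / (2 * F.a i) := by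
  conv_lhs => rw [F.expand x]
  simp only [map_sum, map_smul, LinearMap.sum_apply, LinearMap.smul_apply, smul_eq_mul]
  refine Finset.sum_congr rfl fun i _ => ?_
  have : Λ.form.polarBilin (F.v i) y = Λ.form.polarBilin y (F.v i) := by
    simp [QuadraticMap.polar_comm]
  rw [this]
  ring

theorem form_eq (x : V) : Λ.form x = ∑ i, Λ.form.polarBilin x (F.v i) ^ 2 / (4 * F.a i) := by
  have h := F.polar_eq x x
  rw [QuadraticMap.polarBilin_apply_apply, QuadraticMap.polar_self, two_nsmul] at h
  have h2 : Λ.form x = (Λ.form x + Λ.form x) / 2 := by ring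
  rw [h2, h, Finset.sum_div]
  refine Finset.sum_congr rfl fun i _ => ?_
  have := F.ane i
  field_simp
  ring

theorem sub_mem_of_φ_eq {x y : Λ.dual} (h : F.φ x = F.φ y) : (x - y : V) ∈ Λ.lat := by
  have h0 : F.φ (x - y) = 0 := by rw [map_sub, h, sub_self]
  have h1 := F.expand (x - y : V)
  rw [h1]
  refine sum_mem fun i _ => ?_
  have h2 : ((F.coord (x - y) i : ℤ) : ZMod (2 * (F.a i).natAbs)) = 0 := congrFun h0 i
  rw [ZMod.intCast_zmod_eq_zero_iff_dvd] at h2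
  have h3 : (2 * F.a i) ∣ F.coord (x - y) i := by
    refine dvd_trans ?_ h2
    push_cast
    exact mul_dvd_mul_left 2 ((dvd_abs _ _).mpr dvd_rfl)
  obtain ⟨c, hc⟩ := h3
  have h4 := F.coord_spec (x - y) i
  rw [Submodule.coe_sub, hc] at h4
  rw [h4]
  have : (((2 * F.a i * c : ℤ) : ℝ) / (2 * F.a i)) = (c : ℝ) := by
    have := F.ane i
    push_cast
    field_simp
  rw [this, Int.cast_smul_eq_zsmul]
  exact zsmul_mem (F.mem i) _

/-- Auxiliary: the character `e(-(k, l))`. -/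
def chi (k l : F.K) : ℂ :=
  ∏ i, ZMod.stdAddChar (-(((F.a i).sign : ZMod (2 * (F.a i).natAbs)) * (k i * l i)))

theorem chi_comm (k l : F.K) : F.chi k l = F.chi l k :=
  Finset.prod_congr rfl fun i _ => by rw [mul_comm (k i)]

/-- Auxiliary: `chi` as a character. -/
def chiChar (k : F.K) : AddChar F.K ℂ where
  toFun := F.chi k
  map_zero_eq_one' := by simp [chi]
  map_add_eq_mul' x y := by
    simp only [chi, ← Finset.prod_mul_distrib]
    refine Finset.prod_congr rfl fun i _ => ?_
    rw [← AddChar.map_add_eq_mul]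
    congr 1
    simp only [Pi.add_apply]
    ring

theorem chiChar_eq_zero {k : F.K} (h : F.chiChar k = 0) : k = 0 := by
  funext i
  have h1 : F.chi k (Pi.single i 1) = 1 := by
    change F.chiChar k (Pi.single i 1) = 1
    rw [h]; rfl
  rw [chi, Finset.prod_eq_single i] at h1
  · simp only [Pi.single_eq_same, mul_one] at h1
    have h2 := ZMod.injective_stdAddChar (h1.trans (AddChar.map_zero_eq_one _).symm)
    rcases lt_or_gt_of_ne (F.ne i) with hn | hp
    · rw [Int.sign_eq_neg_one_of_neg hn] at h2
      simpa using h2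
    · rw [Int.sign_eq_one_of_pos hp] at h2
      simpa using h2
  · intro j _ hj
    simp [Pi.single_eq_of_ne hj]
  · simp

theorem e_sum {ι : Type*} (s : Finset ι) (f : ι → ℂ) : e (∑ i ∈ s, f i) = ∏ i ∈ s, e (f i) := by
  rw [e, Finset.mul_sum, Complex.exp_sum]; rfl

theorem chi_intCast (n m : Fin F.r → ℤ) :
    F.chi (fun i => (n i : ZMod (2 * (F.a i).natAbs))) (fun i => (m i : ZMod _)) =
      e (-∑ i, (n i * m i / (2 * F.a i) : ℝ) : ℝ) := by
  push_cast
  rw [← Finset.sum_neg_distrib, e_sum, chi]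
  refine Finset.prod_congr rfl fun i _ => ?_
  have : -(((F.a i).sign : ZMod (2 * (F.a i).natAbs)) * ((n i : ZMod _) * (m i : ZMod _))) =
      ((-((F.a i).sign * (n i * m i)) : ℤ) : ZMod (2 * (F.a i).natAbs)) := by push_cast; ring
  rw [this, ZMod.stdAddChar_coe, e]
  congr 1
  have h1 : (F.a i : ℂ) = (F.a i).sign * (F.a i).natAbs := by
    have := congrArg (Int.cast : ℤ → ℂ) (Int.sign_mul_natAbs (F.a i)).symm
    rwa [Int.cast_mul, Int.cast_natCast] at this
  have h2 : ((F.a i).natAbs : ℂ) ≠ 0 := by exact_mod_cast Int.natAbs_ne_zero.mpr (F.ne i)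
  rw [h1]
  rcases lt_or_gt_of_ne (F.ne i) with hn | hp
  · rw [Int.sign_eq_neg_one_of_neg hn]
    push_cast
    field_simp
  · rw [Int.sign_eq_one_of_pos hp]
    push_cast
    field_simp

theorem chi_φ (x y : Λ.dual) : F.chi (F.φ x) (F.φ y) = e (-Λ.form.polarBilin x y : ℝ) := by
  have := F.chi_intCast (F.coord x) (F.coord y)
  rw [F.polar_eq]
  simp only [coord_spec]
  exact this

theorem exists_lift (k : F.K) (h : ∀ l (hl : l ∈ Λ.lat), F.chi k (F.φ ⟨l, Λ.lat_le_dual hl⟩) = 1) :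
    ∃ y : Λ.dual, F.φ y = k := by
  let y : V := ∑ i, ((k i).val / (2 * F.a i) : ℝ) • F.v i
  have hy : ∀ i, Λ.form.polarBilin y (F.v i) = ((k i).val : ℤ) := fun i => by
    rw [polar_comb]
    have := F.ane i
    push_cast
    field_simp
  have hk : k = fun i => (((k i).val : ℤ) : ZMod (2 * (F.a i).natAbs)) := by
    funext i; simp
  have hyd : y ∈ Λ.dual := by
    rw [mem_dual]
    intro l hl
    have h1 := h l hl
    rw [hk] at h1
    change F.chi _ (fun i => ((F.coord ⟨l, Λ.lat_le_dual hl⟩ i : ℤ) : ZMod _)) = 1 at h1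
    rw [chi_intCast] at h1
    have h2 : Λ.form.polarBilin y l = ∑ i, ((((k i).val : ℤ) : ℝ) *
        F.coord ⟨l, Λ.lat_le_dual hl⟩ i / (2 * F.a i)) := by
      rw [F.polar_eq]
      refine Finset.sum_congr rfl fun i _ => ?_
      rw [hy, ← F.coord_spec]
    rw [← h2, e, Complex.exp_eq_one_iff] at h1
    obtain ⟨n, hn⟩ := h1
    refine ⟨-n, ?_⟩
    have hpi : (2 * Real.pi * Complex.I : ℂ) ≠ 0 := Complex.two_pi_I_ne_zero
    rw [mul_comm (n : ℂ)] at hn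
    have h3 := mul_left_cancel₀ hpi hn
    have h4 : -Λ.form.polarBilin y l = n := by exact_mod_cast h3
    push_cast
    linarith
  refine ⟨⟨y, hyd⟩, ?_⟩
  rw [hk]
  funext i
  have : F.coord ⟨y, hyd⟩ i = (k i).val := by
    have := F.coord_spec ⟨y, hyd⟩ i
    rw [hy i] at this
    exact_mod_cast this.symm
  change ((F.coord ⟨y, hyd⟩ i : ℤ) : ZMod (2 * (F.a i).natAbs)) = _
  rw [this]

end Frame

theorem finite_disc : Finite Λ.Disc := by
  obtain ⟨F⟩ := Λ.nonempty_frame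
  have hs := Λ.toDisc_surjective
  refine Finite.of_injective (fun γ : Λ.Disc => F.φ (Function.surjInv hs γ)) fun γ δ h => ?_
  have := F.sub_mem_of_φ_eq h
  rw [← Λ.toDisc_eq, Function.surjInv_eq hs, Function.surjInv_eq hs] at this
  exact this

instance : Finite Λ.Disc := Λ.finite_disc
instance : Fintype Λ.Disc := Fintype.ofFinite _
instance : DecidableEq Λ.Disc := Classical.decEq _

end EvenLattice

namespace EvenLattice
variable {V : Type*} [AddCommGroup V] [Module ℝ V] (Λ : EvenLattice V)

/-- The matrix of `ρ_L(S)`. -/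
def weilS : Matrix Λ.Disc Λ.Disc ℂ := Matrix.of fun δ γ =>
  (Complex.I ^ (1 / 2 : ℂ)) ^ (-Λ.signature) / (Real.sqrt (Nat.card Λ.Disc) : ℝ) *
    eMod (-Λ.discPairing γ δ)

/-- The matrix of `ρ_L(T)`. -/
def weilT : Matrix Λ.Disc Λ.Disc ℂ := Matrix.diagonal fun γ => eMod (Λ.discForm γ)

theorem discPairing_add (γ δ δ' : Λ.Disc) :
    Λ.discPairing γ (δ + δ') = Λ.discPairing γ δ + Λ.discPairing γ δ' := by
  obtain ⟨x, rfl⟩ := Λ.toDisc_surjective γ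
  obtain ⟨y, rfl⟩ := Λ.toDisc_surjective δ
  obtain ⟨z, rfl⟩ := Λ.toDisc_surjective δ'
  rw [← map_add, discPairing_mk, discPairing_mk, discPairing_mk, ← AddCircle.coe_add,
    Submodule.coe_add, map_add]

theorem discPairing_comm (γ δ : Λ.Disc) : Λ.discPairing γ δ = Λ.discPairing δ γ :=
  QuadraticMap.polar_comm _ _ _

/-- Auxiliary: the character `δ ↦ e(-(γ, δ))`. -/
def discChar (γ : Λ.Disc) : AddChar Λ.Disc ℂ where
  toFun δ := eMod (-Λ.discPairing γ δ)
  map_zero_eq_one' := by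
    have := Λ.discPairing_add γ 0 0
    rw [add_zero, left_eq_add] at this
    rw [this]
    simp [eMod]
  map_add_eq_mul' δ δ' := by
    rw [discPairing_add, neg_add, eMod_add]

theorem eq_zero_of_discPairing {γ : Λ.Disc} (h : ∀ δ, Λ.discPairing γ δ = 0) : γ = 0 := by
  obtain ⟨x, rfl⟩ := Λ.toDisc_surjective γ
  rw [← map_zero Λ.toDisc, Λ.toDisc_eq]
  obtain ⟨r, b, hb⟩ := Λ.exists_basis
  have hsymm : LinearMap.BilinForm.IsSymm Λ.form.polarBilin := ⟨fun x y => by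
    simp [QuadraticMap.polar_comm]⟩
  have hd := LinearMap.BilinForm.dualSubmodule_dualSubmodule_of_basis (R := ℤ)
    Λ.form.polarBilin Λ.nondeg hsymm b
  rw [← hb] at hd
  rw [← hd, LinearMap.BilinForm.mem_dualSubmodule]
  intro y hy
  have h1 := h (Λ.toDisc ⟨y, hy⟩)
  rw [discPairing_mk, AddCircle.coe_eq_zero_iff] at h1
  obtain ⟨n, hn⟩ := h1
  rw [Submodule.mem_one]
  refine ⟨n, ?_⟩
  simp only [zsmul_eq_mul, mul_one] at hn
  simpa using hn

theorem discChar_eq_zero {γ : Λ.Disc} (h : Λ.discChar γ = 0) : γ = 0 := by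
  refine Λ.eq_zero_of_discPairing fun δ => ?_
  have h1 : eMod (-Λ.discPairing γ δ) = 1 := by
    change Λ.discChar γ δ = 1
    rw [h]; rfl
  have h2 : AddCircle.toCircle (-Λ.discPairing γ δ) = AddCircle.toCircle (0 : UnitAddCircle) := by
    rw [AddCircle.toCircle_zero]
    exact Subtype.ext h1
  have := AddCircle.injective_toCircle one_ne_zero h2
  simpa using this

theorem conj_eMod (x : UnitAddCircle) : (starRingEnd ℂ) (eMod x) = eMod (-x) := by
  rw [eMod, eMod, AddCircle.toCircle_neg, Circle.coe_inv_eq_conj]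

theorem weilT_mem : Λ.weilT ∈ Matrix.unitaryGroup Λ.Disc ℂ := by
  rw [Matrix.mem_unitaryGroup_iff, Matrix.star_eq_conjTranspose, weilT,
    Matrix.diagonal_conjTranspose, Matrix.diagonal_mul_diagonal, ← Matrix.diagonal_one]
  congr 1
  funext γ
  rw [Pi.star_apply, Complex.star_def, conj_eMod, ← eMod_add]
  simp [eMod]

theorem weilS_mem : Λ.weilS ∈ Matrix.unitaryGroup Λ.Disc ℂ := by
  rw [Matrix.mem_unitaryGroup_iff]
  ext δ δ'
  rw [Matrix.star_eq_conjTranspose, Matrix.mul_apply]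
  set C : ℂ := (Complex.I ^ (1 / 2 : ℂ)) ^ (-Λ.signature) / (Real.sqrt (Nat.card Λ.Disc) : ℝ)
  have hC : C * (starRingEnd ℂ) C = (Nat.card Λ.Disc : ℂ)⁻¹ := by
    rw [Complex.mul_conj, Complex.normSq_eq_norm_sq, norm_div, norm_zpow, Mp2Z.norm_sqrt_I,
      one_zpow, Complex.norm_real, Real.norm_of_nonneg (Real.sqrt_nonneg _), div_pow,
      Real.sq_sqrt (Nat.cast_nonneg _)]
    simp
  have h1 : ∀ γ, Λ.weilS δ γ * Λ.weilS.conjTranspose γ δ' =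
      (Nat.card Λ.Disc : ℂ)⁻¹ * Λ.discChar (δ - δ') γ := by
    intro γ
    have h2 : Λ.discChar (δ - δ') γ = eMod (-Λ.discPairing γ δ) * eMod (Λ.discPairing γ δ') := by
      change eMod (-Λ.discPairing (δ - δ') γ) = _
      rw [← eMod_add]
      congr 1
      have h3 := Λ.discPairing_add γ (δ - δ') δ'
      rw [sub_add_cancel] at h3
      rw [h3, Λ.discPairing_comm (δ - δ')]
      abel
    rw [Matrix.conjTranspose_apply, Complex.star_def, weilS, Matrix.of_apply, Matrix.of_apply,
      map_mul, conj_eMod, neg_neg, h2, ← hC]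
    ring
  simp_rw [h1, ← Finset.mul_sum]
  classical
  rw [AddChar.sum_eq_ite, Matrix.one_apply]
  have hne : (Nat.card Λ.Disc : ℂ) ≠ 0 := by
    exact_mod_cast Nat.card_pos.ne'
  by_cases h : δ = δ'
  · subst h
    have : Λ.discChar (δ - δ) = 0 := by
      ext γ
      change eMod (-Λ.discPairing (δ - δ) γ) = 1
      have := Λ.discPairing_add γ 0 0
      rw [add_zero, left_eq_add] at this
      rw [sub_self, Λ.discPairing_comm, this]
      simp [eMod]
    rw [if_pos this, if_pos rfl, ← Nat.card_eq_fintype_card, inv_mul_cancel₀ hne]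
  · rw [if_neg h, if_neg, mul_zero]
    intro h'
    exact h (sub_eq_zero.mp (Λ.discChar_eq_zero h'))

theorem sum_sign (F : Λ.Frame) : ∑ i, (F.a i).sign = Λ.signature := by
  have h1 : (Λ.form : QuadraticMap ℝ V ℝ).Equivalent
      (QuadraticMap.weightedSumSquares ℝ fun i => (F.a i : ℝ)) := by
    refine ⟨?_⟩
    have h2 : Λ.form.basisRepr F.v = QuadraticMap.weightedSumSquares ℝ fun i => (F.a i : ℝ) := by
      have hinv : Invertible (2 : ℝ) := invertibleOfNonzero two_ne_zero
      rw [QuadraticMap.basisRepr_eq_of_iIsOrtho]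
      · simp only [F.form]
      · intro i j hij
        have := F.orth i j hij
        rw [QuadraticMap.polarBilin_apply_apply, QuadraticMap.polar] at this
        change QuadraticMap.associated Λ.form (F.v i) (F.v j) = 0
        rw [QuadraticMap.associated_apply, this, smul_zero]
    rw [← h2]
    exact QuadraticMap.isometryEquivBasisRepr _ _
  rw [signature, bPos, bNeg, QuadraticForm.sigPos_of_equiv_weightedSumSquares h1,
    QuadraticForm.sigNeg_of_equiv_weightedSumSquares h1]
  simp only [Int.cast_pos, Int.cast_lt_zero]
  rw [Set.ncard_eq_toFinset_card', Set.ncard_eq_toFinset_card']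
  simp only [Set.toFinset_ofPred]
  rw [Finset.card_filter, Finset.card_filter]
  push_cast
  rw [← Finset.sum_sub_distrib]
  refine Finset.sum_congr rfl fun i _ => ?_
  rcases lt_or_gt_of_ne (F.ne i) with hn | hp
  · simp [Int.sign_eq_neg_one_of_neg hn, hn, hn.not_gt]
  · simp [Int.sign_eq_one_of_pos hp, hp, hp.not_gt]


namespace Frame
variable {Λ} (F : Λ.Frame)

open Classical in
/-- Auxiliary: the embedding of `ℂ[L'/L]` for a diagonal sublattice. -/
def J : Matrix F.K Λ.Disc ℂ := Matrix.of fun k γ =>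
  if ∃ y, Λ.toDisc y = γ ∧ F.φ y = k then 1 else 0

theorem J_φ (y : Λ.dual) (γ : Λ.Disc) : F.J (F.φ y) γ = if Λ.toDisc y = γ then 1 else 0 := by
  rw [J, Matrix.of_apply]
  congr 1
  rw [eq_iff_iff]
  constructor
  · rintro ⟨x, rfl, hx⟩
    rw [Λ.toDisc_eq]
    exact F.sub_mem_of_φ_eq hx.symm
  · intro h
    exact ⟨y, h, rfl⟩

/-- The image of the lattice. -/
def H : AddSubgroup F.K := (Λ.lat.submoduleOf Λ.dual).toAddSubgroup.map F.φ

theorem mem_H {k : F.K} : k ∈ F.H ↔ ∃ l, ∃ hl : l ∈ Λ.lat, F.φ ⟨l, Λ.lat_le_dual hl⟩ = k := by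
  constructor
  · rintro ⟨x, hx, rfl⟩
    exact ⟨x, hx, rfl⟩
  · rintro ⟨l, hl, rfl⟩
    exact ⟨⟨l, Λ.lat_le_dual hl⟩, hl, rfl⟩

theorem toDisc_lat {l : V} (hl : l ∈ Λ.lat) : Λ.toDisc ⟨l, Λ.lat_le_dual hl⟩ = 0 := by
  rw [← map_zero Λ.toDisc, Λ.toDisc_eq]
  simpa using hl

open Classical in
theorem J_eq (k : F.K) (y : Λ.dual) : F.J k (Λ.toDisc y) = if k - F.φ y ∈ F.H then 1 else 0 := by
  rw [J, Matrix.of_apply]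
  congr 1
  rw [eq_iff_iff, F.mem_H]
  constructor
  · rintro ⟨x, hx, rfl⟩
    refine ⟨x - y, Λ.toDisc_eq.mp hx, ?_⟩
    rw [← map_sub]
    rfl
  · rintro ⟨l, hl, h⟩
    refine ⟨⟨l, Λ.lat_le_dual hl⟩ + y, ?_, ?_⟩
    · rw [map_add, toDisc_lat hl, zero_add]
    · rw [map_add, h, sub_add_cancel]

open Classical in
instance : Fintype F.H := Fintype.ofFinite _

/-- Auxiliary: restriction of `chi`. -/
def charH (k : F.K) : AddChar F.H ℂ := (F.chiChar k).compAddMonoidHom F.H.subtype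

theorem sum_fiber (f : F.K → ℂ) (y : Λ.dual) :
    ∑ k, f k * F.J k (Λ.toDisc y) = ∑ h : F.H, f (F.φ y + h) := by
  classical
  simp_rw [J_eq, mul_ite, mul_one, mul_zero]
  rw [← Finset.sum_filter]
  symm
  refine Finset.sum_bij (fun h _ => F.φ y + (h : F.K)) ?_ ?_ ?_ ?_
  · intro h _
    simp [h.2]
  · intro h _ h' _ hh
    exact Subtype.ext (add_left_cancel hh)
  · intro k hk
    refine ⟨⟨k - F.φ y, by simpa using hk⟩, Finset.mem_univ _, by simp⟩
  · intro _ _; rfl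

open Classical in
theorem charH_zero_iff (k : F.K) : F.charH k = 0 ↔ ∃ y, F.φ y = k := by
  constructor
  · intro h
    refine F.exists_lift k fun l hl => ?_
    have := DFunLike.congr_fun h (⟨_, F.mem_H.mpr ⟨l, hl, rfl⟩⟩ : F.H)
    exact this
  · rintro ⟨y, rfl⟩
    ext ⟨h, hh⟩
    obtain ⟨l, hl, rfl⟩ := F.mem_H.mp hh
    change F.chi (F.φ y) (F.φ _) = 1
    rw [chi_φ]
    obtain ⟨n, hn⟩ := Λ.mem_dual.mp y.2 l hl
    rw [hn]
    have := Mp2Z.e_int (-n)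
    push_cast at this ⊢
    exact this

open Classical in
theorem sum_charH (k : F.K) :
    ∑ h : F.H, F.chi k h = if ∃ y, F.φ y = k then (Nat.card F.H : ℂ) else 0 := by
  have : ∑ h : F.H, F.chi k h = ∑ h : F.H, F.charH k h := rfl
  rw [this, AddChar.sum_eq_ite, Nat.card_eq_fintype_card]
  simp only [charH_zero_iff]

open Classical in
theorem sum_J (k : F.K) : ∑ γ, F.J k γ = if ∃ y, F.φ y = k then 1 else 0 := by
  split_ifs with h
  · obtain ⟨y, rfl⟩ := h
    simp [J_φ]
  · refine Finset.sum_eq_zero fun γ _ => ?_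
    rw [J, Matrix.of_apply, if_neg]
    rintro ⟨y, _, hy⟩
    exact h ⟨y, hy⟩

theorem card_K : (Nat.card F.K : ℂ) = Nat.card Λ.Disc * (Nat.card F.H : ℂ) ^ 2 := by
  classical
  have h1 : ∑ k : F.K, ∑ h : F.H, F.chi k h = Nat.card Λ.Disc * (Nat.card F.H : ℂ) ^ 2 := by
    have h2 : ∀ k : F.K, ∑ h : F.H, F.chi k h = ∑ γ, (Nat.card F.H : ℂ) * F.J k γ := fun k => by
      rw [sum_charH, ← Finset.mul_sum, sum_J, mul_ite, mul_one, mul_zero]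
    simp_rw [h2]
    rw [Finset.sum_comm]
    have h3 : ∀ γ, ∑ k, (Nat.card F.H : ℂ) * F.J k γ = (Nat.card F.H : ℂ) ^ 2 := fun γ => by
      obtain ⟨y, rfl⟩ := Λ.toDisc_surjective γ
      rw [F.sum_fiber (fun _ => (Nat.card F.H : ℂ))]
      simp [Nat.card_eq_fintype_card, pow_two]
    simp_rw [h3]
    simp [Nat.card_eq_fintype_card]
  rw [← h1, Finset.sum_comm]
  have h4 : ∀ h : F.H, ∑ k, F.chi k h = if h = 0 then (Nat.card F.K : ℂ) else 0 := fun h => by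
    have : ∑ k, F.chi k h = ∑ k, F.chiChar h k :=
      Finset.sum_congr rfl fun k _ => F.chi_comm _ _
    rw [this, AddChar.sum_eq_ite, Nat.card_eq_fintype_card]
    congr 1
    rw [eq_iff_iff]
    constructor
    · intro h0
      exact Subtype.ext (F.chiChar_eq_zero h0)
    · rintro rfl
      ext k
      change F.chi 0 k = 1
      simp [chi]
  simp_rw [h4]
  simp

theorem sqrt_card_K : Real.sqrt (Nat.card F.K) = Real.sqrt (Nat.card Λ.Disc) * Nat.card F.H := by
  have : (Nat.card F.K : ℝ) = Nat.card Λ.Disc * (Nat.card F.H : ℝ) ^ 2 := by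
    exact_mod_cast F.card_K
  rw [this, Real.sqrt_mul (Nat.cast_nonneg _), Real.sqrt_sq (Nat.cast_nonneg _)]

theorem exists_P : ∃ P : Mp2Z →* Matrix F.K F.K ℂ,
    (∀ k l, P Mp2Z.S k l = (Complex.I ^ (1 / 2 : ℂ)) ^ (-Λ.signature) /
      (Real.sqrt (Nat.card F.K) : ℝ) * F.chi k l) ∧
    (∀ k l, P Mp2Z.T k l = if k = l then
      e (∑ i, ((k i).val ^ 2 / (4 * F.a i) : ℂ)) else 0) := by
  choose ρ hS hT using fun i => Mp2Z.exists_weil_rankOne' (F.a i) (F.ne i)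
  obtain ⟨P, hP⟩ := Mp2Z.exists_prod ρ
  refine ⟨P, fun k l => ?_, fun k l => ?_⟩
  · rw [hP]
    simp only [hS, Matrix.of_apply]
    rw [Finset.prod_mul_distrib, Finset.prod_div_distrib, ← Λ.sum_sign F, chi]
    congr 2
    · rw [← Finset.sum_neg_distrib]
      have hne : Complex.I ^ (1 / 2 : ℂ) ≠ 0 := by simp [Complex.cpow_eq_zero_iff]
      induction (Finset.univ : Finset (Fin F.r)) using Finset.induction_on with
      | empty => simp
      | insert i s hi ih => rw [Finset.prod_insert hi, Finset.sum_insert hi, zpow_add₀ hne, ih]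
    · rw [← Complex.ofReal_prod, ← Real.sqrt_prod _ (fun i _ => Nat.cast_nonneg _),
        Nat.card_pi]
      simp
  · rw [hP]
    simp only [hT, Matrix.diagonal_apply]
    rw [Finset.prod_ite_zero, e_sum]
    simp [funext_iff]

theorem e_form (y : Λ.dual) :
    e (∑ i, (((F.φ y) i).val ^ 2 / (4 * F.a i) : ℂ)) = eMod (Λ.discForm (Λ.toDisc y)) := by
  rw [discForm_mk, eMod_coe, F.form_eq]
  push_cast
  rw [e_sum, e_sum]
  refine Finset.prod_congr rfl fun i _ => ?_
  rw [coord_spec]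
  have ha : (F.a i : ℂ) ≠ 0 := by exact_mod_cast F.ne i
  obtain ⟨c, hc⟩ : ∃ c : ℤ, F.coord y i = ((F.φ y i).val : ℤ) + 2 * F.a i * c := by
    have h : ((F.coord y i : ℤ) : ZMod (2 * (F.a i).natAbs)) =
        (((F.φ y i).val : ℤ) : ZMod (2 * (F.a i).natAbs)) := by
      simp [φ]
    rw [ZMod.intCast_eq_intCast_iff_dvd_sub] at h
    have h2 : 2 * F.a i ∣ ((F.φ y i).val : ℤ) - F.coord y i := by
      refine dvd_trans ?_ h
      push_cast
      exact mul_dvd_mul_left 2 ((dvd_abs _ _).mpr dvd_rfl)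
    obtain ⟨c, hc⟩ := h2
    exact ⟨-c, by linear_combination -hc⟩
  have h3 : (((F.coord y i : ℤ) : ℝ) : ℂ) ^ 2 / (4 * F.a i) =
      ((F.φ y i).val ^ 2 / (4 * F.a i) : ℂ) +
        (((F.φ y i).val * c + F.a i * c ^ 2 : ℤ) : ℂ) := by
    rw [hc]
    push_cast
    field_simp
    ring
  push_cast at h3 ⊢
  rw [h3, Mp2Z.e_add]
  have := Mp2Z.e_int ((F.φ y i).val * c + F.a i * c ^ 2)
  push_cast at this
  rw [this, mul_one]

theorem S_J (P : Mp2Z →* Matrix F.K F.K ℂ)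
    (hS : ∀ k l, P Mp2Z.S k l = (Complex.I ^ (1 / 2 : ℂ)) ^ (-Λ.signature) /
      (Real.sqrt (Nat.card F.K) : ℝ) * F.chi k l) :
    P Mp2Z.S * F.J = F.J * Λ.weilS := by
  classical
  ext k γ
  obtain ⟨y, rfl⟩ := Λ.toDisc_surjective γ
  rw [Matrix.mul_apply, F.sum_fiber, Matrix.mul_apply]
  simp_rw [hS]
  rw [← Finset.mul_sum]
  have h1 : ∀ h : F.H, F.chi k (F.φ y + h) = F.chi k (F.φ y) * F.chi k h := fun h =>
    (F.chiChar k).map_add_eq_mul _ _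
  simp_rw [h1]
  rw [← Finset.mul_sum, sum_charH]
  split_ifs with hk
  · obtain ⟨x, rfl⟩ := hk
    simp only [J_φ, ite_mul, one_mul, zero_mul, Finset.sum_ite_eq, Finset.mem_univ, if_true]
    rw [weilS, Matrix.of_apply, chi_φ, F.sqrt_card_K, discPairing_comm, discPairing_mk,
      ← AddCircle.coe_neg, eMod_coe]
    have hH : (Nat.card F.H : ℂ) ≠ 0 := by exact_mod_cast Nat.card_pos.ne'
    have hD : (Real.sqrt (Nat.card Λ.Disc) : ℂ) ≠ 0 := by
      have : (0 : ℝ) < Nat.card Λ.Disc := by exact_mod_cast Nat.card_pos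
      exact_mod_cast (Real.sqrt_pos.mpr this).ne'
    push_cast
    field_simp
  · rw [mul_zero, mul_zero]
    symm
    refine Finset.sum_eq_zero fun γ _ => ?_
    rw [J, Matrix.of_apply, if_neg, zero_mul]
    rintro ⟨y, _, hy⟩
    exact hk ⟨y, hy⟩

theorem T_J (P : Mp2Z →* Matrix F.K F.K ℂ)
    (hT : ∀ k l, P Mp2Z.T k l = if k = l then
      e (∑ i, ((k i).val ^ 2 / (4 * F.a i) : ℂ)) else 0) :
    P Mp2Z.T * F.J = F.J * Λ.weilT := by
  classical
  ext k γ
  rw [Matrix.mul_apply, weilT, Matrix.mul_diagonal]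
  simp_rw [hT, ite_mul, zero_mul]
  rw [Finset.sum_ite_eq]
  simp only [Finset.mem_univ, if_true]
  by_cases h : ∃ y, Λ.toDisc y = γ ∧ F.φ y = k
  · obtain ⟨y, rfl, rfl⟩ := h
    rw [e_form, mul_comm]
  · rw [J, Matrix.of_apply, if_neg h]
    simp

end Frame

theorem exists_weil_matrix : ∃ ρ : Mp2Z →* Matrix Λ.Disc Λ.Disc ℂ,
    ρ Mp2Z.S = Λ.weilS ∧ ρ Mp2Z.T = Λ.weilT := by
  obtain ⟨F⟩ := Λ.nonempty_frame
  obtain ⟨P, hS, hT⟩ := F.exists_P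
  let R : Submonoid (Mp2Z × Matrix Λ.Disc Λ.Disc ℂ) :=
    { carrier := {x | P x.1 * F.J = F.J * x.2}
      one_mem' := by simp
      mul_mem' := fun {x y} hx hy => by
        change P (x.1 * y.1) * F.J = F.J * (x.2 * y.2)
        have hx : P x.1 * F.J = F.J * x.2 := hx
        have hy : P y.1 * F.J = F.J * y.2 := hy
        rw [map_mul, Matrix.mul_assoc, hy, ← Matrix.mul_assoc, hx, Matrix.mul_assoc] }
  obtain ⟨ρ, h1, h2, -⟩ := Mp2Z.exists_hom R (fun g u u' hu hu' => by
      have h : F.J * u = F.J * u' := (Eq.symm hu).trans hu'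
      ext γ δ
      obtain ⟨y, rfl⟩ := Λ.toDisc_surjective γ
      have := congrFun (congrFun h (F.φ y)) δ
      simpa [Matrix.mul_apply, F.J_φ] using this)
    (F.S_J P hS) (F.T_J P hT)
  exact ⟨ρ, h1, h2⟩

/-- `ρ` is the Weil representation on `ℂ[L'/L]` with its standard basis `𝔢_γ = Pi.single γ 1`:
`ρ(T) 𝔢_γ = e(q(γ)) 𝔢_γ` and `ρ(S) 𝔢_γ = √i ^ (b⁻ - b⁺) / √|L'/L| ∑_δ e(-(γ, δ)) 𝔢_δ`. Since `S` and
`T` generate `Mp₂(ℤ)`, there is at most one such `ρ`. -/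
def IsWeilRepresentation (ρ : Mp2Z →* Matrix.unitaryGroup Λ.Disc ℂ) : Prop :=
  (∀ γ, (ρ Mp2Z.T : Matrix Λ.Disc Λ.Disc ℂ).mulVec (Pi.single γ 1) =
    eMod (Λ.discForm γ) • Pi.single γ 1) ∧
  (∀ γ, (ρ Mp2Z.S : Matrix Λ.Disc Λ.Disc ℂ).mulVec (Pi.single γ 1) =
    ((Complex.I ^ (1 / 2 : ℂ)) ^ ((Λ.bNeg : ℤ) - Λ.bPos) / (Real.sqrt (Nat.card Λ.Disc) : ℝ)) •
      ∑ δ, eMod (-Λ.discPairing γ δ) • Pi.single δ 1)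

theorem exists_isWeilRepresentation : ∃ ρ, Λ.IsWeilRepresentation ρ := by
  obtain ⟨ρ, h1, h2⟩ := Λ.exists_weil_matrix
  have h : ∀ g, ρ g ∈ Matrix.unitaryGroup Λ.Disc ℂ := by
    have := Mp2Z.submonoid_eq_top ((Matrix.unitaryGroup Λ.Disc ℂ).comap ρ)
      (by rw [Submonoid.mem_comap, h1]; exact Λ.weilS_mem)
      (by rw [Submonoid.mem_comap, h2]; exact Λ.weilT_mem)
    intro g
    have hg : g ∈ (Matrix.unitaryGroup Λ.Disc ℂ).comap ρ := by rw [this]; trivial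
    exact hg
  refine ⟨ρ.codRestrict _ h, fun γ => ?_, fun γ => ?_⟩
  · change (ρ Mp2Z.T).mulVec _ = _
    rw [h2, weilT, Matrix.diagonal_mulVec_single, ← Pi.single_smul, smul_eq_mul]
  · change (ρ Mp2Z.S).mulVec _ = _
    rw [h1, Matrix.mulVec_single_one]
    funext δ
    simp [weilS, signature, Pi.single_apply]

/-! ## The Weil representation and the Eisenstein series -/

/-- The Weil representation `ρ_L`. -/
def weilRep : Mp2Z →* Matrix.unitaryGroup Λ.Disc ℂ := Λ.exists_isWeilRepresentation.choose

theorem weilRep_spec : Λ.IsWeilRepresentation Λ.weilRep := Λ.exists_isWeilRepresentation.choose_spec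

/-- The coefficient `ρ_{βγ}(M, φ) = ⟨ρ_L(M, φ) 𝔢_γ, 𝔢_β⟩`. -/
def weilCoeff (β γ : Λ.Disc) (g : Mp2Z) : ℂ := (Λ.weilRep g : Matrix Λ.Disc Λ.Disc ℂ) β γ

/-- The dual representation `ρ_L^*`, in the basis dual to `(𝔢_γ)`. -/
def dualRep : Mp2Z →* Matrix Λ.Disc Λ.Disc ℂ where
  toFun g := (Λ.weilRep g⁻¹ : Matrix Λ.Disc Λ.Disc ℂ).transpose
  map_one' := by simp
  map_mul' g h := by simp [Matrix.transpose_mul]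

/-- The Petersson slash operator `f ∣_κ^* (M, φ)` of weight `κ = w / 2`,
`τ ↦ φ(τ)^(-2κ) ρ_L^*(M, φ)⁻¹ f(Mτ)`. -/
def slash (w : ℤ) (f : ℍ → Λ.Disc → ℂ) (g : Mp2Z) : ℍ → Λ.Disc → ℂ := fun τ =>
  g.root τ ^ (-w) • (Λ.dualRep g⁻¹).mulVec (f (g.mat • τ))

theorem slash_one (w : ℤ) (f : ℍ → Λ.Disc → ℂ) : Λ.slash w f 1 = f := by
  funext τ
  simp [slash]

theorem slash_mul (w : ℤ) (f : ℍ → Λ.Disc → ℂ) (g h : Mp2Z) :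
    Λ.slash w f (g * h) = Λ.slash w (Λ.slash w f g) h := by
  funext τ
  simp only [slash, Mp2Z.mul_root, Mp2Z.mul_mat, mul_inv_rev, map_mul, mul_smul,
    ← Matrix.mulVec_mulVec, Matrix.mulVec_smul, mul_zpow]
  rw [smul_comm]

/-- The function `τ ↦ 𝔢_β y^s`. -/
def eisensteinSeed (β : Λ.Disc) (s : ℂ) : ℍ → Λ.Disc → ℂ := fun τ =>
  (τ.im : ℂ) ^ s • Pi.single β 1

theorem slash_seed_T (w : ℤ) {β : Λ.Disc} (hβ : Λ.discForm β = 0) (s : ℂ) :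
    Λ.slash w (Λ.eisensteinSeed β s) Mp2Z.T = Λ.eisensteinSeed β s := by
  have him : ∀ τ : ℍ, (Mp2Z.T.mat • τ).im = τ.im := fun τ => by
    change (ModularGroup.T • τ).im = _
    rw [UpperHalfPlane.modular_T_smul]
    simp
  funext τ γ
  have h1 : (Λ.weilRep Mp2Z.T : Matrix Λ.Disc Λ.Disc ℂ) β γ = if γ = β then 1 else 0 := by
    have := congrFun (Λ.weilRep_spec.1 γ) β
    rw [Matrix.mulVec_single_one] at this
    change (Λ.weilRep Mp2Z.T : Matrix Λ.Disc Λ.Disc ℂ) β γ = _ at this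
    rw [this, Pi.smul_apply, Pi.single_apply, smul_eq_mul]
    by_cases h : γ = β
    · subst h
      simp [hβ, eMod]
    · simp [h, Ne.symm h]
  simp only [slash, eisensteinSeed, him, Mp2Z.root_T, one_zpow, one_smul, Matrix.mulVec_smul,
    Pi.smul_apply, Matrix.mulVec_single_one]
  congr 1
  change (Λ.weilRep (Mp2Z.T⁻¹)⁻¹ : Matrix Λ.Disc Λ.Disc ℂ) β γ = _
  rw [inv_inv, h1, Pi.single_apply]

end EvenLattice

/-- `Γ̃_∞`, the group of all `((1 n; 0 1), 1) = T ^ n` with `n ∈ ℤ`. -/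
def Mp2Z.GammaInf : Subgroup Mp2Z := Subgroup.zpowers Mp2Z.T

namespace EvenLattice
variable {V : Type*} [AddCommGroup V] [Module ℝ V] (Λ : EvenLattice V)

theorem slash_seed_congr (w : ℤ) {β : Λ.Disc} (hβ : Λ.discForm β = 0) (s : ℂ) {g h : Mp2Z}
    (hgh : h * g⁻¹ ∈ Mp2Z.GammaInf) :
    Λ.slash w (Λ.eisensteinSeed β s) g = Λ.slash w (Λ.eisensteinSeed β s) h := by
  let P : Subgroup Mp2Z :=
    { carrier := {t | Λ.slash w (Λ.eisensteinSeed β s) t = Λ.eisensteinSeed β s}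
      one_mem' := Λ.slash_one _ _
      mul_mem' := fun {x y} hx hy => by
        have hx : Λ.slash w (Λ.eisensteinSeed β s) x = Λ.eisensteinSeed β s := hx
        have hy : Λ.slash w (Λ.eisensteinSeed β s) y = Λ.eisensteinSeed β s := hy
        change Λ.slash w (Λ.eisensteinSeed β s) (x * y) = Λ.eisensteinSeed β s
        rw [slash_mul, hx, hy]
      inv_mem' := fun {x} hx => by
        have hx : Λ.slash w (Λ.eisensteinSeed β s) x = Λ.eisensteinSeed β s := hx
        change Λ.slash w (Λ.eisensteinSeed β s) x⁻¹ = Λ.eisensteinSeed β s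
        conv_lhs => rw [← hx]
        rw [← slash_mul, mul_inv_cancel, slash_one] }
  have hP : Mp2Z.GammaInf ≤ P := by
    rw [Mp2Z.GammaInf, Subgroup.zpowers_le]
    exact Λ.slash_seed_T w hβ s
  have h1 : Λ.slash w (Λ.eisensteinSeed β s) (h * g⁻¹) = Λ.eisensteinSeed β s := hP hgh
  conv_lhs => rw [← h1]
  rw [← slash_mul, inv_mul_cancel_right]

/-- The term `(𝔢_β y^s) ∣_κ^* (M, φ)` at `τ`, as a function of the coset
`(M, φ) ∈ Γ̃_∞ \ Mp₂(ℤ)`, for `β ∈ L'/L` with `q(β) ∈ ℤ` and `w = 2κ`. -/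
def eisensteinTerm (w : ℤ) (β : Λ.Disc) (hβ : Λ.discForm β = 0) (s : ℂ) (τ : ℍ) :
    Quotient (QuotientGroup.rightRel Mp2Z.GammaInf) → Λ.Disc → ℂ :=
  Quotient.lift (fun g => Λ.slash w (Λ.eisensteinSeed β s) g τ) fun _ _ hgh =>
    congrFun (Λ.slash_seed_congr w hβ s (QuotientGroup.rightRel_apply.mp hgh)) τ

/-- The Eisenstein series `E_β(τ, s)` of weight `κ = w / 2`. -/
def eisenstein (w : ℤ) (β : Λ.Disc) (hβ : Λ.discForm β = 0) (s : ℂ) (τ : ℍ) : Λ.Disc → ℂ :=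
  (1 / 2 : ℂ) • ∑' M, Λ.eisensteinTerm w β hβ s τ M

end EvenLattice

/-! ## Kloosterman sums -/

open Classical in
/-- A matrix in `SL₂(ℤ)` with lower row `(c, d)`, for coprime `c` and `d`. -/
def bottomRowMatrix (c d : ℤ) : SL(2, ℤ) :=
  if h : IsCoprime c d then
    ⟨!![h.choose_spec.choose, -h.choose; c, d], by
      rw [Matrix.det_fin_two_of]
      linear_combination h.choose_spec.choose_spec⟩
  else 1

namespace EvenLattice
variable {V : Type*} [AddCommGroup V] [Module ℝ V] (Λ : EvenLattice V)

open Classical in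
/-- The generalized Kloosterman sum
`H_c^*(β, m, γ, n) = exp(-πi sgn(c) κ / 2) / |c| * ∑_d ρ_{βγ}(M̃) e((ma + nd) / c)`. Here `d` runs
through the primitive residues modulo `c` and `M = (a b; c d)`. -/
def kloosterman (κ : ℝ) (c : ℤ) (β : Λ.Disc) (m : ℝ) (γ : Λ.Disc) (n : ℝ) : ℂ :=
  Complex.exp (-Real.pi * Complex.I * c.sign * κ / 2) / (|c| : ℤ) *
    ∑ d ∈ (Finset.range c.natAbs).filter (fun d : ℕ => IsCoprime c (d : ℤ)),
      Λ.weilCoeff β γ (Mp2Z.lift (bottomRowMatrix c d)) *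
        e ((m * (bottomRowMatrix c d 0 0 : ℤ) + n * d) / c)

end EvenLattice

/-! ## Whittaker functions -/

/-- The integral `1 / Γ(a) ∫_0^∞ e^(-zt) t^(a-1) (1+t)^(b-a-1) dt`, which is the confluent
hypergeometric function `U(a, b, z)` for `Re a > 0` and `z > 0`. -/
def tricomiIntegral (a b : ℂ) (z : ℝ) : ℂ :=
  (Complex.Gamma a)⁻¹ * ∫ t in Set.Ioi (0 : ℝ),
    Complex.exp (-z * t) * (t : ℂ) ^ (a - 1) * ((1 + t : ℝ) : ℂ) ^ (b - a - 1)

/-- Analytic continuation of `tricomiIntegral` to `Re a > -k` by means of the contiguous relation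
`U(a, b, z) = (2a + 2 - b + z) U(a + 1, b, z) - (a + 1)(a + 2 - b) U(a + 2, b, z)`. -/
def tricomiAux : ℕ → ℂ → ℂ → ℝ → ℂ
  | 0, a, b, z => tricomiIntegral a b z
  | k + 1, a, b, z => (2 * a + 2 - b + z) * tricomiAux k (a + 1) b z -
      (a + 1) * (a + 2 - b) * tricomiAux k (a + 2) b z

/-- The confluent hypergeometric function (Kummer's function of the second kind) `U(a, b, z)` for
`a, b ∈ ℂ` and real `z > 0`: it is entire in `a`, given by `tricomiIntegral` for `Re a > 0`, and
continued to all `a` with the least `k` such that `Re a + k > 0`. -/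
def tricomiU (a b : ℂ) (z : ℝ) : ℂ := tricomiAux ⌊1 - a.re⌋₊ a b z

/-- The `W`-Whittaker function
`W_{ν,μ}(z) = e^(-z/2) z^(1/2+μ) U(1/2+μ-ν, 1+2μ, z)` for real `z > 0`. -/
def whittakerW (ν μ : ℂ) (z : ℝ) : ℂ :=
  Complex.exp (-z / 2) * (z : ℂ) ^ (1 / 2 + μ) * tricomiU (1 / 2 + μ - ν) (1 + 2 * μ) z

/-- `𝒲_s(y) = |y|^(-κ/2) W_{sgn(y)κ/2, (1-κ)/2-s}(|y|)` for real `y ≠ 0`. -/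
def whittakerCal (κ : ℝ) (s : ℂ) (y : ℝ) : ℂ :=
  ((|y| : ℝ) : ℂ) ^ (-κ / 2 : ℂ) *
    whittakerW ((Real.sign y : ℝ) * κ / 2) ((1 - κ) / 2 - s) |y|

/-! ## The Fourier coefficients -/

namespace EvenLattice
variable {V : Type*} [AddCommGroup V] [Module ℝ V] (Λ : EvenLattice V)

/-- The series `∑_{c ≠ 0} |c|^(1-κ-2s) H_c^*(β, 0, γ, n)`. -/
def kloostermanSeries (κ : ℝ) (β γ : Λ.Disc) (n : ℝ) (s : ℂ) : ℂ :=
  ∑' c : {c : ℤ // c ≠ 0}, (((|c.1| : ℤ) : ℂ) ^ (1 - κ - 2 * s)) * Λ.kloosterman κ c β 0 γ n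

open Classical in
/-- The coefficient `c_β(γ, n, s, y)`. -/
def eisensteinCoeff (κ : ℝ) (β γ : Λ.Disc) (n : ℝ) (s : ℂ) (y : ℝ) : ℂ :=
  if n = 0 then
    ((if β = γ then 1 else 0) + (if -β = γ then 1 else 0)) * (y : ℂ) ^ s +
      2 * Real.pi * (y : ℂ) ^ (1 - κ - s) *
        (Complex.Gamma (κ + 2 * s - 1) / (Complex.Gamma (κ + s) * Complex.Gamma s)) *
        ∑' c : {c : ℤ // c ≠ 0},
          (((|2 * c.1| : ℤ) : ℂ) ^ (1 - κ - 2 * s)) * Λ.kloosterman κ c β 0 γ 0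
  else if 0 < n then
    2 ^ (κ : ℂ) * (Real.pi : ℂ) ^ (s + κ) * ((|n| : ℝ) : ℂ) ^ (s + κ - 1) /
      Complex.Gamma (s + κ) * whittakerCal κ s (4 * Real.pi * n * y) *
      Λ.kloostermanSeries κ β γ n s
  else
    2 ^ (κ : ℂ) * (Real.pi : ℂ) ^ (s + κ) * ((|n| : ℝ) : ℂ) ^ (s + κ - 1) /
      Complex.Gamma s * whittakerCal κ s (4 * Real.pi * n * y) *
      Λ.kloostermanSeries κ β γ n s

end EvenLattice

end

/-!
The term of `E_β` at `(M, φ)` depends only on the lower row `(c, d)` of `M`: elements with the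
same lower row differ by `Γ̃_∞` on the left and by the central element `S ^ 4 = (1, -1)`, and the
weight condition makes `S ^ 4` act trivially. The two roots over each row cancel the factor
`1 / 2`, so `E_β` is the sum over all coprime pairs `(c, d)`, dominated by the classical
Eisenstein series of exponent `κ + 2 Re s > 2` since the entries of a unitary matrix are bounded
by `1`.

The rows `(0, 1)` and `(0, -1)` give `y^s (𝔢_β + 𝔢_{-β})`, because `S ^ 2 = (-1, i)` acts by
`𝔢_γ ↦ i^(b⁻ - b⁺) 𝔢_{-γ}`. For `c ≠ 0` the term with lower row `(c, d)` is a constant times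
`y^s (y - ix)^(-κ-s) (y + ix)^(-s)` with `x` replaced by `x + d / c`
(`automorphy_eq_eulerKernel`), and `d ↦ d + kc` is a translation by `k`, twisted by `e(k q(γ))`.
Poisson summation over `k` (`tsum_eulerKernel`) and the sum over the residues `d` produce the
Kloosterman sums, times the Fourier transform `∫ (y - ix)^(-a) (y + ix)^(-b) e(-nx) dx` at
`a = κ + s`, `b = s`. Absolute convergence of the resulting double series over `c` and `n` follows
from `|H_c^*| ≤ 1` and from the decay `O(n⁻²)` of the transform, by two integrations by parts.

It remains to evaluate the transform for `Re a > 0` and `Re (a + b) > 2`, although `Re b` may be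
negative. Fix `a + b = c`. In the strip `0 < Re a < Re c` the gamma integral for `(y + ix)^(-b)`
and Fourier inversion for that of `(y - ix)^(-a)` express it by `tricomiIntegral`
(`eulerTransform_of_pos_aux`, `eulerTransform_of_neg_aux`). Integration by parts gives a
three-term relation in `a` for the transform (`eulerTransform_contiguous`), which up to gamma
factors is the contiguous relation of Tricomi's function `U` that defines its continuation. As the
strip is wider than `2`, the relation carries the evaluation to all `a` with `Re a > 0`
(`eq_of_contiguous`). Kummer's transformation (`tricomiU_kummer`) brings the result into the form
of the Whittaker function.
-/

/-! ### The contiguous relation of Tricomi's function -/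

section Tricomi
open MeasureTheory Set Filter Topology

theorem cpow_add_one {x : ℂ} (p : ℂ) (hx : x ≠ 0) : x ^ (p + 1) = x ^ p * x := by
  rw [Complex.cpow_add _ _ hx, Complex.cpow_one]

theorem exists_one_add_rpow_le (r : ℝ) {ε : ℝ} (hε : 0 < ε) :
    ∃ C : ℝ, ∀ t : ℝ, 0 ≤ t → (1 + t) ^ r ≤ C * Real.exp (ε * t) := by
  set η := ε / (|r| + 1) with hη
  have hr : 0 < |r| + 1 := by positivity
  have hη0 : 0 < η := by positivity
  refine ⟨Real.exp (|r| * (η - 1 - Real.log η)), fun t ht => ?_⟩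
  have h1 : 0 < 1 + t := by linarith
  rw [Real.rpow_def_of_pos h1, ← Real.exp_add, Real.exp_le_exp]
  have h0 : 0 ≤ Real.log (1 + t) := Real.log_nonneg (by linarith)
  have h2 : Real.log (η * (1 + t)) ≤ η * (1 + t) - 1 := Real.log_le_sub_one_of_pos (by positivity)
  rw [Real.log_mul hη0.ne' h1.ne'] at h2
  have h3 : Real.log (1 + t) * r ≤ Real.log (1 + t) * |r| :=
    mul_le_mul_of_nonneg_left (le_abs_self r) h0
  have h4 : |r| * Real.log (1 + t) ≤ |r| * (η * (1 + t) - 1 - Real.log η) :=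
    mul_le_mul_of_nonneg_left (by linarith) (abs_nonneg r)
  have h5 : |r| * (η * t) ≤ ε * t := by
    have : ε = η * (|r| + 1) := by rw [hη]; field_simp
    rw [this]
    nlinarith [mul_nonneg hη0.le ht]
  nlinarith

theorem norm_tricomi_integrand (p q : ℂ) (z : ℝ) {t : ℝ} (ht : 0 < t) :
    ‖Complex.exp (-z * t) * (t : ℂ) ^ (p - 1) * ((1 + t : ℝ) : ℂ) ^ q‖ =
      Real.exp (-z * t) * t ^ (p.re - 1) * (1 + t) ^ q.re := by
  rw [norm_mul, norm_mul, Complex.norm_exp, Complex.norm_cpow_eq_rpow_re_of_pos ht,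
    Complex.norm_cpow_eq_rpow_re_of_pos (by linarith : 0 < 1 + t)]
  simp

theorem continuousOn_tricomi_integrand (p q : ℂ) (z : ℝ) :
    ContinuousOn (fun t : ℝ => Complex.exp (-z * t) * (t : ℂ) ^ (p - 1) * ((1 + t : ℝ) : ℂ) ^ q)
      (Ioi 0) := by
  have h1 : ∀ t ∈ Ioi (0 : ℝ), (t : ℂ) ∈ Complex.slitPlane := fun t ht => Or.inl (by simpa using ht)
  have h2 : ∀ t ∈ Ioi (0 : ℝ), ((1 + t : ℝ) : ℂ) ∈ Complex.slitPlane := fun t ht =>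
    Or.inl (by rw [Complex.ofReal_re]; have : 0 < t := ht; linarith)
  refine ((Continuous.continuousOn (by fun_prop)).mul
    (ContinuousOn.cpow_const (by fun_prop) h1)).mul (ContinuousOn.cpow_const (by fun_prop) h2)

theorem integrableOn_tricomi {p : ℂ} (q : ℂ) (hp : 0 < p.re) {z : ℝ} (hz : 0 < z) :
    IntegrableOn (fun t : ℝ => Complex.exp (-z * t) * (t : ℂ) ^ (p - 1) * ((1 + t : ℝ) : ℂ) ^ q)
      (Ioi 0) := by
  obtain ⟨C, hC⟩ := exists_one_add_rpow_le q.re (half_pos hz)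
  have h := (integrableOn_rpow_mul_exp_neg_mul_rpow (s := p.re - 1) (by linarith)
    (zero_lt_one' ℝ) (half_pos hz)).const_mul C
  refine Integrable.mono' h ?_ ?_
  · exact (continuousOn_tricomi_integrand p q z).aestronglyMeasurable measurableSet_Ioi
  · refine (ae_restrict_mem measurableSet_Ioi).mono fun t ht => ?_
    have ht : 0 < t := ht
    rw [norm_tricomi_integrand p q z ht, Real.rpow_one]
    have h1 : Real.exp (-z * t) = Real.exp (-(z / 2) * t) * Real.exp (-(z / 2) * t) := by
      rw [← Real.exp_add]; ring_nf
    have h2 : Real.exp (-(z / 2) * t) * Real.exp (z / 2 * t) = 1 := by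
      rw [← Real.exp_add]; simp
    calc _ ≤ Real.exp (-z * t) * t ^ (p.re - 1) * (C * Real.exp (z / 2 * t)) := by
          gcongr; exact hC t ht.le
      _ = _ := by
          rw [h1]
          linear_combination (Real.exp (-(z / 2) * t) * t ^ (p.re - 1) * C) * h2

theorem integral_linear_combination {α : Type*} [MeasurableSpace α] {μ : Measure α} {f g h : α → ℂ}
    (hf : Integrable f μ) (hg : Integrable g μ) (hh : Integrable h μ) (p q r : ℂ) :
    p * ∫ x, f x ∂μ - q * ∫ x, g x ∂μ + r * ∫ x, h x ∂μ =
      ∫ x, (p * f x - q * g x + r * h x) ∂μ := by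
  rw [integral_add, integral_sub (hf.const_mul p) (hg.const_mul q), integral_const_mul,
    integral_const_mul, integral_const_mul]
  · exact (hf.const_mul p).sub (hg.const_mul q)
  · exact hh.const_mul r

/-- The Mellin-type integral satisfies the contiguous relation: the combination of the three
integrands is the derivative of `exp(-zt) t^a (1+t)^(b-a-2)`. -/
theorem tricomiIntegral_contiguous {a : ℂ} (b : ℂ) (ha : 0 < a.re) {z : ℝ} (hz : 0 < z) :
    tricomiIntegral a b z = (2 * a + 2 - b + z) * tricomiIntegral (a + 1) b z -
      (a + 1) * (a + 2 - b) * tricomiIntegral (a + 2) b z := by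
  have ha0 : a ≠ 0 := by rintro rfl; simp at ha
  have ha1 : a + 1 ≠ 0 := by
    intro h; have := congrArg Complex.re h; simp at this; linarith
  have hG : Complex.Gamma a ≠ 0 := Complex.Gamma_ne_zero_of_re_pos ha
  have i0 := integrableOn_tricomi (p := a) (b - a - 1) ha hz
  have i1 := integrableOn_tricomi (p := a + 1) (b - (a + 1) - 1) (by simp; linarith) hz
  have i2 := integrableOn_tricomi (p := a + 2) (b - (a + 2) - 1) (by simp; linarith) hz
  have key : a * (∫ t in Ioi (0 : ℝ), Complex.exp (-z * t) * (t : ℂ) ^ (a - 1) *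
        ((1 + t : ℝ) : ℂ) ^ (b - a - 1)) -
      (2 * a + 2 - b + z) * (∫ t in Ioi (0 : ℝ), Complex.exp (-z * t) * (t : ℂ) ^ (a + 1 - 1) *
        ((1 + t : ℝ) : ℂ) ^ (b - (a + 1) - 1)) +
      (a + 2 - b) * (∫ t in Ioi (0 : ℝ), Complex.exp (-z * t) * (t : ℂ) ^ (a + 2 - 1) *
        ((1 + t : ℝ) : ℂ) ^ (b - (a + 2) - 1)) = 0 := by
    rw [integral_linear_combination i0 i1 i2]
    set g : ℝ → ℂ := fun t => Complex.exp (-z * t) * (t : ℂ) ^ a *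
      ((1 + t : ℝ) : ℂ) ^ (b - a - 2) with hg
    have hint := ((i0.const_mul a).sub (i1.const_mul (2 * a + 2 - b + z))).add
      (i2.const_mul (a + 2 - b))
    have hd : ∀ t ∈ Ioi (0 : ℝ), HasDerivAt g (a * (Complex.exp (-z * t) * (t : ℂ) ^ (a - 1) *
        ((1 + t : ℝ) : ℂ) ^ (b - a - 1)) -
      (2 * a + 2 - b + z) * (Complex.exp (-z * t) * (t : ℂ) ^ (a + 1 - 1) *
        ((1 + t : ℝ) : ℂ) ^ (b - (a + 1) - 1)) +
      (a + 2 - b) * (Complex.exp (-z * t) * (t : ℂ) ^ (a + 2 - 1) *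
        ((1 + t : ℝ) : ℂ) ^ (b - (a + 2) - 1))) t := by
      intro t ht
      have ht : 0 < t := ht
      have hc : HasDerivAt (fun t : ℝ => (t : ℂ)) 1 t := Complex.ofRealCLM.hasDerivAt
      have e1 : HasDerivAt (fun t : ℝ => Complex.exp (-z * t)) (Complex.exp (-z * t) * (-z)) t := by
        simpa using (hc.const_mul (-z : ℂ)).cexp
      have e2 : HasDerivAt (fun t : ℝ => (t : ℂ) ^ a) (a * (t : ℂ) ^ (a - 1)) t := by
        simpa using ((hasDerivAt_id (t : ℂ)).cpow_const (c := a)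
          (Or.inl (by simpa using ht))).comp_ofReal
      have e3 : HasDerivAt (fun t : ℝ => ((1 + t : ℝ) : ℂ) ^ (b - a - 2))
          ((b - a - 2) * ((1 + t : ℝ) : ℂ) ^ (b - a - 2 - 1)) t := by
        simpa using (((hasDerivAt_id (t : ℂ)).const_add 1).cpow_const (c := b - a - 2)
          (Or.inl (by simp; linarith))).comp_ofReal
      have htc : (t : ℂ) ≠ 0 := by exact_mod_cast ht.ne'
      have htc1 : ((1 + t : ℝ) : ℂ) ≠ 0 := by
        have : (1 + t) ≠ 0 := by linarith
        exact_mod_cast this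
      refine ((e1.mul e2).mul e3).congr_deriv ?_
      -- All powers are integral shifts of `t^(a-1)` and `(1+t)^(b-a-3)`.
      have t1 : (t : ℂ) ^ a = (t : ℂ) ^ (a - 1) * t := by
        rw [← cpow_add_one _ htc]; ring_nf
      have t2 : (t : ℂ) ^ (a + 1 - 1) = (t : ℂ) ^ (a - 1) * t := by rw [← t1]; ring_nf
      have t3 : (t : ℂ) ^ (a + 2 - 1) = (t : ℂ) ^ (a - 1) * t * t := by
        rw [← t1, ← cpow_add_one _ htc]; ring_nf
      have s0 : ((1 + t : ℝ) : ℂ) ^ (b - a - 2) =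
          ((1 + t : ℝ) : ℂ) ^ (b - a - 2 - 1) * (1 + t) := by
        have := cpow_add_one (b - a - 2 - 1) htc1
        rw [sub_add_cancel] at this
        rw [this]; push_cast; ring
      have s1 : ((1 + t : ℝ) : ℂ) ^ (b - (a + 1) - 1) =
          ((1 + t : ℝ) : ℂ) ^ (b - a - 2 - 1) * (1 + t) := by rw [← s0]; ring_nf
      have s2 : ((1 + t : ℝ) : ℂ) ^ (b - a - 1) =
          ((1 + t : ℝ) : ℂ) ^ (b - a - 2 - 1) * (1 + t) * (1 + t) := by
        have := cpow_add_one (b - a - 2) htc1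
        rw [← s0, show b - a - 1 = b - a - 2 + 1 by ring, this]; push_cast; ring
      have s3 : ((1 + t : ℝ) : ℂ) ^ (b - (a + 2) - 1) = ((1 + t : ℝ) : ℂ) ^ (b - a - 2 - 1) := by
        ring_nf
      simp only [Pi.mul_apply]
      rw [s0, s1, s2, s3, t1, t2, t3]
      ring
    have hgm : IntegrableOn g (Ioi 0) := by
      have := integrableOn_tricomi (p := a + 1) (b - a - 2) (by simp; linarith) hz
      simpa [hg] using this
    have hcont : ContinuousWithinAt g (Ici 0) 0 := by
      have h1 : ContinuousAt (fun t : ℝ => (t : ℂ) ^ a) 0 :=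
        Complex.continuousAt_ofReal_cpow_const _ _ (Or.inl ha)
      have h2 : ContinuousAt (fun t : ℝ => ((1 + t : ℝ) : ℂ) ^ (b - a - 2)) 0 :=
        ContinuousAt.cpow (by fun_prop) continuousAt_const (Or.inl (by simp))
      have h3 : ContinuousAt (fun t : ℝ => Complex.exp (-z * t)) 0 := by fun_prop
      exact ((h3.mul h1).mul h2).continuousWithinAt
    have hlim : Tendsto g atTop (𝓝 0) :=
      tendsto_zero_of_hasDerivAt_of_integrableOn_Ioi hd hint hgm
    have := integral_Ioi_of_hasDerivAt_of_tendsto hcont hd hint hlim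
    rw [show (0 : ℂ) = 0 - g 0 by simp [hg, Complex.zero_cpow ha0]]
    exact this
  have g1 : Complex.Gamma (a + 1) = a * Complex.Gamma a := Complex.Gamma_add_one a ha0
  have g2 : Complex.Gamma (a + 2) = (a + 1) * (a * Complex.Gamma a) := by
    rw [show a + 2 = a + 1 + 1 by ring, Complex.Gamma_add_one _ ha1, g1]
  unfold tricomiIntegral
  rw [g1, g2]
  generalize (∫ t in Ioi (0 : ℝ), Complex.exp (-z * t) * (t : ℂ) ^ (a - 1) *
    ((1 + t : ℝ) : ℂ) ^ (b - a - 1)) = M0 at key ⊢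
  generalize (∫ t in Ioi (0 : ℝ), Complex.exp (-z * t) * (t : ℂ) ^ (a + 1 - 1) *
    ((1 + t : ℝ) : ℂ) ^ (b - (a + 1) - 1)) = M1 at key ⊢
  generalize (∫ t in Ioi (0 : ℝ), Complex.exp (-z * t) * (t : ℂ) ^ (a + 2 - 1) *
    ((1 + t : ℝ) : ℂ) ^ (b - (a + 2) - 1)) = M2 at key ⊢
  field_simp
  linear_combination key

theorem tricomiAux_succ_eq (k : ℕ) : ∀ {a : ℂ} (b : ℂ) {z : ℝ}, -(k : ℝ) < a.re → 0 < z →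
    tricomiAux (k + 1) a b z = tricomiAux k a b z := by
  induction k with
  | zero =>
    intro a b z ha hz
    rw [tricomiAux, tricomiAux, tricomiAux, tricomiAux]
    exact (tricomiIntegral_contiguous b (by simpa using ha) hz).symm
  | succ k ih =>
    intro a b z ha hz
    push_cast at ha
    rw [tricomiAux, ih b (by simp; linarith) hz, ih b (by simp; linarith) hz, ← tricomiAux]

theorem tricomiAux_eq_of_le {k l : ℕ} (hkl : k ≤ l) {a : ℂ} (b : ℂ) {z : ℝ}
    (ha : -(k : ℝ) < a.re) (hz : 0 < z) : tricomiAux l a b z = tricomiAux k a b z := by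
  induction l, hkl using Nat.le_induction with
  | base => rfl
  | succ l hl ih =>
    rw [tricomiAux_succ_eq l b _ hz, ih]
    have : (k : ℝ) ≤ l := by exact_mod_cast hl
    linarith

theorem tricomiU_eq_aux {k : ℕ} {a : ℂ} (b : ℂ) {z : ℝ} (ha : -(k : ℝ) < a.re) (hz : 0 < z) :
    tricomiU a b z = tricomiAux k a b z := by
  have h1 : -((⌊1 - a.re⌋₊ : ℕ) : ℝ) < a.re := by
    have := Nat.lt_floor_add_one (1 - a.re)
    linarith
  rcases le_total ⌊1 - a.re⌋₊ k with h | h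
  · exact (tricomiAux_eq_of_le h b h1 hz).symm
  · exact tricomiAux_eq_of_le h b ha hz

theorem tricomiU_of_re_pos {a : ℂ} (b : ℂ) {z : ℝ} (ha : 0 < a.re) (hz : 0 < z) :
    tricomiU a b z = tricomiIntegral a b z :=
  tricomiU_eq_aux (k := 0) b (by simpa using ha) hz

/-- The contiguous relation holds for the continued function at every `a`. -/
theorem tricomiU_contiguous (a b : ℂ) {z : ℝ} (hz : 0 < z) :
    tricomiU a b z = (2 * a + 2 - b + z) * tricomiU (a + 1) b z -
      (a + 1) * (a + 2 - b) * tricomiU (a + 2) b z := by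
  obtain ⟨k, hk⟩ := exists_nat_gt (-a.re)
  have hk' : -(k : ℝ) < a.re := by linarith
  rw [tricomiU_eq_aux (k := k + 1) b (by push_cast; linarith) hz,
    tricomiU_eq_aux (k := k) b (by simp; linarith) hz,
    tricomiU_eq_aux (k := k) b (by simp; linarith) hz, tricomiAux]

end Tricomi

/-! ### Kummer's transformation and the gamma integral -/

section Kummer
open MeasureTheory Set Filter Topology

theorem integrableOn_exp_mul_cpow {p : ℂ} (hp : 0 < p.re) {z : ℝ} (hz : 0 < z) :
    IntegrableOn (fun t : ℝ => Complex.exp (-z * t) * (t : ℂ) ^ (p - 1)) (Ioi 0) := by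
  simpa using integrableOn_tricomi 0 hp hz

theorem integral_exp_mul_cpow {p : ℂ} (hp : 0 < p.re) {z : ℝ} (hz : 0 < z) :
    ∫ t : ℝ in Ioi 0, Complex.exp (-z * t) * (t : ℂ) ^ (p - 1) =
      (z : ℂ) ^ (-p) * Complex.Gamma p := by
  have h := Complex.integral_cpow_mul_exp_neg_mul_Ioi hp hz
  rw [one_div,
    Complex.inv_cpow _ _ (by rw [Complex.arg_ofReal_of_nonneg hz.le]; exact Real.pi_pos.ne),
    ← Complex.cpow_neg] at h
  rw [← h]
  refine integral_congr_ae (ae_of_all _ fun t => ?_)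
  simp only [neg_mul]
  rw [mul_comm]

theorem ae_prod_Ioi_pos : ∀ᵐ x : ℝ × ℝ ∂((volume.restrict (Ioi 0)).prod (volume.restrict (Ioi 0))),
    0 < x.1 ∧ 0 < x.2 := by
  rw [Measure.prod_restrict]
  exact (ae_restrict_mem (measurableSet_Ioi.prod measurableSet_Ioi)).mono fun x hx => hx

/-- Kummer's transformation, for the integral representations: insert the gamma integral for
`(1 + t)^(-β)` and interchange the integrations. -/
theorem kummer_integral {α β : ℂ} (hα : 0 < α.re) (hβ : 0 < β.re) {z : ℝ} (hz : 0 < z) :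
    (Complex.Gamma α)⁻¹ * ∫ t : ℝ in Ioi 0, Complex.exp (-z * t) * (t : ℂ) ^ (α - 1) *
      ((1 + t : ℝ) : ℂ) ^ (-β) =
    (z : ℂ) ^ (β - α) * ((Complex.Gamma β)⁻¹ * ∫ t : ℝ in Ioi 0, Complex.exp (-z * t) *
      (t : ℂ) ^ (β - 1) * ((1 + t : ℝ) : ℂ) ^ (-α)) := by
  have hGα : Complex.Gamma α ≠ 0 := Complex.Gamma_ne_zero_of_re_pos hα
  have hGβ : Complex.Gamma β ≠ 0 := Complex.Gamma_ne_zero_of_re_pos hβ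
  have hzc : (z : ℂ) ≠ 0 := by exact_mod_cast hz.ne'
  set F : ℝ → ℝ → ℂ := fun t u => Complex.exp (-(u * t)) *
    ((Complex.exp (-z * t) * (t : ℂ) ^ (α - 1)) *
      (Complex.exp (-(1 : ℝ) * u) * (u : ℂ) ^ (β - 1))) with hF
  have hint : Integrable (Function.uncurry F)
      ((volume.restrict (Ioi 0)).prod (volume.restrict (Ioi 0))) := by
    refine ((integrableOn_exp_mul_cpow hα hz).mul_prod
      (integrableOn_exp_mul_cpow hβ zero_lt_one)).bdd_mul (c := 1)
      (Continuous.aestronglyMeasurable (by fun_prop)) ?_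
    refine ae_prod_Ioi_pos.mono fun x hx => ?_
    rw [Complex.norm_exp]
    simpa using mul_nonneg hx.2.le hx.1.le
  have hswap := integral_integral_swap hint
  have h1 : ∀ t ∈ Ioi (0 : ℝ), ∫ u in Ioi (0 : ℝ), F t u =
      Complex.Gamma β * (Complex.exp (-z * t) * (t : ℂ) ^ (α - 1) *
      ((1 + t : ℝ) : ℂ) ^ (-β)) := fun t ht => by
    have ht : 0 < t := ht
    have := integral_exp_mul_cpow hβ (by linarith : 0 < 1 + t)
    have h2 : ∀ u : ℝ, F t u = (Complex.exp (-z * t) * (t : ℂ) ^ (α - 1)) *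
        (Complex.exp (-(1 + t : ℝ) * u) * (u : ℂ) ^ (β - 1)) := fun u => by
      have : Complex.exp (-(1 + t : ℝ) * u) = Complex.exp (-(u * t)) *
          Complex.exp (-(1 : ℝ) * u) := by
        rw [← Complex.exp_add]; push_cast; ring_nf
      rw [hF, this]; ring
    simp_rw [h2]
    rw [integral_const_mul, this]; ring
  have h1' : ∀ u ∈ Ioi (0 : ℝ), ∫ t in Ioi (0 : ℝ), F t u =
      Complex.Gamma α * (Complex.exp (-u) * (u : ℂ) ^ (β - 1) *
      ((z + u : ℝ) : ℂ) ^ (-α)) := fun u hu => by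
    have hu : 0 < u := hu
    have := integral_exp_mul_cpow hα (by linarith : 0 < z + u)
    have h2 : ∀ t : ℝ, F t u = (Complex.exp (-u) * (u : ℂ) ^ (β - 1)) *
        (Complex.exp (-(z + u : ℝ) * t) * (t : ℂ) ^ (α - 1)) := fun t => by
      have : Complex.exp (-(z + u : ℝ) * t) = Complex.exp (-(u * t)) *
          Complex.exp (-z * t) := by
        rw [← Complex.exp_add]; push_cast; ring_nf
      simp only [hF]
      rw [this]; push_cast; ring_nf
    simp_rw [h2]
    rw [integral_const_mul, this]; ring
  rw [setIntegral_congr_fun measurableSet_Ioi h1, setIntegral_congr_fun measurableSet_Ioi h1',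
    integral_const_mul, integral_const_mul] at hswap
  have h3 : ∫ u : ℝ in Ioi 0, Complex.exp (-u) * (u : ℂ) ^ (β - 1) * ((z + u : ℝ) : ℂ) ^ (-α) =
      (z : ℂ) ^ (β - α) * ∫ t : ℝ in Ioi 0, Complex.exp (-z * t) *
      (t : ℂ) ^ (β - 1) * ((1 + t : ℝ) : ℂ) ^ (-α) := by
    have := integral_comp_mul_left_Ioi (fun u : ℝ => Complex.exp (-u) * (u : ℂ) ^ (β - 1) *
      ((z + u : ℝ) : ℂ) ^ (-α)) 0 hz
    rw [mul_zero] at this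
    have h4 : ∀ t ∈ Ioi (0 : ℝ), Complex.exp (-(z * t : ℝ)) * ((z * t : ℝ) : ℂ) ^ (β - 1) *
        ((z + z * t : ℝ) : ℂ) ^ (-α) = ((z : ℂ) ^ (β - α) * (z : ℂ)⁻¹) * (Complex.exp (-z * t) *
      (t : ℂ) ^ (β - 1) * ((1 + t : ℝ) : ℂ) ^ (-α)) := fun t ht => by
      have ht : 0 < t := ht
      rw [show z + z * t = z * (1 + t) by ring, Complex.ofReal_mul z t,
        Complex.ofReal_mul z (1 + t), Complex.mul_cpow_ofReal_nonneg hz.le ht.le,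
        Complex.mul_cpow_ofReal_nonneg hz.le (by linarith)]
      have : (z : ℂ) ^ (β - α) * (z : ℂ)⁻¹ = (z : ℂ) ^ (β - 1) * (z : ℂ) ^ (-α) := by
        rw [← Complex.cpow_add _ _ hzc, ← Complex.cpow_neg_one, ← Complex.cpow_add _ _ hzc]
        ring_nf
      rw [this]; ring_nf
    rw [setIntegral_congr_fun measurableSet_Ioi h4, integral_const_mul] at this
    rw [Complex.real_smul, Complex.ofReal_inv] at this
    have h5 := congrArg (fun x => (z : ℂ) * x) this
    simp only [mul_inv_cancel_left₀ hzc] at h5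
    rw [← h5]; field_simp
  rw [h3] at hswap
  field_simp
  simp only [neg_mul] at hswap ⊢
  linear_combination hswap

/-- Kummer's transformation `U(a, 2 - c, z) = z^(c-1) U(a + c - 1, c, z)` for the continued
function; both sides satisfy the same contiguous relation. -/
theorem tricomiU_kummer {c : ℂ} {z : ℝ} (hz : 0 < z) {a : ℂ}
    (ha : 0 < (c - 1 + a).re) :
    tricomiU a (2 - c) z = (z : ℂ) ^ (c - 1) * tricomiIntegral (c - 1 + a) c z := by
  have key : ∀ k : ℕ, ∀ a : ℂ, 0 < (c - 1 + a).re → -(k : ℝ) < a.re →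
      tricomiU a (2 - c) z = (z : ℂ) ^ (c - 1) * tricomiIntegral (c - 1 + a) c z := by
    intro k
    induction k with
    | zero =>
      intro a ha h
      have h : 0 < a.re := by simpa using h
      rw [tricomiU_of_re_pos _ h hz]
      have := kummer_integral h ha hz
      rw [tricomiIntegral, tricomiIntegral, show 2 - c - a - 1 = -(c - 1 + a) by ring, this,
        show c - (c - 1 + a) - 1 = -a by ring, show c - 1 + a - a = c - 1 by ring]
    | succ k ih =>
      intro a ha h
      push_cast at h
      simp only [Complex.add_re, Complex.sub_re, Complex.one_re] at ha
      rw [tricomiU_contiguous a _ hz, ih (a + 1) (by simp; linarith) (by simp; linarith),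
        ih (a + 2) (by simp; linarith) (by simp; linarith),
        tricomiIntegral_contiguous (a := c - 1 + a) c (by simp; linarith) hz,
        show c - 1 + (a + 1) = c - 1 + a + 1 by ring, show c - 1 + (a + 2) = c - 1 + a + 2 by ring]
      ring
  obtain ⟨k, hk⟩ := exists_nat_gt (-a.re)
  exact key k a ha (by linarith)

/-- The gamma integral `∫_0^∞ exp(-ζt) t^(p-1) dt = ζ^(-p) Γ(p)` in the half plane `Re ζ > 0`, by
the identity theorem. -/
theorem integral_cexp_mul_cpow {p : ℂ} (hp : 0 < p.re) {ζ : ℂ} (hζ : 0 < ζ.re) :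
    ∫ t : ℝ in Ioi 0, Complex.exp (-ζ * t) * (t : ℂ) ^ (p - 1) =
      ζ ^ (-p) * Complex.Gamma p := by
  set U : Set ℂ := {ζ | 0 < ζ.re} with hU
  have hUo : IsOpen U := isOpen_lt continuous_const Complex.continuous_re
  have hcont : ∀ (q : ℂ) (ζ : ℂ), ContinuousOn
      (fun t : ℝ => Complex.exp (-ζ * t) * (t : ℂ) ^ q) (Ioi 0) := fun q ζ =>
    (Continuous.continuousOn (by fun_prop)).mul (ContinuousOn.cpow_const (by fun_prop)
      fun t ht => Or.inl (by simpa using ht))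
  have hd : DifferentiableOn ℂ
      (fun ζ => ∫ t : ℝ in Ioi 0, Complex.exp (-ζ * t) * (t : ℂ) ^ (p - 1)) U := by
    intro ζ hζ
    have hζ : 0 < ζ.re := hζ
    have hs : {w : ℂ | ζ.re / 2 < w.re} ∈ 𝓝 ζ :=
      (isOpen_lt continuous_const Complex.continuous_re).mem_nhds (by simp; linarith)
    have hb := integrableOn_rpow_mul_exp_neg_mul_rpow (s := p.re) (by linarith)
      (zero_lt_one' ℝ) (half_pos hζ)
    have hm := integrableOn_exp_mul_cpow hp hζ
    refine (hasDerivAt_integral_of_dominated_loc_of_deriv_le (F := fun (ζ : ℂ) (t : ℝ) =>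
      Complex.exp (-ζ * t) * (t : ℂ) ^ (p - 1))
      (F' := fun (ζ : ℂ) (t : ℝ) => Complex.exp (-ζ * t) * (-t) * (t : ℂ) ^ (p - 1))
      (bound := fun t => t ^ p.re * Real.exp (-(ζ.re / 2) * t ^ (1 : ℝ))) hs
      (Eventually.of_forall fun w => (hcont _ w).aestronglyMeasurable measurableSet_Ioi)
      ?_ ?_ ?_ hb ?_).2.differentiableAt.differentiableWithinAt
    · refine Integrable.mono hm ((hcont _ ζ).aestronglyMeasurable measurableSet_Ioi) ?_
      refine ae_of_all _ fun t => ?_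
      rw [norm_mul, norm_mul, Complex.norm_exp, Complex.norm_exp]
      simp
    · refine ContinuousOn.aestronglyMeasurable ?_ measurableSet_Ioi
      exact (Continuous.continuousOn (by fun_prop)).mul (ContinuousOn.cpow_const (by fun_prop)
        fun t ht => Or.inl (by simpa using ht))
    · refine (ae_restrict_mem measurableSet_Ioi).mono fun t ht w hw => ?_
      have ht : 0 < t := ht
      have hw : ζ.re / 2 < w.re := hw
      rw [norm_mul, norm_mul, Complex.norm_exp, Complex.norm_cpow_eq_rpow_re_of_pos ht, norm_neg,
        Complex.norm_real, Real.norm_eq_abs, abs_of_pos ht, mul_assoc, Real.rpow_one, mul_comm]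
      have h1 : t * t ^ (p - 1).re = t ^ p.re := by
        rw [Complex.sub_re, Complex.one_re, Real.rpow_sub_one ht.ne']; field_simp
      rw [h1]
      gcongr
      simp
      nlinarith
    · refine ae_of_all _ fun t w _ => ?_
      have : HasDerivAt (fun w : ℂ => Complex.exp (-w * t)) (Complex.exp (-w * t) * (-t)) w := by
        simpa using (((hasDerivAt_id w).neg.mul_const (t : ℂ))).cexp
      exact this.mul_const _
  have hg : DifferentiableOn ℂ (fun ζ : ℂ => ζ ^ (-p) * Complex.Gamma p) U := by
    intro ζ hζ
    exact ((differentiableAt_id.cpow_const (Or.inl hζ)).mul_const _).differentiableWithinAt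
  refine (hd.analyticOnNhd hUo).eqOn_of_preconnected_of_frequently_eq (hg.analyticOnNhd hUo)
    (z₀ := 1) (convex_halfSpace_re_gt 0).isPreconnected (by simp [hU]) ?_ hζ
  have ht : Tendsto (fun x : ℝ => (x : ℂ)) (𝓝[≠] 1) (𝓝[≠] 1) := by
    refine tendsto_nhdsWithin_iff.mpr ⟨?_, ?_⟩
    · exact (Complex.continuous_ofReal.tendsto' 1 1 (by simp)).mono_left nhdsWithin_le_nhds
    · filter_upwards [self_mem_nhdsWithin] with x hx
      simpa using hx
  refine ht.frequently (Eventually.frequently ?_)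
  filter_upwards [nhdsWithin_le_nhds (Ioi_mem_nhds (zero_lt_one' ℝ))] with x hx
  exact integral_exp_mul_cpow hp hx

end Kummer

/-! ### The kernel and its Fourier transform -/

section Kernel
open MeasureTheory Set Filter Topology

/-- The kernel `(y - ix)^(-a) (y + ix)^(-b)`. -/
noncomputable def eulerKernel (a b : ℂ) (y x : ℝ) : ℂ :=
  ((y : ℂ) - Complex.I * x) ^ (-a) * ((y : ℂ) + Complex.I * x) ^ (-b)

/-- The Fourier transform `∫ (y - ix)^(-a) (y + ix)^(-b) e(-nx) dx`. -/
noncomputable def eulerTransform (a b : ℂ) (y n : ℝ) : ℂ :=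
  ∫ x : ℝ, eulerKernel a b y x * e (-(n * x))

theorem sub_I_mem_slitPlane {y : ℝ} (hy : 0 < y) (x : ℝ) :
    (y : ℂ) - Complex.I * x ∈ Complex.slitPlane := Or.inl (by simpa using hy)

theorem add_I_mem_slitPlane {y : ℝ} (hy : 0 < y) (x : ℝ) :
    (y : ℂ) + Complex.I * x ∈ Complex.slitPlane := Or.inl (by simpa using hy)

theorem norm_e_ofReal (x : ℝ) : ‖e x‖ = 1 := by
  rw [e, Complex.norm_exp]; simp

theorem norm_e_neg_mul (n x : ℝ) : ‖e (-(n * x))‖ = 1 := by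
  have := norm_e_ofReal (-(n * x)); push_cast at this; exact this

@[fun_prop]
theorem continuous_e : Continuous e := by unfold e; fun_prop

theorem continuous_eulerKernel (a b : ℂ) {y : ℝ} (hy : 0 < y) : Continuous (eulerKernel a b y) :=
  (Continuous.cpow (by fun_prop) continuous_const (sub_I_mem_slitPlane hy)).mul
    (Continuous.cpow (by fun_prop) continuous_const (add_I_mem_slitPlane hy))

theorem norm_cpow_le_exp {z : ℂ} (hz : z ≠ 0) (w : ℂ) :
    ‖z ^ w‖ ≤ Real.exp (Real.pi * |w.im|) * ‖z‖ ^ w.re := by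
  rw [Complex.norm_cpow_of_ne_zero hz, div_eq_mul_inv, ← Real.exp_neg, mul_comm]
  gcongr
  calc -(z.arg * w.im) ≤ |z.arg * w.im| := neg_le_abs _
    _ = |z.arg| * |w.im| := abs_mul _ _
    _ ≤ _ := by gcongr; exact Complex.abs_arg_le_pi z

theorem norm_eulerKernel_le (a b : ℂ) {y : ℝ} (hy : 0 < y) (hab : 0 ≤ (a + b).re) :
    ∃ C : ℝ, ∀ x : ℝ, ‖eulerKernel a b y x‖ ≤ C * (1 + ‖x‖ ^ 2) ^ (-(a + b).re / 2) := by
  set m := min 1 (y ^ 2) with hm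
  have hm0 : 0 < m := lt_min one_pos (by positivity)
  refine ⟨Real.exp (Real.pi * |(-a).im|) * Real.exp (Real.pi * |(-b).im|) *
    m ^ (-(a + b).re / 2), fun x => ?_⟩
  have n1 : ‖(y : ℂ) - Complex.I * x‖ = (y ^ 2 + x ^ 2) ^ (1 / 2 : ℝ) := by
    rw [Complex.norm_def, Real.sqrt_eq_rpow]; congr 1
    simp [Complex.normSq_apply]; ring
  have n2 : ‖(y : ℂ) + Complex.I * x‖ = (y ^ 2 + x ^ 2) ^ (1 / 2 : ℝ) := by
    rw [Complex.norm_def, Real.sqrt_eq_rpow]; congr 1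
    simp [Complex.normSq_apply]; ring
  have hp : 0 < y ^ 2 + x ^ 2 := by positivity
  have h1 := norm_cpow_le_exp (Complex.slitPlane_ne_zero (sub_I_mem_slitPlane hy x)) (-a)
  have h2 := norm_cpow_le_exp (Complex.slitPlane_ne_zero (add_I_mem_slitPlane hy x)) (-b)
  rw [n1, ← Real.rpow_mul hp.le] at h1
  rw [n2, ← Real.rpow_mul hp.le] at h2
  have h3 : (y ^ 2 + x ^ 2) ^ (-(a + b).re / 2) ≤ (m * (1 + ‖x‖ ^ 2)) ^ (-(a + b).re / 2) := by
    refine Real.rpow_le_rpow_of_nonpos (by positivity) ?_ (by linarith)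
    rw [Real.norm_eq_abs, sq_abs, mul_add, mul_one]
    have := min_le_left 1 (y ^ 2)
    have := min_le_right 1 (y ^ 2)
    nlinarith [sq_nonneg x]
  rw [Real.mul_rpow hm0.le (by positivity)] at h3
  calc ‖eulerKernel a b y x‖ ≤ (Real.exp (Real.pi * |(-a).im|) *
        (y ^ 2 + x ^ 2) ^ (1 / 2 * (-a).re)) * (Real.exp (Real.pi * |(-b).im|) *
        (y ^ 2 + x ^ 2) ^ (1 / 2 * (-b).re)) := by
        rw [eulerKernel, norm_mul]; gcongr
    _ = Real.exp (Real.pi * |(-a).im|) * Real.exp (Real.pi * |(-b).im|) *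
        (y ^ 2 + x ^ 2) ^ (-(a + b).re / 2) := by
        have : -(a + b).re / 2 = 1 / 2 * (-a).re + 1 / 2 * (-b).re := by simp; ring
        rw [this, Real.rpow_add hp]; ring
    _ ≤ _ := by rw [mul_assoc _ (m ^ _)]; gcongr

theorem integrable_eulerKernel {a b : ℂ} {y : ℝ} (hy : 0 < y) (hab : 1 < (a + b).re) :
    Integrable (eulerKernel a b y) := by
  obtain ⟨C, hC⟩ := norm_eulerKernel_le a b hy (by linarith)
  have := (integrable_rpow_neg_one_add_norm_sq (E := ℝ) (μ := volume) (r := (a + b).re)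
    (by simpa using hab)).const_mul C
  exact this.mono' (continuous_eulerKernel a b hy).aestronglyMeasurable (ae_of_all _ hC)

theorem integrable_eulerKernel_mul_e {a b : ℂ} {y : ℝ} (hy : 0 < y) (hab : 1 < (a + b).re)
    (n : ℝ) : Integrable fun x : ℝ => eulerKernel a b y x * e (-(n * x)) :=
  (integrable_eulerKernel hy hab).mul_bdd (c := 1)
    (Continuous.aestronglyMeasurable (by fun_prop)) (ae_of_all _ fun x => (norm_e_neg_mul n x).le)

theorem hasDerivAt_eulerKernel (a b : ℂ) {y : ℝ} (hy : 0 < y) (x : ℝ) :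
    HasDerivAt (eulerKernel a b y) (Complex.I * a * eulerKernel (a + 1) b y x -
      Complex.I * b * eulerKernel a (b + 1) y x) x := by
  have h1 : HasDerivAt (fun x : ℝ => ((y : ℂ) - Complex.I * x) ^ (-a))
      (-a * ((y : ℂ) - Complex.I * x) ^ (-a - 1) * (-Complex.I)) x := by
    have := ((((hasDerivAt_id (x : ℂ)).const_mul Complex.I).const_sub (y : ℂ)).cpow_const
      (c := -a) (sub_I_mem_slitPlane hy x)).comp_ofReal
    simpa using this
  have h2 : HasDerivAt (fun x : ℝ => ((y : ℂ) + Complex.I * x) ^ (-b))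
      (-b * ((y : ℂ) + Complex.I * x) ^ (-b - 1) * Complex.I) x := by
    have := ((((hasDerivAt_id (x : ℂ)).const_mul Complex.I).const_add (y : ℂ)).cpow_const
      (c := -b) (add_I_mem_slitPlane hy x)).comp_ofReal
    simpa using this
  refine (h1.mul h2).congr_deriv ?_
  simp only [eulerKernel, neg_add', neg_mul]
  ring

theorem eulerKernel_add (a b : ℂ) {y : ℝ} (hy : 0 < y) (x : ℝ) :
    eulerKernel a (b + 1) y x + eulerKernel (a + 1) b y x =
      2 * y * eulerKernel (a + 1) (b + 1) y x := by
  have h1 := Complex.slitPlane_ne_zero (sub_I_mem_slitPlane hy x)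
  have h2 := Complex.slitPlane_ne_zero (add_I_mem_slitPlane hy x)
  have e1 : ((y : ℂ) - Complex.I * x) ^ (-a) =
      ((y : ℂ) - Complex.I * x) ^ (-(a + 1)) * (y - Complex.I * x) := by
    rw [← cpow_add_one _ h1]; ring_nf
  have e2 : ((y : ℂ) + Complex.I * x) ^ (-b) =
      ((y : ℂ) + Complex.I * x) ^ (-(b + 1)) * (y + Complex.I * x) := by
    rw [← cpow_add_one _ h2]; ring_nf
  simp only [eulerKernel, e1, e2]
  ring

theorem eulerTransform_add {a b : ℂ} {y : ℝ} (hy : 0 < y) (hab : 0 < (a + b).re) (n : ℝ) :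
    eulerTransform a (b + 1) y n + eulerTransform (a + 1) b y n =
      2 * y * eulerTransform (a + 1) (b + 1) y n := by
  simp only [Complex.add_re] at hab
  rw [eulerTransform, eulerTransform, eulerTransform, ← integral_add
    (integrable_eulerKernel_mul_e hy (by simp; linarith) n)
    (integrable_eulerKernel_mul_e hy (by simp; linarith) n), ← integral_const_mul]
  refine integral_congr_ae (ae_of_all _ fun x => ?_)
  simp only
  rw [← add_mul, eulerKernel_add a b hy]; ring

theorem tendsto_eulerKernel {a b : ℂ} {y : ℝ} (hy : 0 < y) (hab : 1 < (a + b).re) {l : Filter ℝ}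
    (hl : Tendsto (fun x : ℝ => ‖x‖) l atTop) : Tendsto (eulerKernel a b y) l (𝓝 0) := by
  obtain ⟨C, hC⟩ := norm_eulerKernel_le a b hy (by linarith)
  refine squeeze_zero_norm hC ?_
  have h1 : Tendsto (fun x : ℝ => 1 + ‖x‖ ^ 2) l atTop :=
    tendsto_atTop_add_const_left _ _ ((tendsto_pow_atTop two_ne_zero).comp hl)
  have h2 := ((tendsto_rpow_neg_atTop (y := (a + b).re / 2) (by linarith)).comp h1).const_mul C
  rw [mul_zero] at h2
  simpa only [Function.comp_def, neg_div] using h2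

/-- Integration by parts; with `eulerTransform_add` it yields the three-term relation. -/
theorem eulerTransform_by_parts {a b : ℂ} {y : ℝ} (hy : 0 < y) (hab : 1 < (a + b).re) (n : ℝ) :
    2 * Real.pi * n * eulerTransform a b y n =
      a * eulerTransform (a + 1) b y n - b * eulerTransform a (b + 1) y n := by
  simp only [Complex.add_re] at hab
  have i1 := integrable_eulerKernel_mul_e (a := a + 1) (b := b) hy (by simp; linarith) n
  have i2 := integrable_eulerKernel_mul_e (a := a) (b := b + 1) hy (by simp; linarith) n
  have i0 := integrable_eulerKernel_mul_e (a := a) (b := b) hy (by simp; linarith) n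
  have hd : ∀ x : ℝ, HasDerivAt (fun x : ℝ => eulerKernel a b y x * e (-(n * x)))
      (Complex.I * a * (eulerKernel (a + 1) b y x * e (-(n * x))) -
      Complex.I * b * (eulerKernel a (b + 1) y x * e (-(n * x))) +
      (-(2 * Real.pi * Complex.I * n)) * (eulerKernel a b y x * e (-(n * x)))) x := fun x => by
    have h2 : HasDerivAt (fun x : ℝ => e (-(n * x)))
        (e (-(n * x)) * (2 * Real.pi * Complex.I * (-n))) x := by
      have := (((hasDerivAt_id (x : ℂ)).const_mul (n : ℂ)).neg.const_mul
        (2 * Real.pi * Complex.I)).cexp.comp_ofReal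
      simpa [e] using this
    refine ((hasDerivAt_eulerKernel a b hy x).mul h2).congr_deriv ?_
    ring
  have hi := ((i1.const_mul (Complex.I * a)).sub (i2.const_mul (Complex.I * b))).add
    (i0.const_mul (-(2 * Real.pi * Complex.I * n)))
  have hlim : ∀ l : Filter ℝ, Tendsto (fun x : ℝ => ‖x‖) l atTop →
      Tendsto (fun x : ℝ => eulerKernel a b y x * e (-(n * x))) l (𝓝 0) := fun l hl => by
    have := tendsto_eulerKernel (a := a) (b := b) hy (by simpa using hab) hl
    rw [tendsto_zero_iff_norm_tendsto_zero] at this ⊢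
    simpa [norm_e_neg_mul] using this
  have h := integral_of_hasDerivAt_of_tendsto hd hi (hlim _ tendsto_abs_atBot_atTop)
    (hlim _ tendsto_abs_atTop_atTop)
  rw [sub_zero, ← integral_linear_combination i1 i2 i0] at h
  change Complex.I * a * eulerTransform (a + 1) b y n - Complex.I * b * eulerTransform a (b + 1) y n
    + -(2 * Real.pi * Complex.I * n) * eulerTransform a b y n = 0 at h
  linear_combination Complex.I * h + (2 * Real.pi * n * eulerTransform a b y n -
      a * eulerTransform (a + 1) b y n + b * eulerTransform a (b + 1) y n) * Complex.I_sq

/-- The three-term relation along `a + b = c`. -/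
theorem eulerTransform_contiguous {c : ℂ} {y : ℝ} (hy : 0 < y) (hc : 1 < c.re) (a : ℂ) (n : ℝ) :
    a * eulerTransform (a + 1) (c - (a + 1)) y n =
      (4 * Real.pi * n * y - 2 * a + c) * eulerTransform a (c - a) y n +
      (c - a) * eulerTransform (a - 1) (c - (a - 1)) y n := by
  have h1 := eulerTransform_by_parts (a := a) (b := c - a) hy (by simpa using hc) n
  have h2 := eulerTransform_add (a := a) (b := c - a - 1) hy (by simp; linarith) n
  have h3 := eulerTransform_add (a := a - 1) (b := c - a) hy (by simp; linarith) n
  rw [sub_add_cancel] at h2 h3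
  rw [show c - (a + 1) = c - a - 1 by ring, show c - (a - 1) = c - a + 1 by ring]
  linear_combination (-2 * y) * h1 + a * h2 - (c - a) * h3

theorem eulerTransform_swap (a b : ℂ) (y n : ℝ) :
    eulerTransform b a y (-n) = eulerTransform a b y n := by
  rw [eulerTransform, eulerTransform, ← integral_neg_eq_self]
  refine integral_congr_ae (ae_of_all _ fun x => ?_)
  simp only [eulerKernel]
  push_cast
  rw [mul_comm (_ ^ (-b))]
  congr 2 <;> ring_nf

theorem norm_eulerTransform_le (a b : ℂ) (y n : ℝ) :
    ‖eulerTransform a b y n‖ ≤ ∫ x : ℝ, ‖eulerKernel a b y x‖ := by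
  refine (norm_integral_le_integral_norm _).trans (le_of_eq ?_)
  refine integral_congr_ae (ae_of_all _ fun x => ?_)
  simp [norm_e_neg_mul]

/-- Two integrations by parts give the decay `O(n⁻²)` that makes Poisson summation and the expansion
converge absolutely. -/
theorem exists_eulerTransform_decay {a b : ℂ} {y : ℝ} (hy : 0 < y) (hab : 1 < (a + b).re) :
    ∃ C : ℝ, ∀ n : ℝ, n ^ 2 * ‖eulerTransform a b y n‖ ≤ C := by
  simp only [Complex.add_re] at hab
  refine ⟨‖a‖ * (‖a + 1‖ * (∫ x : ℝ, ‖eulerKernel (a + 1 + 1) b y x‖) +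
    ‖b‖ * ∫ x : ℝ, ‖eulerKernel (a + 1) (b + 1) y x‖) + ‖b‖ *
    (‖a‖ * (∫ x : ℝ, ‖eulerKernel (a + 1) (b + 1) y x‖) +
    ‖b + 1‖ * ∫ x : ℝ, ‖eulerKernel a (b + 1 + 1) y x‖), fun n => ?_⟩
  have h1 := eulerTransform_by_parts (a := a) (b := b) hy (by simpa using hab) n
  have h2 := eulerTransform_by_parts (a := a + 1) (b := b) hy (by simp; linarith) n
  have h3 := eulerTransform_by_parts (a := a) (b := b + 1) hy (by simp; linarith) n
  have h4 : ((2 * Real.pi * n) ^ 2 : ℂ) * eulerTransform a b y n =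
      a * ((a + 1) * eulerTransform (a + 1 + 1) b y n - b * eulerTransform (a + 1) (b + 1) y n) -
      b * (a * eulerTransform (a + 1) (b + 1) y n -
        (b + 1) * eulerTransform a (b + 1 + 1) y n) := by
    linear_combination (2 * Real.pi * n) * h1 + a * h2 - b * h3
  have h5 : ‖((2 * Real.pi * n) ^ 2 : ℂ)‖ = (2 * Real.pi) ^ 2 * n ^ 2 := by
    have : ((2 * Real.pi * n) ^ 2 : ℂ) = (((2 * Real.pi) ^ 2 * n ^ 2 : ℝ) : ℂ) := by
      push_cast; ring
    rw [this, Complex.norm_real, Real.norm_of_nonneg (by positivity)]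
  have h6 : n ^ 2 * ‖eulerTransform a b y n‖ ≤
      ‖((2 * Real.pi * n) ^ 2 : ℂ) * eulerTransform a b y n‖ := by
    rw [norm_mul, h5]
    have : 1 ≤ (2 * Real.pi) ^ 2 := by nlinarith [Real.pi_gt_three]
    gcongr
    nlinarith [sq_nonneg n]
  refine h6.trans ?_
  rw [h4]
  refine (norm_sub_le _ _).trans ?_
  rw [norm_mul, norm_mul]
  gcongr
  · refine (norm_sub_le _ _).trans ?_
    rw [norm_mul, norm_mul]
    gcongr <;> exact norm_eulerTransform_le _ _ _ _
  · refine (norm_sub_le _ _).trans ?_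
    rw [norm_mul, norm_mul]
    gcongr <;> exact norm_eulerTransform_le _ _ _ _

end Kernel

/-! ### Evaluation of the Fourier transform -/

section Evaluation
open MeasureTheory Set Filter Topology
open scoped FourierTransform

/-- The density `w^(a-1) exp(-wy)` on `w > 0`, extended by zero. -/
noncomputable def gammaDensity (a : ℂ) (y w : ℝ) : ℂ :=
  (Ioi (0 : ℝ)).indicator (fun w : ℝ => Complex.exp (-y * w) * (w : ℂ) ^ (a - 1)) w

/-- Fourier inversion for the gamma integral. -/
theorem integral_cpow_sub_I_mul_exp {a : ℂ} (ha : 1 < a.re) {y : ℝ} (hy : 0 < y) {w : ℝ}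
    (hw : w ≠ 0) :
    ∫ x : ℝ, ((y : ℂ) - Complex.I * x) ^ (-a) * Complex.exp (-(Complex.I * w * x)) =
      2 * Real.pi / Complex.Gamma a * gammaDensity a y w := by
  have hG : Complex.Gamma a ≠ 0 := Complex.Gamma_ne_zero_of_re_pos (by linarith)
  have hπ : 0 < 2 * Real.pi := by positivity
  have hπc : (Real.pi : ℂ) ≠ 0 := by exact_mod_cast Real.pi_ne_zero
  have hgi : Integrable (gammaDensity a y) :=
    (integrable_indicator_iff measurableSet_Ioi).mpr (integrableOn_exp_mul_cpow (by linarith) hy)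
  have hF : ∀ ξ : ℝ, 𝓕 (gammaDensity a y) ξ =
      eulerKernel a 0 y (-(2 * Real.pi) * ξ) * Complex.Gamma a := fun ξ => by
    rw [Real.fourier_eq']
    have h1 : ∀ v : ℝ, Complex.exp (↑(-2 * Real.pi * inner ℝ v ξ) * Complex.I) •
        gammaDensity a y v = (Ioi (0 : ℝ)).indicator (fun w : ℝ =>
          Complex.exp (-((y : ℂ) - Complex.I * ((-(2 * Real.pi) * ξ : ℝ) : ℂ)) * w) *
          (w : ℂ) ^ (a - 1)) v := fun v => by
      by_cases hv : v ∈ Ioi (0 : ℝ)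
      · rw [gammaDensity, indicator_of_mem hv, indicator_of_mem hv, smul_eq_mul, ← mul_assoc,
          ← Complex.exp_add]
        congr 2
        simp
        ring
      · rw [gammaDensity, indicator_of_notMem hv, indicator_of_notMem hv, smul_zero]
    simp_rw [h1]
    rw [integral_indicator measurableSet_Ioi,
      integral_cexp_mul_cpow (by linarith) (by simpa using hy)]
    simp [eulerKernel]
  have hFi : Integrable (𝓕 (gammaDensity a y)) := by
    have h1 : Integrable (eulerKernel a 0 y) := integrable_eulerKernel hy (by simpa using ha)
    have h2 := (h1.comp_mul_left' (R := -(2 * Real.pi)) (by linarith)).mul_const (Complex.Gamma a)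
    exact h2.congr (ae_of_all _ fun ξ => (hF ξ).symm)
  have hc : ContinuousAt (gammaDensity a y) w := by
    rcases lt_or_gt_of_ne hw with h | h
    · have : gammaDensity a y =ᶠ[𝓝 w] fun _ => 0 := by
        filter_upwards [Iio_mem_nhds h] with v hv
        exact indicator_of_notMem (by simpa using (hv : v < 0).le) _
      exact continuousAt_const.congr this.symm
    · have : gammaDensity a y =ᶠ[𝓝 w] fun w : ℝ => Complex.exp (-y * w) * (w : ℂ) ^ (a - 1) := by
        filter_upwards [Ioi_mem_nhds h] with v hv
        exact indicator_of_mem hv _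
      refine ContinuousAt.congr ?_ this.symm
      exact (Continuous.continuousAt (by fun_prop)).mul
        (ContinuousAt.cpow (by fun_prop) continuousAt_const (Or.inl (by simpa using h)))
  have hinv := hgi.fourierInv_fourier_eq hFi hc
  rw [Real.fourierInv_eq'] at hinv
  have h3 : ∀ ξ : ℝ, Complex.exp (↑(2 * Real.pi * inner ℝ ξ w) * Complex.I) •
      𝓕 (gammaDensity a y) ξ = (fun x : ℝ => Complex.Gamma a * (((y : ℂ) - Complex.I * x) ^ (-a) *
        Complex.exp (-(Complex.I * w * x)))) (-(2 * Real.pi) * ξ) := fun ξ => by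
    rw [hF]
    simp only [eulerKernel, neg_zero, Complex.cpow_zero, mul_one, smul_eq_mul]
    have : Complex.exp (↑(2 * Real.pi * inner ℝ ξ w) * Complex.I) =
        Complex.exp (-(Complex.I * w * ((-(2 * Real.pi) * ξ : ℝ) : ℂ))) := by
      congr 1; simp; ring
    rw [this]; ring
  have h4 := Measure.integral_comp_mul_left (fun x : ℝ => Complex.Gamma a *
    (((y : ℂ) - Complex.I * x) ^ (-a) * Complex.exp (-(Complex.I * w * x)))) (-(2 * Real.pi))
  rw [integral_congr_ae (ae_of_all _ h3), h4, integral_const_mul, Complex.real_smul] at hinv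
  rw [← hinv]
  rw [abs_inv, abs_neg, abs_of_pos hπ]
  generalize (∫ x : ℝ, ((y : ℂ) - Complex.I * x) ^ (-a) * Complex.exp (-(Complex.I * w * x))) = M
  push_cast
  field_simp

/-- The gamma integral for `(y + ix)^(-b)` turns the Fourier transform of the kernel into a
convolution of gamma densities. -/
theorem eulerTransform_eq_integral {a b : ℂ} (ha : 1 < a.re) (hb : 0 < b.re) {y : ℝ} (hy : 0 < y)
    (n : ℝ) : Complex.Gamma b * eulerTransform a b y n = 2 * Real.pi / Complex.Gamma a *
      ∫ v in Ioi (0 : ℝ), Complex.exp (-y * v) * (v : ℂ) ^ (b - 1) *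
        gammaDensity a y (v + 2 * Real.pi * n) := by
  set F : ℝ → ℝ → ℂ := fun x v => Complex.exp (-(Complex.I * (v + 2 * Real.pi * n : ℝ) * x)) *
    (((y : ℂ) - Complex.I * x) ^ (-a) * (Complex.exp (-y * v) * (v : ℂ) ^ (b - 1))) with hF
  have hint : Integrable (Function.uncurry F) (volume.prod (volume.restrict (Ioi 0))) := by
    have h1 : Integrable fun x : ℝ => ((y : ℂ) - Complex.I * x) ^ (-a) := by
      have : Integrable (eulerKernel a 0 y) := integrable_eulerKernel hy (by simpa using ha)
      exact this.congr (ae_of_all _ fun x => by simp [eulerKernel])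
    refine (h1.mul_prod (integrableOn_exp_mul_cpow hb hy)).bdd_mul (c := 1)
      (Continuous.aestronglyMeasurable (by fun_prop)) (ae_of_all _ fun x => ?_)
    rw [Complex.norm_exp]
    simp
  have hswap := integral_integral_swap hint
  have h1 : ∀ x : ℝ, ∫ v in Ioi (0 : ℝ), F x v =
      Complex.Gamma b * (eulerKernel a b y x * e (-(n * x))) := fun x => by
    have h2 : ∀ v : ℝ, F x v = (((y : ℂ) - Complex.I * x) ^ (-a) * e (-(n * x))) *
        (Complex.exp (-((y : ℂ) + Complex.I * x) * v) * (v : ℂ) ^ (b - 1)) := fun v => by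
      have : Complex.exp (-(Complex.I * (v + 2 * Real.pi * n : ℝ) * x)) * Complex.exp (-y * v) =
          e (-(n * x)) * Complex.exp (-((y : ℂ) + Complex.I * x) * v) := by
        rw [e, ← Complex.exp_add, ← Complex.exp_add]; congr 1; push_cast; ring
      simp only [hF]
      linear_combination (((y : ℂ) - Complex.I * x) ^ (-a) * (v : ℂ) ^ (b - 1)) * this
    simp_rw [h2]
    rw [integral_const_mul, integral_cexp_mul_cpow hb (by simpa using hy), eulerKernel]
    ring
  have h2 : ∀ᵐ v : ℝ ∂(volume.restrict (Ioi 0)), ∫ x : ℝ, F x v =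
      2 * Real.pi / Complex.Gamma a * (Complex.exp (-y * v) * (v : ℂ) ^ (b - 1) *
        gammaDensity a y (v + 2 * Real.pi * n)) := by
    have : ∀ᵐ v : ℝ ∂(volume.restrict (Ioi 0)), v ≠ -(2 * Real.pi * n) :=
      ae_restrict_of_ae (Measure.ae_ne volume _)
    refine this.mono fun v hv => ?_
    have hv' : v + 2 * Real.pi * n ≠ 0 := fun h => hv (by linarith)
    have h3 : ∀ x : ℝ, F x v = (Complex.exp (-y * v) * (v : ℂ) ^ (b - 1)) *
        (((y : ℂ) - Complex.I * x) ^ (-a) *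
        Complex.exp (-(Complex.I * (v + 2 * Real.pi * n : ℝ) * x))) := fun x => by
      simp only [hF]; ring
    simp_rw [h3]
    rw [integral_const_mul, integral_cpow_sub_I_mul_exp ha hy hv']; ring
  simp_rw [h1] at hswap
  rw [integral_congr_ae h2, integral_const_mul, integral_const_mul] at hswap
  exact hswap

theorem integral_Ioi_comp_add_right (f : ℝ → ℂ) (M : ℝ) :
    ∫ v in Ioi (0 : ℝ), f (v + M) = ∫ v in Ioi M, f v := by
  rw [← integral_indicator measurableSet_Ioi, ← integral_indicator measurableSet_Ioi,
    ← integral_add_right_eq_self ((Ioi M).indicator f) M]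
  refine integral_congr_ae (ae_of_all _ fun v => ?_)
  by_cases hv : 0 < v
  · simp [indicator, hv]
  · simp [indicator, hv]

theorem integral_pos_scale (p q : ℂ) {N : ℝ} (hN : 0 < N) (y : ℝ) :
    ∫ v in Ioi (0 : ℝ), Complex.exp (-y * v) * (v : ℂ) ^ (p - 1) *
      (Complex.exp (-y * (v + N : ℝ)) * ((v + N : ℝ) : ℂ) ^ (q - 1)) =
    (N : ℂ) ^ (p + q - 1) * Complex.exp (-N * y) * ∫ t in Ioi (0 : ℝ),
      Complex.exp (-(2 * N * y : ℝ) * t) * (t : ℂ) ^ (p - 1) * ((1 + t : ℝ) : ℂ) ^ (q - 1) := by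
  have hNc : (N : ℂ) ≠ 0 := by exact_mod_cast hN.ne'
  have h := integral_comp_mul_left_Ioi (fun v : ℝ => Complex.exp (-y * v) * (v : ℂ) ^ (p - 1) *
      (Complex.exp (-y * (v + N : ℝ)) * ((v + N : ℝ) : ℂ) ^ (q - 1))) 0 hN
  rw [mul_zero] at h
  have h1 : ∀ t ∈ Ioi (0 : ℝ), Complex.exp (-y * (N * t : ℝ)) * ((N * t : ℝ) : ℂ) ^ (p - 1) *
      (Complex.exp (-y * (N * t + N : ℝ)) * ((N * t + N : ℝ) : ℂ) ^ (q - 1)) =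
      ((N : ℂ)⁻¹ * ((N : ℂ) ^ (p + q - 1) * Complex.exp (-N * y))) *
      (Complex.exp (-(2 * N * y : ℝ) * t) * (t : ℂ) ^ (p - 1) * ((1 + t : ℝ) : ℂ) ^ (q - 1)) := by
    intro t ht
    have ht : 0 < t := ht
    rw [show N * t + N = N * (1 + t) by ring, Complex.ofReal_mul N t,
      Complex.ofReal_mul N (1 + t), Complex.mul_cpow_ofReal_nonneg hN.le ht.le,
      Complex.mul_cpow_ofReal_nonneg hN.le (by linarith)]
    have e1 : (N : ℂ) ^ (p + q - 1) = N * ((N : ℂ) ^ (p - 1) * (N : ℂ) ^ (q - 1)) := by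
      rw [← Complex.cpow_add _ _ hNc, mul_comm, ← cpow_add_one _ hNc]; ring_nf
    have e2 : Complex.exp (-y * (N * t)) * Complex.exp (-y * (N * (1 + t : ℝ))) =
        Complex.exp (-N * y) * Complex.exp (-(2 * N * y : ℝ) * t) := by
      rw [← Complex.exp_add, ← Complex.exp_add]; push_cast; ring_nf
    rw [e1]
    linear_combination ((N : ℂ) ^ (p - 1) * (N : ℂ) ^ (q - 1) * (t : ℂ) ^ (p - 1) *
      ((1 + t : ℝ) : ℂ) ^ (q - 1)) * e2 - ((N : ℂ) ^ (p - 1) * (N : ℂ) ^ (q - 1) *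
      (t : ℂ) ^ (p - 1) * ((1 + t : ℝ) : ℂ) ^ (q - 1) * (Complex.exp (-N * y) *
      Complex.exp (-(2 * N * y : ℝ) * t))) * (inv_mul_cancel₀ hNc)
  rw [setIntegral_congr_fun measurableSet_Ioi h1, integral_const_mul, Complex.real_smul,
    Complex.ofReal_inv, mul_assoc] at h
  exact (mul_left_cancel₀ (inv_ne_zero hNc) h).symm

theorem eulerTransform_of_pos_aux {a b : ℂ} (ha : 1 < a.re) (hb : 0 < b.re) {y : ℝ} (hy : 0 < y)
    {n : ℝ} (hn : 0 < n) : eulerTransform a b y n =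
      2 * Real.pi * ((2 * Real.pi * n : ℝ) : ℂ) ^ (a + b - 1) *
        Complex.exp (-(2 * Real.pi * n : ℝ) * y) / Complex.Gamma a *
        tricomiIntegral b (a + b) (4 * Real.pi * n * y) := by
  have hGb : Complex.Gamma b ≠ 0 := Complex.Gamma_ne_zero_of_re_pos hb
  have hN : 0 < 2 * Real.pi * n := by positivity
  have h := eulerTransform_eq_integral ha hb hy n
  have h1 : ∀ v ∈ Ioi (0 : ℝ), Complex.exp (-y * v) * (v : ℂ) ^ (b - 1) *
      gammaDensity a y (v + 2 * Real.pi * n) = Complex.exp (-y * v) * (v : ℂ) ^ (b - 1) *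
      (Complex.exp (-y * (v + 2 * Real.pi * n : ℝ)) *
        ((v + 2 * Real.pi * n : ℝ) : ℂ) ^ (a - 1)) := fun v hv => by
    have hv : 0 < v := hv
    rw [gammaDensity, indicator_of_mem (by simp; linarith)]
  rw [setIntegral_congr_fun measurableSet_Ioi h1, integral_pos_scale b a hN] at h
  rw [tricomiIntegral, show a + b - b - 1 = a - 1 by ring, add_comm a b,
    show 4 * Real.pi * n * y = 2 * (2 * Real.pi * n) * y by ring]
  generalize (∫ t in Ioi (0 : ℝ), Complex.exp (-(2 * (2 * Real.pi * n) * y : ℝ) * t) *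
    (t : ℂ) ^ (b - 1) * ((1 + t : ℝ) : ℂ) ^ (a - 1)) = M at h ⊢
  rw [mul_comm] at h
  rw [eq_div_of_mul_eq hGb h]
  ring

theorem eulerTransform_of_neg_aux {a b : ℂ} (ha : 1 < a.re) (hb : 0 < b.re) {y : ℝ} (hy : 0 < y)
    {n : ℝ} (hn : n < 0) : eulerTransform a b y n =
      2 * Real.pi * ((2 * Real.pi * (-n) : ℝ) : ℂ) ^ (a + b - 1) *
        Complex.exp (-(2 * Real.pi * (-n) : ℝ) * y) / Complex.Gamma b *
        tricomiIntegral a (a + b) (4 * Real.pi * (-n) * y) := by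
  have hGb : Complex.Gamma b ≠ 0 := Complex.Gamma_ne_zero_of_re_pos hb
  have hN : 0 < 2 * Real.pi * (-n) := mul_pos (by positivity) (by linarith)
  have h := eulerTransform_eq_integral ha hb hy n
  set g : ℝ → ℂ := fun v => (Ioi (2 * Real.pi * (-n))).indicator (fun v : ℝ =>
    Complex.exp (-y * (v + 2 * Real.pi * n : ℝ)) * ((v + 2 * Real.pi * n : ℝ) : ℂ) ^ (a - 1) *
    (Complex.exp (-y * v) * (v : ℂ) ^ (b - 1))) v with hg
  have h1 : ∀ v : ℝ, Complex.exp (-y * v) * (v : ℂ) ^ (b - 1) *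
      gammaDensity a y (v + 2 * Real.pi * n) = g v := fun v => by
    by_cases hv : v ∈ Ioi (2 * Real.pi * (-n))
    · have hv' : 2 * Real.pi * (-n) < v := hv
      simp only [hg]
      rw [gammaDensity, indicator_of_mem (by simp; linarith), indicator_of_mem hv, mul_comm]
    · have hv' : v ≤ 2 * Real.pi * (-n) := not_lt.mp hv
      simp only [hg]
      rw [gammaDensity, indicator_of_notMem (by simp; linarith), indicator_of_notMem hv,
        mul_zero]
  simp_rw [h1] at h
  rw [hg, setIntegral_indicator measurableSet_Ioi, Ioi_inter_Ioi, sup_of_le_right hN.le] at h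
  have h2 := integral_Ioi_comp_add_right (fun v : ℝ =>
    Complex.exp (-y * (v + 2 * Real.pi * n : ℝ)) * ((v + 2 * Real.pi * n : ℝ) : ℂ) ^ (a - 1) *
    (Complex.exp (-y * v) * (v : ℂ) ^ (b - 1))) (2 * Real.pi * (-n))
  have h3 : ∀ t : ℝ, t + 2 * Real.pi * (-n) + 2 * Real.pi * n = t := fun t => by ring
  simp_rw [h3] at h2
  rw [← h2, integral_pos_scale a b hN] at h
  rw [tricomiIntegral, show a + b - a - 1 = b - 1 by ring,
    show 4 * Real.pi * (-n) * y = 2 * (2 * Real.pi * (-n)) * y by ring]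
  generalize (∫ t in Ioi (0 : ℝ), Complex.exp (-(2 * (2 * Real.pi * (-n)) * y : ℝ) * t) *
    (t : ℂ) ^ (a - 1) * ((1 + t : ℝ) : ℂ) ^ (b - 1)) = M at h ⊢
  rw [mul_comm] at h
  rw [eq_div_of_mul_eq hGb h]
  ring

theorem eulerTransform_zero_aux {a b : ℂ} (ha : 1 < a.re) (hb : 0 < b.re) {y : ℝ} (hy : 0 < y) :
    eulerTransform a b y 0 = 2 * Real.pi * ((2 * y : ℝ) : ℂ) ^ (1 - (a + b)) *
      Complex.Gamma (a + b - 1) / (Complex.Gamma a * Complex.Gamma b) := by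
  have hGb : Complex.Gamma b ≠ 0 := Complex.Gamma_ne_zero_of_re_pos hb
  have h := eulerTransform_eq_integral ha hb hy 0
  have h1 : ∀ v ∈ Ioi (0 : ℝ), Complex.exp (-y * v) * (v : ℂ) ^ (b - 1) *
      gammaDensity a y (v + 2 * Real.pi * 0) = Complex.exp (-(2 * y : ℝ) * v) *
        (v : ℂ) ^ (a + b - 1 - 1) := fun v hv => by
    have hv' : 0 < v := hv
    have hvc : (v : ℂ) ≠ 0 := by exact_mod_cast hv'.ne'
    rw [mul_zero, add_zero, gammaDensity, indicator_of_mem hv,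
      show a + b - 1 - 1 = (b - 1) + (a - 1) by ring, Complex.cpow_add _ _ hvc]
    have : Complex.exp (-(2 * y : ℝ) * v) = Complex.exp (-y * v) * Complex.exp (-y * v) := by
      rw [← Complex.exp_add]; push_cast; ring_nf
    rw [this]; ring
  rw [setIntegral_congr_fun measurableSet_Ioi h1,
    integral_exp_mul_cpow (by simp; linarith) (by linarith), neg_sub] at h
  rw [mul_comm] at h
  rw [eq_div_of_mul_eq hGb h]
  field_simp

/-- A solution of the three-term relation of `eulerTransform_contiguous` is determined on the half
plane `Re a > 0` by its values on the strip `0 < Re a < Re c`, which is wider than `2`. -/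
theorem eq_of_contiguous {c : ℂ} (hc : 2 < c.re) (z : ℂ) {X Y : ℂ → ℂ}
    (hX : ∀ a : ℂ, 1 < a.re → a * X (a + 1) = (z - 2 * a + c) * X a + (c - a) * X (a - 1))
    (hY : ∀ a : ℂ, 1 < a.re → a * Y (a + 1) = (z - 2 * a + c) * Y a + (c - a) * Y (a - 1))
    (h : ∀ a : ℂ, 0 < a.re → a.re < c.re → X a = Y a) {a : ℂ} (ha : 0 < a.re) : X a = Y a := by
  have key : ∀ k : ℕ, ∀ a : ℂ, 0 < a.re → a.re < c.re + k → X a = Y a := by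
    intro k
    induction k with
    | zero => intro a h1 h2; exact h a h1 (by simpa using h2)
    | succ k ih =>
      intro a h1 h2
      push_cast at h2
      rcases lt_or_ge a.re c.re with h3 | h3
      · exact h a h1 h3
      · have e1 := ih (a - 1) (by simp; linarith) (by simp; linarith)
        have e2 := ih (a - 1 - 1) (by simp; linarith) (by simp; linarith)
        have h4 : a - 1 ≠ 0 := by
          intro h; have := congrArg Complex.re h; simp at this; linarith
        have x1 := hX (a - 1) (by simp; linarith)
        have x2 := hY (a - 1) (by simp; linarith)
        rw [sub_add_cancel] at x1 x2
        rw [e1, e2, ← x2] at x1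
        exact mul_left_cancel₀ h4 x1
  obtain ⟨k, hk⟩ := exists_nat_gt a.re
  exact key k a ha (by linarith)

theorem eulerTransform_of_pos {a c : ℂ} (ha : 0 < a.re) (hc : 2 < c.re) {y : ℝ} (hy : 0 < y)
    {n : ℝ} (hn : 0 < n) : eulerTransform a (c - a) y n =
      2 * Real.pi * ((2 * Real.pi * n : ℝ) : ℂ) ^ (c - 1) *
        Complex.exp (-(2 * Real.pi * n : ℝ) * y) / Complex.Gamma a *
        (((4 * Real.pi * n * y : ℝ) : ℂ) ^ (1 - c) *
          tricomiU (1 - a) (2 - c) (4 * Real.pi * n * y)) := by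
  have hz : 0 < 4 * Real.pi * n * y := by positivity
  have hzc : ((4 * Real.pi * n * y : ℝ) : ℂ) ≠ 0 := by exact_mod_cast hz.ne'
  set C := 2 * Real.pi * ((2 * Real.pi * n : ℝ) : ℂ) ^ (c - 1) *
        Complex.exp (-(2 * Real.pi * n : ℝ) * y) with hC
  refine eq_of_contiguous hc (4 * Real.pi * n * y) (X := fun a => eulerTransform a (c - a) y n)
    (Y := fun a => C / Complex.Gamma a * (((4 * Real.pi * n * y : ℝ) : ℂ) ^ (1 - c) *
          tricomiU (1 - a) (2 - c) (4 * Real.pi * n * y)))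
    (fun a _ => eulerTransform_contiguous hy (by linarith) a n) ?_ ?_ ha
  · intro a ha
    have ha0 : a - 1 ≠ 0 := by
      intro h; have := congrArg Complex.re h; simp at this; linarith
    have ha1 : a ≠ 0 := by rintro rfl; simp at ha; linarith
    have hG : Complex.Gamma (a - 1) ≠ 0 := Complex.Gamma_ne_zero_of_re_pos (by simpa using ha)
    have g1 : Complex.Gamma a = (a - 1) * Complex.Gamma (a - 1) := by
      conv_lhs => rw [← sub_add_cancel a 1, Complex.Gamma_add_one _ ha0]
    have hu := tricomiU_contiguous (1 - (a + 1)) (2 - c) hz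
    rw [show 1 - (a + 1) + 1 = 1 - a by ring, show 1 - (a + 1) + 2 = 1 - (a - 1) by ring] at hu
    rw [hu, Complex.Gamma_add_one _ ha1, g1]
    field_simp
    push_cast
    ring
  · intro a ha hac
    have hk := tricomiU_kummer (c := c) hz (a := 1 - a) (by simp; linarith)
    rw [hk, ← mul_assoc (_ ^ (1 - c)), ← Complex.cpow_add _ _ hzc,
      show 1 - c + (c - 1) = 0 by ring, Complex.cpow_zero, one_mul,
      show c - 1 + (1 - a) = c - a by ring]
    -- Only one of `Re a` and `Re (c - a)` need exceed `1`; the symmetry `x ↦ -x` exchanges them.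
    rcases lt_or_ge 1 a.re with h1 | h1
    · have := eulerTransform_of_pos_aux (a := a) (b := c - a) h1 (by simp; linarith) hy hn
      rwa [add_sub_cancel] at this
    · have := eulerTransform_of_neg_aux (a := c - a) (b := a) (by simp; linarith) ha hy
        (neg_neg_of_pos hn)
      rwa [neg_neg, sub_add_cancel, eulerTransform_swap] at this

theorem eulerTransform_of_neg {a c : ℂ} (ha : 0 < a.re) (hc : 2 < c.re) {y : ℝ} (hy : 0 < y)
    {n : ℝ} (hn : n < 0) : eulerTransform a (c - a) y n =
      2 * Real.pi * ((2 * Real.pi * (-n) : ℝ) : ℂ) ^ (c - 1) *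
        Complex.exp (-(2 * Real.pi * (-n) : ℝ) * y) / Complex.Gamma (c - a) *
        (((4 * Real.pi * (-n) * y : ℝ) : ℂ) ^ (1 - c) *
          tricomiU (1 - (c - a)) (2 - c) (4 * Real.pi * (-n) * y)) := by
  have hn' : 0 < -n := by linarith
  have hz : 0 < 4 * Real.pi * (-n) * y := by positivity
  have hzc : ((4 * Real.pi * (-n) * y : ℝ) : ℂ) ≠ 0 := by exact_mod_cast hz.ne'
  have hk := tricomiU_kummer (c := c) hz (a := 1 - (c - a)) (by simpa using ha)
  rw [hk, ← mul_assoc (_ ^ (1 - c)), ← Complex.cpow_add _ _ hzc,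
    show 1 - c + (c - 1) = 0 by ring, Complex.cpow_zero, one_mul,
    show c - 1 + (1 - (c - a)) = a by ring, ← tricomiU_of_re_pos _ ha hz]
  set C := 2 * Real.pi * ((2 * Real.pi * (-n) : ℝ) : ℂ) ^ (c - 1) *
        Complex.exp (-(2 * Real.pi * (-n) : ℝ) * y) with hC
  refine eq_of_contiguous hc (4 * Real.pi * n * y) (X := fun a => eulerTransform a (c - a) y n)
    (Y := fun a => C / Complex.Gamma (c - a) * tricomiU a c (4 * Real.pi * (-n) * y))
    (fun a _ => eulerTransform_contiguous hy (by linarith) a n) ?_ ?_ ha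
  · intro a ha
    have g1 := Complex.one_div_Gamma_eq_self_mul_one_div_Gamma_add_one (c - (a + 1))
    have g2 := Complex.one_div_Gamma_eq_self_mul_one_div_Gamma_add_one (c - a)
    rw [show c - (a + 1) + 1 = c - a by ring] at g1
    rw [show c - a + 1 = c - (a - 1) by ring] at g2
    have hu := tricomiU_contiguous (a - 1) c hz
    rw [sub_add_cancel, show a - 1 + 2 = a + 1 by ring] at hu
    simp only [div_eq_mul_inv]
    rw [g1]
    rw [g2] at *
    rw [hu]
    push_cast
    ring
  · intro a ha hac
    rw [tricomiU_of_re_pos _ ha hz]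
    -- Only one of `Re a` and `Re (c - a)` need exceed `1`; the symmetry `x ↦ -x` exchanges them.
    rcases lt_or_ge 1 a.re with h1 | h1
    · have := eulerTransform_of_neg_aux (a := a) (b := c - a) h1 (by simp; linarith) hy hn
      rwa [add_sub_cancel] at this
    · have := eulerTransform_of_pos_aux (a := c - a) (b := a) (by simp; linarith) ha hy hn'
      rwa [sub_add_cancel, eulerTransform_swap] at this

theorem eulerTransform_zero {a c : ℂ} (ha : 0 < a.re) (hc : 2 < c.re) {y : ℝ} (hy : 0 < y) :
    eulerTransform a (c - a) y 0 = 2 * Real.pi * ((2 * y : ℝ) : ℂ) ^ (1 - c) *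
      Complex.Gamma (c - 1) / (Complex.Gamma a * Complex.Gamma (c - a)) := by
  set C := 2 * Real.pi * ((2 * y : ℝ) : ℂ) ^ (1 - c) * Complex.Gamma (c - 1) with hC
  refine eq_of_contiguous hc (4 * Real.pi * (0 : ℝ) * y)
    (X := fun a => eulerTransform a (c - a) y 0)
    (Y := fun a => C / (Complex.Gamma a * Complex.Gamma (c - a)))
    (fun a _ => eulerTransform_contiguous hy (by linarith) a 0) ?_ ?_ ha
  · intro a ha
    have ha0 : a - 1 ≠ 0 := by
      intro h; have := congrArg Complex.re h; simp at this; linarith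
    have ha1 : a ≠ 0 := by rintro rfl; simp at ha; linarith
    have hG : Complex.Gamma (a - 1) ≠ 0 := Complex.Gamma_ne_zero_of_re_pos (by simpa using ha)
    have g3 : Complex.Gamma a = (a - 1) * Complex.Gamma (a - 1) := by
      conv_lhs => rw [← sub_add_cancel a 1, Complex.Gamma_add_one _ ha0]
    have g1 := Complex.one_div_Gamma_eq_self_mul_one_div_Gamma_add_one (c - (a + 1))
    have g2 := Complex.one_div_Gamma_eq_self_mul_one_div_Gamma_add_one (c - a)
    rw [show c - (a + 1) + 1 = c - a by ring] at g1
    rw [show c - a + 1 = c - (a - 1) by ring] at g2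
    simp only [div_eq_mul_inv, mul_inv]
    rw [g1, g2, Complex.Gamma_add_one _ ha1, g3]
    field_simp
    push_cast
    ring
  · intro a ha hac
    -- Only one of `Re a` and `Re (c - a)` need exceed `1`; the symmetry `x ↦ -x` exchanges them.
    rcases lt_or_ge 1 a.re with h1 | h1
    · have := eulerTransform_zero_aux (a := a) (b := c - a) h1 (by simp; linarith) hy
      rwa [add_sub_cancel] at this
    · have := eulerTransform_zero_aux (a := c - a) (b := a) (by simp; linarith) ha hy
      rw [← neg_zero, eulerTransform_swap] at this
      rwa [sub_add_cancel, mul_comm (Complex.Gamma _)] at this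

end Evaluation

/-! ### The coefficients and the Kloosterman sums -/

section Coefficients

theorem ofReal_cpow_eq_exp {r : ℝ} (hr : 0 < r) (p : ℂ) :
    (r : ℂ) ^ p = Complex.exp (p * (Real.log r : ℝ)) := by
  rw [Complex.cpow_def_of_ne_zero (by exact_mod_cast hr.ne'), Complex.ofReal_log hr.le, mul_comm]

theorem intCast_abs_eq (c : ℤ) : ((|c| : ℤ) : ℂ) = ((|(c : ℝ)| : ℝ) : ℂ) := by
  rw [← Int.cast_abs, Complex.ofReal_intCast]

theorem whittaker_power_identity (κ s : ℂ) {n y : ℝ} (hn : 0 < n) (hy : 0 < y) :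
    (y : ℂ) ^ s * (2 * Real.pi * ((2 * Real.pi * n : ℝ) : ℂ) ^ (κ + 2 * s - 1) *
      ((4 * Real.pi * n * y : ℝ) : ℂ) ^ (1 - (κ + 2 * s))) =
    2 ^ κ * (Real.pi : ℂ) ^ (s + κ) * (n : ℂ) ^ (s + κ - 1) *
      (((4 * Real.pi * n * y : ℝ) : ℂ) ^ (-κ / 2) *
        ((4 * Real.pi * n * y : ℝ) : ℂ) ^ (1 / 2 + ((1 - κ) / 2 - s))) := by
  have hπ := Real.pi_pos
  have l1 : Real.log (2 * Real.pi * n) = Real.log 2 + Real.log Real.pi + Real.log n := by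
    rw [Real.log_mul (by positivity) hn.ne', Real.log_mul two_ne_zero hπ.ne']
  have l2 : Real.log (4 * Real.pi * n * y) =
      2 * Real.log 2 + Real.log Real.pi + Real.log n + Real.log y := by
    rw [Real.log_mul (by positivity) hy.ne', Real.log_mul (by positivity) hn.ne',
      Real.log_mul (by norm_num) hπ.ne', show (4 : ℝ) = 2 ^ 2 by norm_num, Real.log_pow]
    push_cast; ring
  have e1 : (2 * Real.pi : ℂ) = Complex.exp ((Real.log 2 : ℝ) + (Real.log Real.pi : ℝ)) := by
    rw [← Complex.ofReal_add, ← Real.log_mul two_ne_zero hπ.ne', ← Complex.ofReal_exp,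
      Real.exp_log (by positivity)]
    push_cast; ring
  have e2 : (2 : ℂ) ^ κ = Complex.exp (κ * (Real.log 2 : ℝ)) := by
    have := ofReal_cpow_eq_exp zero_lt_two κ
    exact_mod_cast this
  have hz : 0 < 4 * Real.pi * n * y := by positivity
  rw [e1, e2, ofReal_cpow_eq_exp hy, ofReal_cpow_eq_exp (by positivity : 0 < 2 * Real.pi * n),
    ofReal_cpow_eq_exp hz, ofReal_cpow_eq_exp hz, ofReal_cpow_eq_exp hz, ofReal_cpow_eq_exp hπ,
    ofReal_cpow_eq_exp hn, l1, l2]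
  simp only [← Complex.exp_add]
  congr 1
  push_cast
  ring

theorem whittakerCal_of_pos {κ : ℝ} {s : ℂ} {z : ℝ} (hz : 0 < z) :
    whittakerCal κ s z = Complex.exp (-z / 2) * ((z : ℂ) ^ (-(κ : ℂ) / 2) *
      (z : ℂ) ^ (1 / 2 + ((1 - (κ : ℂ)) / 2 - s))) *
      tricomiU (1 - (κ + s)) (2 - (κ + 2 * s)) z := by
  rw [whittakerCal, whittakerW, abs_of_pos hz, Real.sign_of_pos hz,
    show (1 : ℂ) / 2 + ((1 - κ) / 2 - s) - (1 : ℝ) * κ / 2 = 1 - (κ + s) by push_cast; ring,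
    show (1 : ℂ) + 2 * ((1 - κ) / 2 - s) = 2 - (κ + 2 * s) by ring]
  ring

theorem whittakerCal_of_neg {κ : ℝ} {s : ℂ} {z : ℝ} (hz : z < 0) :
    whittakerCal κ s z = Complex.exp (-(-z : ℝ) / 2) * (((-z : ℝ) : ℂ) ^ (-(κ : ℂ) / 2) *
      ((-z : ℝ) : ℂ) ^ (1 / 2 + ((1 - (κ : ℂ)) / 2 - s))) *
      tricomiU (1 - s) (2 - (κ + 2 * s)) (-z) := by
  rw [whittakerCal, whittakerW, abs_of_neg hz, Real.sign_of_neg hz,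
    show (1 : ℂ) / 2 + ((1 - κ) / 2 - s) - (-1 : ℝ) * κ / 2 = 1 - s by push_cast; ring,
    show (1 : ℂ) + 2 * ((1 - κ) / 2 - s) = 2 - (κ + 2 * s) by ring]
  ring

namespace EvenLattice
variable {V : Type*} [AddCommGroup V] [Module ℝ V] (Λ : EvenLattice V)

open Classical in
/-- The coefficient of the expansion is the transform of the kernel times the Kloosterman series,
plus the contribution of `c = 0`. -/
theorem eisensteinCoeff_eq {κ : ℝ} (hκ : 2 ≤ κ) (β γ : Λ.Disc) (n : ℝ) {s : ℂ}
    (hs : 1 - κ / 2 < s.re) {y : ℝ} (hy : 0 < y) :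
    Λ.eisensteinCoeff κ β γ n s y =
      (if n = 0 then ((if β = γ then 1 else 0) + (if -β = γ then 1 else 0)) * (y : ℂ) ^ s else 0) +
      (y : ℂ) ^ s * eulerTransform (κ + s) s y n * Λ.kloostermanSeries κ β γ n s := by
  have ha : 0 < ((κ : ℂ) + s).re := by simp; linarith
  have hc : 2 < ((κ : ℂ) + 2 * s).re := by simp; linarith
  have hca : (κ : ℂ) + 2 * s - (κ + s) = s := by ring
  rw [eisensteinCoeff]
  rcases lt_trichotomy n 0 with hn | rfl | hn
  · rw [if_neg hn.ne, if_neg hn.ne, if_neg (not_lt.mpr hn.le), zero_add]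
    have hn' : 0 < -n := by linarith
    have hJ := eulerTransform_of_neg ha hc hy hn
    rw [hca] at hJ
    have hz : 4 * Real.pi * n * y < 0 := by
      have : 0 < 4 * Real.pi * (-n) * y := by positivity
      linarith
    rw [hJ, whittakerCal_of_neg hz, show -(4 * Real.pi * n * y) = 4 * Real.pi * (-n) * y by ring,
      abs_of_neg hn]
    have hp := whittaker_power_identity κ s hn' hy
    have he : Complex.exp (-(4 * Real.pi * (-n) * y : ℝ) / 2) =
        Complex.exp (-(2 * Real.pi * (-n) : ℝ) * y) := by congr 1; push_cast; ring
    rw [he]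
    linear_combination (-Complex.exp (-(2 * Real.pi * (-n) : ℝ) * y) / Complex.Gamma s *
      tricomiU (1 - s) (2 - (κ + 2 * s)) (4 * Real.pi * (-n) * y) *
      Λ.kloostermanSeries κ β γ n s) * hp
  · rw [if_pos rfl, if_pos rfl, add_right_inj]
    have hJ := eulerTransform_zero ha hc hy
    rw [hca] at hJ
    have h1 : ∀ c : {c : ℤ // c ≠ 0}, (((|2 * c.1| : ℤ) : ℂ) ^ (1 - κ - 2 * s)) *
        Λ.kloosterman κ c β 0 γ 0 = (2 : ℂ) ^ (1 - κ - 2 * s) *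
        ((((|c.1| : ℤ) : ℂ) ^ (1 - κ - 2 * s)) * Λ.kloosterman κ c β 0 γ 0) := fun c => by
      have := Complex.mul_cpow_ofReal_nonneg zero_le_two (abs_nonneg (c.1 : ℝ)) (1 - κ - 2 * s)
      rw [← mul_assoc, intCast_abs_eq, intCast_abs_eq, Int.cast_mul, abs_mul, Complex.ofReal_mul]
      rw [Complex.ofReal_ofNat] at this
      simp only [Int.cast_ofNat, Nat.abs_ofNat, Complex.ofReal_ofNat]
      rw [this]
    simp_rw [h1]
    rw [tsum_mul_left, ← kloostermanSeries, hJ]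
    have h2 : (y : ℂ) ^ s * ((2 * y : ℝ) : ℂ) ^ (1 - (κ + 2 * s)) =
        (y : ℂ) ^ (1 - κ - s) * (2 : ℂ) ^ (1 - κ - 2 * s) := by
      have hyc : (y : ℂ) ≠ 0 := by exact_mod_cast hy.ne'
      rw [Complex.ofReal_mul, Complex.mul_cpow_ofReal_nonneg zero_le_two hy.le,
        mul_left_comm, ← Complex.cpow_add _ _ hyc, mul_comm]
      push_cast
      ring_nf
    linear_combination (-(2 * Real.pi * Complex.Gamma (κ + 2 * s - 1) /
      (Complex.Gamma (κ + s) * Complex.Gamma s) * Λ.kloostermanSeries κ β γ 0 s)) * h2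
  · rw [if_neg hn.ne', if_neg hn.ne', if_pos hn, zero_add]
    have hJ := eulerTransform_of_pos ha hc hy hn
    rw [hca] at hJ
    have hz : 0 < 4 * Real.pi * n * y := by positivity
    rw [hJ, whittakerCal_of_pos hz, abs_of_pos hn]
    have hp := whittaker_power_identity κ s hn hy
    have he : Complex.exp (-(4 * Real.pi * n * y : ℝ) / 2) =
        Complex.exp (-(2 * Real.pi * n : ℝ) * y) := by congr 1; push_cast; ring
    rw [he, add_comm s]
    rw [add_comm s] at hp
    linear_combination (-Complex.exp (-(2 * Real.pi * n : ℝ) * y) / Complex.Gamma (κ + s) *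
      tricomiU (1 - (κ + s)) (2 - (κ + 2 * s)) (4 * Real.pi * n * y) *
      Λ.kloostermanSeries κ β γ n s) * hp

theorem norm_weilCoeff_le (β γ : Λ.Disc) (g : Mp2Z) : ‖Λ.weilCoeff β γ g‖ ≤ 1 :=
  entry_norm_bound_of_unitary (Λ.weilRep g).2 β γ

theorem norm_kloosterman_le (κ : ℝ) {c : ℤ} (hc : c ≠ 0) (β γ : Λ.Disc) (n : ℝ) :
    ‖Λ.kloosterman κ c β 0 γ n‖ ≤ 1 := by
  classical
  have hc' : (0 : ℝ) < c.natAbs := by exact_mod_cast Int.natAbs_pos.mpr hc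
  rw [kloosterman, norm_mul, norm_div]
  have h1 : ‖Complex.exp (-Real.pi * Complex.I * c.sign * κ / 2)‖ = 1 := by
    rw [Complex.norm_exp]
    simp
  have h2 : ‖((|c| : ℤ) : ℂ)‖ = c.natAbs := by
    rw [Complex.norm_intCast, Int.abs_eq_natAbs]; simp
  rw [h1, h2, one_div]
  have h3 : ‖∑ d ∈ (Finset.range c.natAbs).filter (fun d : ℕ => IsCoprime c (d : ℤ)),
      Λ.weilCoeff β γ (Mp2Z.lift (bottomRowMatrix c d)) *
        e (((0 : ℝ) * (bottomRowMatrix c d 0 0 : ℤ) + n * d) / c)‖ ≤ c.natAbs := by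
    refine (norm_sum_le_of_le (n := fun _ => (1 : ℝ)) _ fun d _ => ?_).trans ?_
    · have := norm_e_ofReal (((0 : ℝ) * (bottomRowMatrix c d 0 0 : ℤ) + n * d) / c)
      push_cast at this
      rw [norm_mul]
      push_cast
      rw [this, mul_one]
      exact Λ.norm_weilCoeff_le _ _ _
    · rw [Finset.sum_const, nsmul_eq_mul, mul_one]
      exact_mod_cast (Finset.card_filter_le _ _).trans (Finset.card_range _).le
  calc _ ≤ (c.natAbs : ℝ)⁻¹ * c.natAbs := by gcongr
    _ = 1 := inv_mul_cancel₀ hc'.ne'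

theorem summable_abs_cpow {κ : ℝ} {s : ℂ} (hs : 1 - κ / 2 < s.re) :
    Summable fun c : {c : ℤ // c ≠ 0} => ‖((|c.1| : ℤ) : ℂ) ^ (1 - κ - 2 * s)‖ := by
  have h := (Real.summable_abs_int_rpow (b := κ + 2 * s.re - 1) (by linarith)).subtype
    {c : ℤ | c ≠ 0}
  refine h.congr fun c => ?_
  have hc : 0 < |(c.1 : ℝ)| := abs_pos.mpr (by exact_mod_cast c.2)
  rw [intCast_abs_eq, Complex.norm_cpow_eq_rpow_re_of_pos hc]
  simp only [Function.comp_apply]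
  congr 1
  simp
  ring

theorem summable_kloosterman {κ : ℝ} (β γ : Λ.Disc) (n : ℝ) {s : ℂ} (hs : 1 - κ / 2 < s.re) :
    Summable fun c : {c : ℤ // c ≠ 0} =>
      (((|c.1| : ℤ) : ℂ) ^ (1 - κ - 2 * s)) * Λ.kloosterman κ c β 0 γ n := by
  refine (summable_abs_cpow hs).of_norm_bounded fun c => ?_
  rw [norm_mul]
  exact mul_le_of_le_one_right (norm_nonneg _) (Λ.norm_kloosterman_le κ c.2 β γ n)

end EvenLattice
end Coefficients

/-! ### Roots and logarithms of the automorphy factor -/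

section Metaplectic

namespace Mp2Z

theorem T_zpow_mat (k : ℤ) : (T ^ k).mat = ModularGroup.T ^ k := map_zpow matHom T k

theorem T_zpow_root (k : ℤ) (τ : ℍ) : (T ^ k).root τ = 1 := by
  let P : Subgroup Mp2Z :=
    { carrier := {g | ∀ τ, g.root τ = 1}
      one_mem' := fun τ => rfl
      mul_mem' := fun {x y} hx hy τ => by
        rw [mul_root, hx, hy, one_mul]
      inv_mem' := fun {x} hx τ => by rw [inv_root, hx, inv_one] }
  have hP : Subgroup.zpowers T ≤ P := (Subgroup.zpowers_le).mpr root_T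
  exact hP (Subgroup.zpow_mem_zpowers T k) τ

theorem S_sq_mat : (S * S).mat = -1 := by
  have : ModularGroup.S * ModularGroup.S = -1 := by decide
  exact this

/-- The square of `S` is `(-1, i)`. The sign of the root is decided at the fixed point `i`
of `S`. -/
theorem S_sq_root (τ : ℍ) : (S * S).root τ = Complex.I := by
  have hl : ∀ τ, (lift (-1)).root τ = Complex.I := fun τ => by
    have : autFactor (-1) τ = -1 := by simp [autFactor]
    simp only [lift, this]
    rw [Complex.cpow_def_of_ne_zero (by simp), Complex.log_neg_one,
      show Real.pi * Complex.I * (1 / 2 : ℂ) = Real.pi / 2 * Complex.I by ring,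
      Complex.exp_pi_div_two_mul_I]
  rcases eq_or_neg (g := S * S) (h := lift (-1)) S_sq_mat with h | h
  · rw [h, hl]
  · exfalso
    have h1 := h UpperHalfPlane.I
    have h2 : S.mat • UpperHalfPlane.I = UpperHalfPlane.I := by
      change ModularGroup.S • UpperHalfPlane.I = UpperHalfPlane.I
      rw [UpperHalfPlane.modular_S_smul]
      ext
      simp
    have h3 : (Complex.I ^ (1 / 2 : ℂ)) * (Complex.I ^ (1 / 2 : ℂ)) = Complex.I := by
      rw [← pow_two, ← Complex.cpow_nat_mul]; simp
    rw [mul_root, h2, root_S, hl, UpperHalfPlane.coe_I, h3] at h1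
    have := congrArg Complex.im h1
    norm_num at this

/-- `S⁴ = (1, -1)` is central. -/
theorem S_pow_four_mul (g : Mp2Z) : S ^ 4 * g = g * S ^ 4 := by
  refine Mp2Z.ext ?_ ?_
  · rw [mul_mat, mul_mat, S_pow_four_mat, one_mul, mul_one]
  · ext τ
    rw [mul_root, mul_root, S_pow_four_root, S_pow_four_root, S_pow_four_mat, one_smul]
    ring

/-- Elements whose matrices have the same lower row agree up to `Γ̃_∞` and the sign of the root. -/
theorem exists_eq_of_row {g h : Mp2Z} (h0 : g.mat 1 0 = h.mat 1 0) (h1 : g.mat 1 1 = h.mat 1 1) :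
    ∃ k : ℤ, h = T ^ k * g ∨ h = T ^ k * (S ^ 4 * g) := by
  have hdg := g.mat.det_coe
  have hdh := h.mat.det_coe
  rw [Matrix.det_fin_two] at hdg hdh
  set k : ℤ := h.mat 0 1 * g.mat 0 0 - h.mat 0 0 * g.mat 0 1 with hk
  have hm : h.mat = (T ^ k * g).mat := by
    rw [mul_mat, T_zpow_mat]
    ext i j
    rw [Matrix.SpecialLinearGroup.coe_mul, ModularGroup.coe_T_zpow, Matrix.mul_apply,
      Fin.sum_univ_two]
    fin_cases i <;> fin_cases j <;> simp [hk]
    · rw [h0, h1] at hdg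
      rw [h0]
      linear_combination (-h.mat 0 0) * hdg + g.mat 0 0 * hdh
    · rw [h0, h1] at hdg
      rw [h1]
      linear_combination (-h.mat 0 1) * hdg + g.mat 0 1 * hdh
    · exact h0.symm
    · exact h1.symm
  refine ⟨k, ?_⟩
  rcases eq_or_neg hm with h2 | h2
  · exact Or.inl h2
  · right
    rw [← mul_assoc, ← S_pow_four_mul, mul_assoc]
    refine Mp2Z.ext ?_ ?_
    · rw [mul_mat, S_pow_four_mat, one_mul]; exact hm
    · ext τ
      rw [mul_root, S_pow_four_root, h2]; ring

end Mp2Z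

theorem bottomRowMatrix_row {c d : ℤ} (h : IsCoprime c d) :
    bottomRowMatrix c d 1 0 = c ∧ bottomRowMatrix c d 1 1 = d := by
  rw [show bottomRowMatrix c d = _ from dif_pos h]
  exact ⟨rfl, rfl⟩

/-- The logarithm of `cτ + d` in terms of that of `(cτ + d) / (ci)`, which lies in the right half
plane. -/
theorem log_autFactor {M : SL(2, ℤ)} (hc : M 1 0 ≠ 0) (τ : ℍ) :
    Complex.log (autFactor M τ) = Real.log |((M 1 0 : ℤ) : ℝ)| +
      (M 1 0).sign * (Real.pi / 2) * Complex.I +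
      Complex.log ((τ.im : ℂ) - Complex.I * ((τ.re + (M 1 1 : ℤ) / (M 1 0 : ℤ) : ℝ) : ℂ)) := by
  set c : ℤ := M 1 0 with hcd
  set d : ℤ := M 1 1 with hdd
  set x : ℝ := τ.re + d / c with hx
  have hcR : (c : ℝ) ≠ 0 := by exact_mod_cast hc
  have hcC : (c : ℂ) ≠ 0 := by exact_mod_cast hc
  set ζ : ℂ := (τ.im : ℂ) - Complex.I * x with hζ
  have hζre : 0 < ζ.re := by simpa [hζ] using τ.im_pos
  have hζ0 : ζ ≠ 0 := by rintro h; rw [h] at hζre; simp at hζre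
  have harg : |ζ.arg| < Real.pi / 2 := Complex.abs_arg_lt_pi_div_two_iff.mpr (Or.inl hζre)
  rw [abs_lt] at harg
  have hsgn : Complex.exp (c.sign * (Real.pi / 2) * Complex.I) = c.sign * Complex.I := by
    rcases lt_or_gt_of_ne hc with h | h
    · rw [Int.sign_eq_neg_one_of_neg h]
      push_cast
      rw [show (-1 : ℂ) * (Real.pi / 2) * Complex.I = -(Real.pi / 2 * Complex.I) by ring,
        Complex.exp_neg, Complex.exp_pi_div_two_mul_I, Complex.inv_I]
      ring
    · rw [Int.sign_eq_one_of_pos h]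
      push_cast
      rw [one_mul, Complex.exp_pi_div_two_mul_I, one_mul]
  have habs : ((|(c : ℝ)| : ℝ) : ℂ) * (c.sign : ℂ) = c := by
    have := Int.sign_mul_abs c
    have h2 : ((c.sign * |c| : ℤ) : ℂ) = c := by rw [this]
    rw [Int.cast_mul, intCast_abs_eq] at h2
    rw [mul_comm]; exact h2
  have hexp : Complex.exp (Real.log |(c : ℝ)| + c.sign * (Real.pi / 2) * Complex.I +
      Complex.log ζ) = autFactor M τ := by
    rw [Complex.exp_add, Complex.exp_add, Complex.exp_log hζ0, ← Complex.ofReal_exp,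
      Real.exp_log (abs_pos.mpr hcR), hsgn, ← mul_assoc, habs, autFactor, ← hcd, ← hdd, hζ, hx,
      ← UpperHalfPlane.re_add_im τ]
    push_cast
    field_simp
    linear_combination (-(τ.re * c + d)) * Complex.I_sq
  rw [← hexp, Complex.log_exp]
  · have h1 : (Real.log |(c : ℝ)| + c.sign * (Real.pi / 2) * Complex.I + Complex.log ζ).im =
        c.sign * (Real.pi / 2) + ζ.arg := by
      simp [Complex.log_im]
    rw [h1]
    rcases lt_or_gt_of_ne hc with h | h
    · rw [Int.sign_eq_neg_one_of_neg h]; push_cast; linarith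
    · rw [Int.sign_eq_one_of_pos h]; push_cast; linarith [Real.pi_pos]
  · have h1 : (Real.log |(c : ℝ)| + c.sign * (Real.pi / 2) * Complex.I + Complex.log ζ).im =
        c.sign * (Real.pi / 2) + ζ.arg := by
      simp [Complex.log_im]
    rw [h1]
    rcases lt_or_gt_of_ne hc with h | h
    · rw [Int.sign_eq_neg_one_of_neg h]; push_cast; linarith [Real.pi_pos]
    · rw [Int.sign_eq_one_of_pos h]; push_cast; linarith

/-- The automorphy factor of a term with `c ≠ 0` in terms of the kernel. -/
theorem automorphy_eq_eulerKernel {M : SL(2, ℤ)} (hc : M 1 0 ≠ 0) (τ : ℍ) {κ : ℝ} {w : ℤ}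
    (hw : (w : ℝ) = 2 * κ) (s : ℂ) :
    (Mp2Z.lift M).root τ ^ (-w) * ((M • τ).im : ℂ) ^ s =
      Complex.exp (-Real.pi * Complex.I * (M 1 0).sign * κ / 2) *
        ((|M 1 0| : ℤ) : ℂ) ^ (-κ - 2 * s) * ((τ.im : ℂ) ^ s *
        eulerKernel (κ + s) s τ.im (τ.re + (M 1 1 : ℤ) / (M 1 0 : ℤ))) := by
  have hlog := log_autFactor hc τ
  have hcR : (((M 1 0 : ℤ)) : ℝ) ≠ 0 := by exact_mod_cast hc
  have hc0 : 0 < |((M 1 0 : ℤ) : ℝ)| := abs_pos.mpr hcR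
  set x : ℝ := τ.re + (M 1 1 : ℤ) / (M 1 0 : ℤ) with hx
  set ζ : ℂ := (τ.im : ℂ) - Complex.I * x with hζ
  have hζre : 0 < ζ.re := by simpa [hζ] using τ.im_pos
  have hζ0 : ζ ≠ 0 := by rintro h; rw [h] at hζre; simp at hζre
  have hζarg : ζ.arg ≠ Real.pi := Complex.slitPlane_arg_ne_pi (Or.inl hζre)
  have hconj : (τ.im : ℂ) + Complex.I * x = (starRingEnd ℂ) ζ := by simp [hζ]
  have hsum : Complex.log ζ + Complex.log ((starRingEnd ℂ) ζ) = 2 * (Real.log ‖ζ‖ : ℝ) := by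
    rw [Complex.log_conj _ hζarg, Complex.add_conj, Complex.log_re]
    push_cast; ring
  have hne := autFactor_ne_zero M τ
  have hroot : (Mp2Z.lift M).root τ ^ (-w) = Complex.exp (-κ * Complex.log (autFactor M τ)) := by
    change (autFactor M τ ^ (1 / 2 : ℂ)) ^ (-w) = _
    rw [Complex.cpow_def_of_ne_zero hne, ← Complex.exp_int_mul]
    congr 1
    have : (w : ℂ) = 2 * κ := by exact_mod_cast congrArg (fun r : ℝ => (r : ℂ)) hw
    push_cast
    rw [this]; ring
  have hnorm : ‖autFactor M τ‖ = |((M 1 0 : ℤ) : ℝ)| * ‖ζ‖ := by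
    have h1 := congrArg Complex.re hlog
    rw [Complex.log_re] at h1
    simp only [Complex.add_re, Complex.ofReal_re, Complex.log_re] at h1
    have h2 : (((M 1 0).sign : ℂ) * (Real.pi / 2) * Complex.I).re = 0 := by
      simp
    rw [h2, add_zero, ← Real.log_mul hc0.ne' (norm_ne_zero_iff.mpr hζ0)] at h1
    exact Real.log_injOn_pos (norm_pos_iff.mpr hne)
      (mul_pos hc0 (norm_pos_iff.mpr hζ0)) h1
  have him : (M • τ).im = τ.im / (|((M 1 0 : ℤ) : ℝ)| * ‖ζ‖) ^ 2 := by
    rw [ModularGroup.im_smul_eq_div_normSq, ← autFactor_eq_denom, Complex.normSq_eq_norm_sq, hnorm]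
  have hlim : Real.log (M • τ).im = Real.log τ.im - 2 * (Real.log |((M 1 0 : ℤ) : ℝ)| +
      Real.log ‖ζ‖) := by
    rw [him, Real.log_div τ.im_pos.ne' (by positivity), Real.log_pow,
      Real.log_mul hc0.ne' (norm_ne_zero_iff.mpr hζ0)]
    push_cast; ring
  rw [hroot, ofReal_cpow_eq_exp (M • τ).im_pos, intCast_abs_eq, ofReal_cpow_eq_exp hc0,
    ofReal_cpow_eq_exp τ.im_pos, eulerKernel, ← hζ, hconj,
    Complex.cpow_def_of_ne_zero hζ0, Complex.cpow_def_of_ne_zero (by simpa using hζ0), hlog, hlim]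
  simp only [← Complex.exp_add]
  congr 1
  push_cast
  linear_combination s * hsum

end Metaplectic

/-! ### The terms of the Eisenstein series -/

section Slash
namespace EvenLattice
variable {V : Type*} [AddCommGroup V] [Module ℝ V] (Λ : EvenLattice V)

theorem slash_seed_apply (w : ℤ) (β γ : Λ.Disc) (s : ℂ) (g : Mp2Z) (τ : ℍ) :
    Λ.slash w (Λ.eisensteinSeed β s) g τ γ =
      g.root τ ^ (-w) * ((g.mat • τ).im : ℂ) ^ s * Λ.weilCoeff β γ g := by
  simp only [slash, eisensteinSeed, Pi.smul_apply, Matrix.mulVec_smul, Matrix.mulVec_single_one,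
    smul_eq_mul]
  rw [mul_assoc]
  congr 2
  change (Λ.weilRep (g⁻¹)⁻¹ : Matrix Λ.Disc Λ.Disc ℂ) β γ = _
  rw [inv_inv, weilCoeff]

theorem weilCoeff_mul (β γ : Λ.Disc) (g h : Mp2Z) :
    Λ.weilCoeff β γ (g * h) = ∑ δ, Λ.weilCoeff β δ g * Λ.weilCoeff δ γ h := by
  simp only [weilCoeff, map_mul, Submonoid.coe_mul, Matrix.mul_apply]

theorem weilCoeff_T (δ γ : Λ.Disc) :
    Λ.weilCoeff δ γ Mp2Z.T = if δ = γ then eMod (Λ.discForm γ) else 0 := by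
  have := congrFun (Λ.weilRep_spec.1 γ) δ
  rw [Matrix.mulVec_single_one] at this
  change Λ.weilCoeff δ γ Mp2Z.T = _ at this
  rw [this, Pi.smul_apply, Pi.single_apply, smul_eq_mul, mul_ite, mul_one, mul_zero]

theorem weilCoeff_mul_T (β γ : Λ.Disc) (g : Mp2Z) :
    Λ.weilCoeff β γ (g * Mp2Z.T) = Λ.weilCoeff β γ g * eMod (Λ.discForm γ) := by
  rw [weilCoeff_mul]
  simp [weilCoeff_T]

theorem eMod_ne_zero (x : UnitAddCircle) : eMod x ≠ 0 := by
  simp [eMod]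

theorem weilCoeff_mul_T_zpow (β γ : Λ.Disc) (g : Mp2Z) (k : ℤ) :
    Λ.weilCoeff β γ (g * Mp2Z.T ^ k) = Λ.weilCoeff β γ g * eMod (k • Λ.discForm γ) := by
  induction k with
  | zero => simp [eMod]
  | succ k ih =>
    rw [zpow_add_one, ← mul_assoc, weilCoeff_mul_T, ih, add_smul, one_smul, eMod_add, mul_assoc]
  | pred k ih =>
    have h := Λ.weilCoeff_mul_T β γ (g * Mp2Z.T ^ (-(k : ℤ) - 1))
    rw [mul_assoc, ← zpow_add_one, sub_add_cancel, ih] at h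
    have h2 : eMod ((-(k : ℤ)) • Λ.discForm γ) =
        eMod ((-(k : ℤ) - 1) • Λ.discForm γ) * eMod (Λ.discForm γ) := by
      rw [← eMod_add, sub_smul, one_smul, sub_add_cancel]
    rw [h2, ← mul_assoc] at h
    exact (mul_right_cancel₀ (eMod_ne_zero _) h).symm

theorem weilCoeff_S (δ γ : Λ.Disc) :
    Λ.weilCoeff δ γ Mp2Z.S = (Complex.I ^ (1 / 2 : ℂ)) ^ ((Λ.bNeg : ℤ) - Λ.bPos) /
      (Real.sqrt (Nat.card Λ.Disc) : ℝ) * Λ.discChar γ δ := by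
  have := congrFun (Λ.weilRep_spec.2 γ) δ
  rw [Matrix.mulVec_single_one] at this
  change Λ.weilCoeff δ γ Mp2Z.S = _ at this
  rw [this, Pi.smul_apply, smul_eq_mul, Finset.sum_apply]
  simp [Pi.single_apply, discChar]

/-- `ρ_L(S²) 𝔢_γ = i^(b⁻ - b⁺) 𝔢_{-γ}`, by the orthogonality of characters. -/
theorem weilCoeff_S_sq (δ γ : Λ.Disc) : Λ.weilCoeff δ γ (Mp2Z.S * Mp2Z.S) =
    if -δ = γ then Complex.I ^ ((Λ.bNeg : ℤ) - Λ.bPos) else 0 := by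
  have h1 : ∀ ε, Λ.discChar ε δ * Λ.discChar γ ε = Λ.discChar (δ + γ) ε := fun ε => by
    change eMod (-Λ.discPairing ε δ) * eMod (-Λ.discPairing γ ε) =
      eMod (-Λ.discPairing (δ + γ) ε)
    rw [← eMod_add, Λ.discPairing_comm (δ + γ), discPairing_add, Λ.discPairing_comm γ ε, neg_add]
  have h2 : Λ.discChar (δ + γ) = 0 ↔ -δ = γ := by
    rw [neg_eq_iff_add_eq_zero]
    refine ⟨fun h => Λ.discChar_eq_zero h, fun h => ?_⟩
    rw [h]
    ext ε
    change eMod (-Λ.discPairing 0 ε) = 1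
    rw [Λ.discPairing_comm]
    exact (Λ.discChar ε).map_zero_eq_one
  have h3 : ((Real.sqrt (Nat.card Λ.Disc) : ℝ) : ℂ) * (Real.sqrt (Nat.card Λ.Disc) : ℝ) =
      Fintype.card Λ.Disc := by
    rw [← Complex.ofReal_mul, Real.mul_self_sqrt (Nat.cast_nonneg _), Nat.card_eq_fintype_card]
    simp
  have h4 : (Fintype.card Λ.Disc : ℂ) ≠ 0 := by exact_mod_cast Fintype.card_ne_zero
  have h5 : (Complex.I ^ (1 / 2 : ℂ)) * (Complex.I ^ (1 / 2 : ℂ)) = Complex.I := by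
    rw [← pow_two, ← Complex.cpow_nat_mul]; simp
  rw [weilCoeff_mul]
  simp only [weilCoeff_S]
  have h6 : ∀ ε, (Complex.I ^ (1 / 2 : ℂ)) ^ ((Λ.bNeg : ℤ) - Λ.bPos) /
      (Real.sqrt (Nat.card Λ.Disc) : ℝ) * Λ.discChar ε δ *
      ((Complex.I ^ (1 / 2 : ℂ)) ^ ((Λ.bNeg : ℤ) - Λ.bPos) /
      (Real.sqrt (Nat.card Λ.Disc) : ℝ) * Λ.discChar γ ε) =
      Complex.I ^ ((Λ.bNeg : ℤ) - Λ.bPos) / Fintype.card Λ.Disc * Λ.discChar (δ + γ) ε :=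
      fun ε => by
    have h7 : Complex.I ^ ((Λ.bNeg : ℤ) - Λ.bPos) =
        (Complex.I ^ (1 / 2 : ℂ)) ^ ((Λ.bNeg : ℤ) - Λ.bPos) *
          (Complex.I ^ (1 / 2 : ℂ)) ^ ((Λ.bNeg : ℤ) - Λ.bPos) := by rw [← mul_zpow, h5]
    rw [← h1, ← h3, h7]
    ring
  simp only [h6]
  rw [← Finset.mul_sum, AddChar.sum_eq_ite]
  simp only [h2]
  split_ifs
  · field_simp
  · simp

variable {w : ℤ}

theorem I_zpow_eq_one (hsig : (w - Λ.bNeg + Λ.bPos : ℤ) ≡ 0 [ZMOD 4]) :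
    Complex.I ^ (-w) * Complex.I ^ ((Λ.bNeg : ℤ) - Λ.bPos) = 1 := by
  obtain ⟨k, hk⟩ := (Int.modEq_zero_iff_dvd).mp hsig
  rw [← zpow_add₀ Complex.I_ne_zero, show -w + ((Λ.bNeg : ℤ) - Λ.bPos) = 4 * (-k) by linarith,
    zpow_mul]
  have : Complex.I ^ (4 : ℤ) = 1 := by exact_mod_cast Complex.I_pow_four
  rw [this, one_zpow]

theorem slash_seed_S_sq (hsig : (w - Λ.bNeg + Λ.bPos : ℤ) ≡ 0 [ZMOD 4]) (β : Λ.Disc) (s : ℂ) :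
    Λ.slash w (Λ.eisensteinSeed β s) (Mp2Z.S * Mp2Z.S) = Λ.eisensteinSeed (-β) s := by
  funext τ γ
  have h1 : ((-1 : SL(2, ℤ)) • τ) = τ := by simp
  rw [slash_seed_apply, Mp2Z.S_sq_root, Mp2Z.S_sq_mat, h1, weilCoeff_S_sq, eisensteinSeed,
    Pi.smul_apply, Pi.single_apply, smul_eq_mul]
  by_cases h : -β = γ
  · rw [if_pos h, if_pos h.symm]
    linear_combination ((τ.im : ℂ) ^ s) * Λ.I_zpow_eq_one hsig
  · rw [if_neg h, if_neg (Ne.symm h)]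
    simp

theorem slash_seed_S_pow_four (hsig : (w - Λ.bNeg + Λ.bPos : ℤ) ≡ 0 [ZMOD 4]) (β : Λ.Disc)
    (s : ℂ) : Λ.slash w (Λ.eisensteinSeed β s) (Mp2Z.S ^ 4) = Λ.eisensteinSeed β s := by
  rw [show Mp2Z.S ^ 4 = (Mp2Z.S * Mp2Z.S) * (Mp2Z.S * Mp2Z.S) by
    rw [← pow_two, ← pow_two, ← pow_mul], slash_mul,
    Λ.slash_seed_S_sq hsig, Λ.slash_seed_S_sq hsig, neg_neg]

theorem slash_seed_T_zpow_mul {β : Λ.Disc} (hβ : Λ.discForm β = 0) (s : ℂ) (k : ℤ) (g : Mp2Z) :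
    Λ.slash w (Λ.eisensteinSeed β s) (Mp2Z.T ^ k * g) = Λ.slash w (Λ.eisensteinSeed β s) g := by
  refine (Λ.slash_seed_congr w hβ s ?_).symm
  rw [mul_inv_cancel_right]
  exact Subgroup.zpow_mem_zpowers _ _

theorem slash_seed_S_pow_four_mul (hsig : (w - Λ.bNeg + Λ.bPos : ℤ) ≡ 0 [ZMOD 4]) (β : Λ.Disc)
    (s : ℂ) (g : Mp2Z) :
    Λ.slash w (Λ.eisensteinSeed β s) (Mp2Z.S ^ 4 * g) = Λ.slash w (Λ.eisensteinSeed β s) g := by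
  rw [slash_mul, Λ.slash_seed_S_pow_four hsig]

/-- The terms of the Eisenstein series depend only on the lower row of the matrix. -/
theorem slash_seed_eq_of_row (hsig : (w - Λ.bNeg + Λ.bPos : ℤ) ≡ 0 [ZMOD 4]) {β : Λ.Disc}
    (hβ : Λ.discForm β = 0) (s : ℂ) {g h : Mp2Z} (h0 : g.mat 1 0 = h.mat 1 0)
    (h1 : g.mat 1 1 = h.mat 1 1) :
    Λ.slash w (Λ.eisensteinSeed β s) h = Λ.slash w (Λ.eisensteinSeed β s) g := by
  obtain ⟨k, rfl | rfl⟩ := Mp2Z.exists_eq_of_row h0 h1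
  · exact Λ.slash_seed_T_zpow_mul hβ s k g
  · rw [Λ.slash_seed_T_zpow_mul hβ s k, Λ.slash_seed_S_pow_four_mul hsig]

end EvenLattice

/-- The coprime pairs `(c, d)`, the lower rows of the elements of `SL₂(ℤ)`. -/
abbrev CoprimePair : Type := {p : ℤ × ℤ // IsCoprime p.1 p.2}

/-- The element of `Mp₂(ℤ)` with a given lower row and the principal root. -/
noncomputable def CoprimePair.toMp2Z (p : CoprimePair) : Mp2Z :=
  Mp2Z.lift (bottomRowMatrix p.1.1 p.1.2)

theorem CoprimePair.toMp2Z_row (p : CoprimePair) :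
    p.toMp2Z.mat 1 0 = p.1.1 ∧ p.toMp2Z.mat 1 1 = p.1.2 := bottomRowMatrix_row p.2

/-- Cosets in `Γ̃_∞ \ Mp₂(ℤ)` correspond to coprime pairs with a sign of the root. -/
noncomputable def cosetMap :
    CoprimePair ⊕ CoprimePair → Quotient (QuotientGroup.rightRel Mp2Z.GammaInf) :=
  Sum.elim (fun p => Quotient.mk _ p.toMp2Z) fun p => Quotient.mk _ (Mp2Z.S ^ 4 * p.toMp2Z)

theorem T_zpow_mul_row (k : ℤ) (g : Mp2Z) :
    (Mp2Z.T ^ k * g).mat 1 0 = g.mat 1 0 ∧ (Mp2Z.T ^ k * g).mat 1 1 = g.mat 1 1 := by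
  rw [Mp2Z.mul_mat, Mp2Z.T_zpow_mat]
  constructor <;>
  · rw [Matrix.SpecialLinearGroup.coe_mul, ModularGroup.coe_T_zpow, Matrix.mul_apply,
      Fin.sum_univ_two]
    simp

theorem mk_eq_mk_iff {g h : Mp2Z} :
    (Quotient.mk (QuotientGroup.rightRel Mp2Z.GammaInf) g = Quotient.mk _ h) ↔
      ∃ k : ℤ, h = Mp2Z.T ^ k * g := by
  rw [Quotient.eq, QuotientGroup.rightRel_apply, Mp2Z.GammaInf, Subgroup.mem_zpowers_iff]
  exact exists_congr fun k => ⟨fun h => (eq_mul_inv_iff_mul_eq.mp h).symm,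
    fun h => eq_mul_inv_iff_mul_eq.mpr h.symm⟩

theorem T_zpow_eq_one {k : ℤ} (h : (Mp2Z.T ^ k).mat = 1) : Mp2Z.T ^ k = 1 := by
  rw [Mp2Z.T_zpow_mat] at h
  have h2 := congrFun (congrFun (congrArg Subtype.val h) 0) 1
  rw [ModularGroup.coe_T_zpow] at h2
  have : k = 0 := by simpa using h2
  rw [this, zpow_zero]

theorem cosetMap_bijective : Function.Bijective cosetMap := by
  have key : ∀ {p q : CoprimePair} {k : ℤ} {u : Mp2Z}, u.mat = 1 →
      p.toMp2Z = Mp2Z.T ^ k * (u * q.toMp2Z) → p = q ∧ u = 1 := by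
    intro p q k u hu h
    have hr := T_zpow_mul_row k (u * q.toMp2Z)
    rw [← h, Mp2Z.mul_mat u, hu, one_mul] at hr
    have hpq : p = q := by
      refine Subtype.ext (Prod.ext ?_ ?_)
      · rw [← p.toMp2Z_row.1, hr.1, q.toMp2Z_row.1]
      · rw [← p.toMp2Z_row.2, hr.2, q.toMp2Z_row.2]
    subst hpq
    refine ⟨rfl, ?_⟩
    have h1 : Mp2Z.T ^ k * u = 1 := by
      rw [← mul_assoc] at h
      exact (mul_eq_right.mp h.symm)
    have h2 : (Mp2Z.T ^ k).mat = 1 := by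
      have := congrArg Mp2Z.mat h1
      rwa [Mp2Z.mul_mat, hu, mul_one] at this
    rw [T_zpow_eq_one h2, one_mul] at h1
    exact h1
  have hS : (Mp2Z.S ^ 4) ≠ 1 := fun h => by
    have := Mp2Z.S_pow_four_root UpperHalfPlane.I
    rw [h, Mp2Z.one_root] at this
    norm_num at this
  have hSS : Mp2Z.S ^ 4 * Mp2Z.S ^ 4 = 1 := by
    rw [← pow_add]; exact Mp2Z.S_pow_eight
  constructor
  · rintro (p | p) (q | q) h
    · obtain ⟨k, hk⟩ := mk_eq_mk_iff.mp h
      rw [(key (p := q) (q := p) (k := k) (u := 1) rfl (by rwa [one_mul])).1]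
    · obtain ⟨k, hk⟩ := mk_eq_mk_iff.mp h
      refine absurd (key (p := q) (q := p) (k := k) (u := Mp2Z.S ^ 4) Mp2Z.S_pow_four_mat ?_).2 hS
      have := congrArg (fun g => Mp2Z.S ^ 4 * g) hk
      simp only [← mul_assoc, hSS, one_mul] at this
      rw [this, Mp2Z.S_pow_four_mul, mul_assoc]
    · obtain ⟨k, hk⟩ := mk_eq_mk_iff.mp h
      exact absurd (key Mp2Z.S_pow_four_mat hk).2 hS
    · obtain ⟨k, hk⟩ := mk_eq_mk_iff.mp h
      have := congrArg (fun g => Mp2Z.S ^ 4 * g) hk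
      simp only [← mul_assoc, hSS, one_mul] at this
      rw [Mp2Z.S_pow_four_mul, mul_assoc (Mp2Z.T ^ k), hSS, mul_one] at this
      rw [(key (p := q) (q := p) (k := k) (u := 1) rfl (by rwa [one_mul])).1]
  · intro x
    obtain ⟨g, rfl⟩ := Quotient.exists_rep x
    have hd := g.mat.det_coe
    rw [Matrix.det_fin_two] at hd
    let p : CoprimePair := ⟨(g.mat 1 0, g.mat 1 1), -g.mat 0 1, g.mat 0 0, by
      linear_combination hd⟩
    obtain ⟨k, h | h⟩ := Mp2Z.exists_eq_of_row (g := p.toMp2Z) (h := g) p.toMp2Z_row.1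
      p.toMp2Z_row.2
    · exact ⟨Sum.inl p, mk_eq_mk_iff.mpr ⟨k, h⟩⟩
    · exact ⟨Sum.inr p, mk_eq_mk_iff.mpr ⟨k, h⟩⟩

namespace EvenLattice
variable {V : Type*} [AddCommGroup V] [Module ℝ V] (Λ : EvenLattice V) {w : ℤ}

/-- The two roots over each lower row contribute equally, which cancels the factor `1 / 2`. -/
theorem hasSum_eisensteinTerm (hsig : (w - Λ.bNeg + Λ.bPos : ℤ) ≡ 0 [ZMOD 4]) {β : Λ.Disc}
    (hβ : Λ.discForm β = 0) (s : ℂ) (τ : ℍ) {A : Λ.Disc → ℂ}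
    (h : HasSum (fun p : CoprimePair => Λ.slash w (Λ.eisensteinSeed β s) p.toMp2Z τ) A) :
    HasSum (Λ.eisensteinTerm w β hβ s τ) (A + A) := by
  rw [← (Equiv.ofBijective _ cosetMap_bijective).hasSum_iff]
  refine HasSum.sum h ?_
  refine h.congr_fun fun p => ?_
  change Λ.slash w (Λ.eisensteinSeed β s) (Mp2Z.S ^ 4 * p.toMp2Z) τ = _
  rw [Λ.slash_seed_S_pow_four_mul hsig]

theorem eisenstein_eq_of_hasSum (hsig : (w - Λ.bNeg + Λ.bPos : ℤ) ≡ 0 [ZMOD 4]) {β : Λ.Disc}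
    (hβ : Λ.discForm β = 0) (s : ℂ) (τ : ℍ) {A : Λ.Disc → ℂ}
    (h : HasSum (fun p : CoprimePair => Λ.slash w (Λ.eisensteinSeed β s) p.toMp2Z τ) A) :
    Λ.eisenstein w β hβ s τ = A := by
  rw [eisenstein, (Λ.hasSum_eisensteinTerm hsig hβ s τ h).tsum_eq, ← two_smul ℂ A, smul_smul]
  norm_num

end EvenLattice
end Slash

/-! ### Poisson summation for the kernel -/

section Poisson
open MeasureTheory Set Filter Topology Asymptotics
open scoped FourierTransform

theorem summable_eulerTransform {a b : ℂ} {y : ℝ} (hy : 0 < y) (hab : 1 < (a + b).re) (q : ℝ) :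
    Summable fun m : ℤ => ‖eulerTransform a b y (m - q)‖ := by
  obtain ⟨C, hC⟩ := exists_eulerTransform_decay hy hab
  have h := ((Real.summable_one_div_int_add_rpow (-q) 2).mpr one_lt_two).mul_left C
  refine h.of_norm_bounded_eventually ?_
  refine Filter.eventually_cofinite.mpr (Set.Finite.subset (Set.finite_singleton ⌊q⌋) ?_)
  intro m hm
  by_contra hne
  refine hm ?_
  rw [norm_norm, ← sub_eq_add_neg]
  have hmq : (m : ℝ) - q ≠ 0 := fun h => hne (by
    have : q = m := by linarith
    rw [Set.mem_singleton_iff, this, Int.floor_intCast])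
  have h2 : |(m : ℝ) - q| ^ (2 : ℝ) = ((m : ℝ) - q) ^ 2 := by
    rw [show (2 : ℝ) = ((2 : ℕ) : ℝ) by norm_num, Real.rpow_natCast, sq_abs]
  rw [h2, mul_one_div, le_div_iff₀ (by positivity), mul_comm]
  exact hC _

theorem isBigO_eulerKernel {a b : ℂ} {y : ℝ} (hy : 0 < y) (hab : 1 < (a + b).re) :
    eulerKernel a b y =O[cocompact ℝ] fun x : ℝ => |x| ^ (-(a + b).re) := by
  obtain ⟨C, hC⟩ := norm_eulerKernel_le a b hy (by linarith)
  have hC0 : 0 ≤ C := by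
    have := (norm_nonneg _).trans (hC 0)
    simpa using this
  refine IsBigO.of_bound C ?_
  have h0 : ∀ᶠ x : ℝ in cocompact ℝ, x ≠ 0 := by
    have := (isCompact_singleton (x := (0 : ℝ))).compl_mem_cocompact
    filter_upwards [this] with x hx
    simpa using hx
  filter_upwards [h0] with x hx
  refine (hC x).trans ?_
  have hx' : 0 < |x| := abs_pos.mpr hx
  rw [Real.norm_of_nonneg (Real.rpow_nonneg (abs_nonneg x) _)]
  gcongr
  have : |x| ^ (-(a + b).re) = (|x| ^ (2 : ℕ)) ^ (-(a + b).re / 2) := by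
    rw [← Real.rpow_natCast, ← Real.rpow_mul hx'.le]
    congr 1
    push_cast; ring
  rw [this, Real.norm_eq_abs]
  exact Real.rpow_le_rpow_of_nonpos (by positivity) (by linarith) (by linarith)

/-- Poisson summation for the kernel, twisted by an additive character of `ℤ`. -/
theorem tsum_eulerKernel {a b : ℂ} {y : ℝ} (hy : 0 < y) (hab : 1 < (a + b).re) (q u : ℝ) :
    ∑' k : ℤ, e (k * q) * eulerKernel a b y (u + k) =
      ∑' m : ℤ, eulerTransform a b y (m - q) * e (((m - q : ℝ) : ℂ) * u) := by
  set f : ℝ → ℂ := fun x => eulerKernel a b y x * e (q * x) with hf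
  have hc : Continuous f := (continuous_eulerKernel a b hy).mul (by fun_prop)
  have hn : ∀ x : ℝ, ‖e (q * x)‖ = 1 := fun x => by
    have := norm_e_ofReal (q * x); push_cast at this; exact this
  have hO : f =O[cocompact ℝ] fun x : ℝ => |x| ^ (-(a + b).re) := by
    refine IsBigO.trans (IsBigO.of_bound 1 (Eventually.of_forall fun x => ?_))
      (isBigO_eulerKernel hy hab)
    rw [hf, norm_mul, hn]; simp
  have hF : ∀ m : ℤ, 𝓕 f m = eulerTransform a b y (m - q) := fun m => by
    rw [Real.fourier_eq', eulerTransform]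
    refine integral_congr_ae (ae_of_all _ fun x => ?_)
    simp only [hf, smul_eq_mul]
    rw [mul_left_comm, e, e, ← Complex.exp_add]
    congr 2
    simp
    ring
  have hs : Summable fun m : ℤ => 𝓕 f m := by
    simp_rw [hF]
    exact (summable_eulerTransform hy hab q).of_norm
  have hP := Real.tsum_eq_tsum_fourier_of_rpow_decay_of_summable hc hab hO hs u
  have hl : ∀ k : ℤ, e (k * q) * eulerKernel a b y (u + k) = e (-(q * u)) * f (u + k) := fun k => by
    simp only [hf]
    rw [mul_left_comm, mul_comm (e _), ← Mp2Z.e_add]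
    congr 2
    push_cast; ring
  have hr : ∀ m : ℤ, eulerTransform a b y (m - q) * e (((m - q : ℝ) : ℂ) * u) =
      e (-(q * u)) * (𝓕 f m * fourier m (u : UnitAddCircle)) := fun m => by
    rw [hF, fourier_coe_apply, mul_left_comm]
    congr 1
    rw [e, e, ← Complex.exp_add]
    congr 1
    push_cast
    ring
  simp_rw [hl, hr]
  rw [tsum_mul_left, tsum_mul_left, hP]

end Poisson

/-! ### The lower rows and their contributions -/

section Rows

open Classical in
/-- The primitive residues modulo `c`, represented in `[0, |c|)`. -/
noncomputable def primitiveResidues (c : ℤ) : Finset ℕ :=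
  (Finset.range c.natAbs).filter fun d : ℕ => IsCoprime c (d : ℤ)

theorem mem_primitiveResidues {c : ℤ} {d : ℕ} :
    d ∈ primitiveResidues c ↔ d < c.natAbs ∧ IsCoprime c (d : ℤ) := by
  simp [primitiveResidues]

theorem residue_emod {c : ℤ} {d : ℕ} (hd : d < c.natAbs) (k : ℤ) : ((d : ℤ) + k * c) % c = d := by
  rw [Int.add_mul_emod_self_right, ← Int.emod_abs, Int.emod_eq_of_lt (by positivity)]
  rw [Int.abs_eq_natAbs]
  exact_mod_cast hd

/-- The pairs with `c ≠ 0`, sorted by `c`, by the residue of `d` modulo `c`, and by the quotient. -/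
abbrev RowIndex : Type := Σ c : {c : ℤ // c ≠ 0}, primitiveResidues c.1 × ℤ

/-- All coprime pairs: `(0, 1)`, `(0, -1)` and the pairs `(c, d + kc)` with `c ≠ 0`. -/
def rowMap : Bool ⊕ RowIndex → CoprimePair
  | Sum.inl true => ⟨(0, 1), isCoprime_one_right⟩
  | Sum.inl false => ⟨(0, -1), isCoprime_one_right.neg_right⟩
  | Sum.inr ⟨c, d, k⟩ => ⟨(c.1, (d.1 : ℤ) + k * c.1),
      (mem_primitiveResidues.mp d.2).2.add_mul_right_right k⟩

theorem rowMap_bijective : Function.Bijective rowMap := by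
  constructor
  · have h0 : ∀ (i : Bool), (rowMap (Sum.inl i)).1.1 = 0 := by
      rintro (_ | _) <;> rfl
    rintro (i | ⟨c, d, k⟩) (j | ⟨c', d', k'⟩) h
    · have := congrArg (fun p : CoprimePair => p.1.2) h
      rcases i with _ | _ <;> rcases j with _ | _ <;> simp [rowMap] at this ⊢
    · have := congrArg (fun p : CoprimePair => p.1.1) h
      simp only [h0] at this
      exact absurd this.symm c'.2
    · have := congrArg (fun p : CoprimePair => p.1.1) h
      simp only [h0] at this
      exact absurd this c.2
    · have h1 : c = c' := Subtype.ext (congrArg (fun p : CoprimePair => p.1.1) h)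
      subst h1
      have h2 : (d.1 : ℤ) + k * c.1 = (d'.1 : ℤ) + k' * c.1 :=
        congrArg (fun p : CoprimePair => p.1.2) h
      have h3 := congrArg (· % c.1) h2
      simp only [residue_emod (mem_primitiveResidues.mp d.2).1,
        residue_emod (mem_primitiveResidues.mp d'.2).1] at h3
      have h4 : d = d' := Subtype.ext (by exact_mod_cast h3)
      subst h4
      have h5 : k = k' := mul_right_cancel₀ c.2 (add_left_cancel h2)
      rw [h5]
  · rintro ⟨⟨c, d⟩, h⟩
    by_cases hc : c = 0
    · subst hc
      rcases Int.isUnit_iff.mp (isCoprime_zero_left.mp h) with rfl | rfl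
      · exact ⟨Sum.inl true, rfl⟩
      · exact ⟨Sum.inl false, rfl⟩
    · have hr : ((d % c).toNat : ℤ) = d % c := Int.toNat_of_nonneg (Int.emod_nonneg _ hc)
      have hd : (d % c).toNat + d / c * c = d := by
        rw [hr]; exact Int.emod_add_ediv_mul d c
      refine ⟨Sum.inr ⟨⟨c, hc⟩, ⟨(d % c).toNat, mem_primitiveResidues.mpr ⟨?_, ?_⟩⟩, d / c⟩, ?_⟩
      · have := Int.emod_lt_abs d hc
        rw [← hr, Int.abs_eq_natAbs] at this
        exact_mod_cast this
      · rw [show ((d % c).toNat : ℤ) = d + (-(d / c)) * c by linarith]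
        exact IsCoprime.add_mul_right_right h _
      · exact Subtype.ext (Prod.ext rfl hd)

namespace EvenLattice
variable {V : Type*} [AddCommGroup V] [Module ℝ V] (Λ : EvenLattice V) {w : ℤ}

theorem norm_slash_seed {κ : ℝ} (hw : (w : ℝ) = 2 * κ) (β γ : Λ.Disc) (s : ℂ) (g : Mp2Z) (τ : ℍ) :
    ‖Λ.slash w (Λ.eisensteinSeed β s) g τ γ‖ ≤
      τ.im ^ s.re * ‖autFactor g.mat τ‖ ^ (-(κ + 2 * s.re)) := by
  have hA : 0 < ‖autFactor g.mat τ‖ := norm_pos_iff.mpr (autFactor_ne_zero _ _)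
  have hr : ‖g.root τ ^ (-w)‖ = ‖autFactor g.mat τ‖ ^ (-κ) := by
    rw [← g.sq τ, norm_pow, norm_zpow, ← Real.rpow_intCast, ← Real.rpow_natCast,
      ← Real.rpow_mul (norm_nonneg _)]
    congr 1
    push_cast
    rw [hw]; ring
  have hi : (g.mat • τ).im = τ.im / ‖autFactor g.mat τ‖ ^ (2 : ℝ) := by
    rw [ModularGroup.im_smul_eq_div_normSq, ← autFactor_eq_denom, Complex.normSq_eq_norm_sq]
    norm_cast
  rw [slash_seed_apply, norm_mul, norm_mul, hr, Complex.norm_cpow_eq_rpow_re_of_pos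
    (g.mat • τ).im_pos, hi, Real.div_rpow τ.im_pos.le (by positivity), ← Real.rpow_mul hA.le,
    neg_add, Real.rpow_add hA, Real.rpow_neg hA.le (2 * s.re)]
  refine (mul_le_of_le_one_right (by positivity) (Λ.norm_weilCoeff_le β γ g)).trans (le_of_eq ?_)
  ring

theorem summable_slash_seed {κ : ℝ} (hw : (w : ℝ) = 2 * κ) (β : Λ.Disc) {s : ℂ}
    (hs : 1 - κ / 2 < s.re) (τ : ℍ) :
    Summable fun p : CoprimePair => Λ.slash w (Λ.eisensteinSeed β s) p.toMp2Z τ := by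
  rw [Pi.summable]
  intro γ
  have hinj : Function.Injective fun p : CoprimePair => (![p.1.1, p.1.2] : Fin 2 → ℤ) := by
    intro p q h
    exact Subtype.ext (Prod.ext (congrFun h 0) (congrFun h 1))
  have h := (((EisensteinSeries.summable_one_div_norm_rpow (k := κ + 2 * s.re)
    (by linarith)).comp_injective hinj).mul_left
      (τ.im ^ s.re * EisensteinSeries.r τ ^ (-(κ + 2 * s.re))))
  refine h.of_norm_bounded fun p => ?_
  refine (Λ.norm_slash_seed hw β γ s p.toMp2Z τ).trans ?_
  have hb := EisensteinSeries.summand_bound τ (k := κ + 2 * s.re) (by linarith) ![p.1.1, p.1.2]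
  simp only [Matrix.cons_val_zero, Matrix.cons_val_one] at hb
  rw [autFactor, p.toMp2Z_row.1, p.toMp2Z_row.2, mul_assoc]
  exact mul_le_mul_of_nonneg_left hb (Real.rpow_nonneg τ.im_pos.le _)

theorem slash_seed_zero_one (hsig : (w - Λ.bNeg + Λ.bPos : ℤ) ≡ 0 [ZMOD 4]) {β : Λ.Disc}
    (hβ : Λ.discForm β = 0) (s : ℂ) :
    Λ.slash w (Λ.eisensteinSeed β s) (rowMap (Sum.inl true)).toMp2Z = Λ.eisensteinSeed β s := by
  conv_rhs => rw [← Λ.slash_one w (Λ.eisensteinSeed β s)]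
  refine Λ.slash_seed_eq_of_row hsig hβ s ?_ ?_
  · rw [(CoprimePair.toMp2Z_row _).1]; rfl
  · rw [(CoprimePair.toMp2Z_row _).2]; rfl

theorem slash_seed_zero_neg_one (hsig : (w - Λ.bNeg + Λ.bPos : ℤ) ≡ 0 [ZMOD 4]) {β : Λ.Disc}
    (hβ : Λ.discForm β = 0) (s : ℂ) :
    Λ.slash w (Λ.eisensteinSeed β s) (rowMap (Sum.inl false)).toMp2Z =
      Λ.eisensteinSeed (-β) s := by
  rw [← Λ.slash_seed_S_sq hsig]
  refine Λ.slash_seed_eq_of_row hsig hβ s ?_ ?_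
  · rw [(CoprimePair.toMp2Z_row _).1, Mp2Z.S_sq_mat]; simp [rowMap]
  · rw [(CoprimePair.toMp2Z_row _).2, Mp2Z.S_sq_mat]; simp [rowMap]

/-- The factor of a term with lower row `(c, d)`, `c ≠ 0`, that is independent of `τ`. -/
noncomputable def rowFactor (κ : ℝ) (s : ℂ) (β γ : Λ.Disc) (c : ℤ) (d : ℕ) : ℂ :=
  Complex.exp (-Real.pi * Complex.I * c.sign * κ / 2) * ((|c| : ℤ) : ℂ) ^ (-κ - 2 * s) *
    Λ.weilCoeff β γ (Mp2Z.lift (bottomRowMatrix c d))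

/-- The term with lower row `(c, d + kc)` is a translate of the one with lower row `(c, d)`. -/
theorem slash_seed_row (hsig : (w - Λ.bNeg + Λ.bPos : ℤ) ≡ 0 [ZMOD 4]) {κ : ℝ}
    (hw : (w : ℝ) = 2 * κ) {β : Λ.Disc} (hβ : Λ.discForm β = 0) (γ : Λ.Disc) {q : ℝ}
    (hq : (q : UnitAddCircle) = Λ.discForm γ) (s : ℂ) (τ : ℍ) (c : {c : ℤ // c ≠ 0})
    (d : primitiveResidues c.1) (k : ℤ) :
    Λ.slash w (Λ.eisensteinSeed β s) (rowMap (Sum.inr ⟨c, d, k⟩)).toMp2Z τ γ =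
      Λ.rowFactor κ s β γ c.1 d.1 * (τ.im : ℂ) ^ s *
        (e (k * q) * eulerKernel (κ + s) s τ.im (τ.re + d.1 / c.1 + k)) := by
  have hM := bottomRowMatrix_row (mem_primitiveResidues.mp d.2).2
  set M := bottomRowMatrix c.1 (d.1 : ℤ) with hMd
  have hr := CoprimePair.toMp2Z_row (rowMap (Sum.inr ⟨c, d, k⟩))
  have hrow : Λ.slash w (Λ.eisensteinSeed β s) (rowMap (Sum.inr ⟨c, d, k⟩)).toMp2Z =
      Λ.slash w (Λ.eisensteinSeed β s) (Mp2Z.lift M * Mp2Z.T ^ k) := by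
    have hm : ((Mp2Z.lift M * Mp2Z.T ^ k).mat : Matrix (Fin 2) (Fin 2) ℤ) =
        (M : Matrix (Fin 2) (Fin 2) ℤ) * !![1, k; 0, 1] := by
      rw [Mp2Z.mul_mat, Mp2Z.T_zpow_mat, Matrix.SpecialLinearGroup.coe_mul,
        ModularGroup.coe_T_zpow]
      rfl
    refine Λ.slash_seed_eq_of_row hsig hβ s ?_ ?_
    · rw [hr.1, hm, Matrix.mul_apply, Fin.sum_univ_two]
      simp [rowMap, hM.1]
    · rw [hr.2, hm, Matrix.mul_apply, Fin.sum_univ_two]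
      simp [rowMap, hM.1, hM.2]
      ring
  have hc : M 1 0 ≠ 0 := by rw [hM.1]; exact c.2
  have haut := automorphy_eq_eulerKernel hc (ModularGroup.T ^ k • τ) hw s
  rw [ModularGroup.im_T_zpow_smul, ModularGroup.re_T_zpow_smul, hM.1, hM.2] at haut
  rw [hrow, slash_seed_apply, weilCoeff_mul_T_zpow, Mp2Z.mul_root, Mp2Z.T_zpow_root, mul_one,
    Mp2Z.mul_mat, Mp2Z.T_zpow_mat, mul_smul]
  change (Mp2Z.lift M).root (ModularGroup.T ^ k • τ) ^ (-w) *
    ((M • (ModularGroup.T ^ k • τ)).im : ℂ) ^ s * _ = _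
  rw [haut, ← hq, ← AddCircle.coe_zsmul, eMod_coe, rowFactor, ← hMd]
  have e1 : (((k • q : ℝ)) : ℂ) = k * q := by simp
  have e2 : τ.re + k + ((d.1 : ℤ) : ℝ) / c.1 = τ.re + d.1 / c.1 + k := by push_cast; ring
  rw [e1, e2]
  ring

end EvenLattice
end Rows

/-! ### The Fourier expansion -/

section Expansion

theorem tsum_sum_rowIndex {F : Bool ⊕ RowIndex → ℂ} (h : Summable F) :
    ∑' i, F i = F (Sum.inl true) + F (Sum.inl false) +
      ∑' c : {c : ℤ // c ≠ 0}, ∑ d : primitiveResidues c.1, ∑' k : ℤ, F (Sum.inr ⟨c, d, k⟩) := by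
  have hinr : Summable fun i => F (Sum.inr i) := h.comp_injective Sum.inr_injective
  rw [Summable.tsum_sum (h.comp_injective Sum.inl_injective) hinr, tsum_bool, hinr.tsum_sigma,
    add_comm (F _)]
  refine congrArg _ (tsum_congr fun c => ?_)
  rw [Summable.tsum_prod (hinr.sigma_factor c), tsum_fintype]

/-- The sum over all coprime pairs, sorted by `c` and by the residue of `d` modulo `c`. -/
theorem tsum_coprimePair {F : CoprimePair → ℂ} (hF : Summable F) :
    ∑' p, F p = F (rowMap (Sum.inl true)) + F (rowMap (Sum.inl false)) +
      ∑' c : {c : ℤ // c ≠ 0}, ∑ d : primitiveResidues c.1, ∑' k : ℤ,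
        F (rowMap (Sum.inr ⟨c, d, k⟩)) := by
  have h : Summable fun i => F (rowMap i) :=
    ((Equiv.ofBijective rowMap rowMap_bijective).summable_iff (f := F)).mpr hF
  have htsum : ∑' p, F p = ∑' i, F (rowMap i) :=
    ((Equiv.ofBijective rowMap rowMap_bijective).tsum_eq F).symm
  rw [htsum, tsum_sum_rowIndex h]

namespace EvenLattice
variable {V : Type*} [AddCommGroup V] [Module ℝ V] (Λ : EvenLattice V) {w : ℤ}

theorem sum_rowFactor (κ : ℝ) (s : ℂ) (β γ : Λ.Disc) {c : ℤ} (hc : c ≠ 0) (n : ℝ) :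
    ∑ d : primitiveResidues c, Λ.rowFactor κ s β γ c d.1 * e (n * (d.1 / c)) =
      ((|c| : ℤ) : ℂ) ^ (1 - κ - 2 * s) * Λ.kloosterman κ c β 0 γ n := by
  have habs : ((|c| : ℤ) : ℂ) ≠ 0 := by exact_mod_cast abs_ne_zero.mpr hc
  rw [Finset.sum_coe_sort (primitiveResidues c)
    (fun d => Λ.rowFactor κ s β γ c d * e (n * (d / c))), kloosterman, ← primitiveResidues,
    ← mul_assoc, Finset.mul_sum]
  refine Finset.sum_congr rfl fun d _ => ?_
  have h1 : ((|c| : ℤ) : ℂ) ^ (1 - κ - 2 * s) =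
      ((|c| : ℤ) : ℂ) ^ (-κ - 2 * s) * ((|c| : ℤ) : ℂ) := by
    rw [← cpow_add_one _ habs]; ring_nf
  have h2 : (n : ℂ) * (d / c) =
      (((0 : ℝ) : ℂ) * (bottomRowMatrix c d 0 0 : ℤ) + n * d) / c := by
    rw [Complex.ofReal_zero]; ring
  rw [h1, rowFactor, h2]
  field_simp

/-- The contribution of the rows `(c, *)` to the frequency `n`. -/
noncomputable def frequencyTerm (κ : ℝ) (s : ℂ) (β γ : Λ.Disc) (τ : ℍ) (n : ℝ)
    (c : {c : ℤ // c ≠ 0}) : ℂ :=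
  (τ.im : ℂ) ^ s * eulerTransform (κ + s) s τ.im n * e (n * τ.re) *
    (((|c.1| : ℤ) : ℂ) ^ (1 - κ - 2 * s) * Λ.kloosterman κ c.1 β 0 γ n)

theorem summable_frequencyTerm {κ : ℝ} {s : ℂ} (hs : 1 - κ / 2 < s.re) (β γ : Λ.Disc)
    (τ : ℍ) (q : ℝ) : Summable fun p : {c : ℤ // c ≠ 0} × ℤ =>
      Λ.frequencyTerm κ s β γ τ (p.2 - q) p.1 := by
  have h1 := (summable_eulerTransform (a := κ + s) (b := s) τ.im_pos (by simp; linarith) q).mul_left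
    ‖(τ.im : ℂ) ^ s‖
  refine ((summable_abs_cpow hs).mul_of_nonneg h1 (fun c => norm_nonneg _)
    (fun m => by positivity)).of_norm_bounded fun p => ?_
  have h2 : ‖e ((p.2 - q : ℝ) * τ.re)‖ = 1 := by
    have := norm_e_ofReal ((p.2 - q) * τ.re); push_cast at this ⊢; exact this
  rw [frequencyTerm, norm_mul, norm_mul, norm_mul, norm_mul, h2, mul_one, mul_comm]
  refine mul_le_mul_of_nonneg_right ?_ (by positivity)
  exact mul_le_of_le_one_right (norm_nonneg _) (Λ.norm_kloosterman_le κ p.1.2 β γ _)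

theorem hasSum_frequencyTerm {κ : ℝ} (β γ : Λ.Disc) {s : ℂ} (hs : 1 - κ / 2 < s.re)
    (τ : ℍ) (n : ℝ) : HasSum (Λ.frequencyTerm κ s β γ τ n)
      ((τ.im : ℂ) ^ s * eulerTransform (κ + s) s τ.im n * e (n * τ.re) *
        Λ.kloostermanSeries κ β γ n s) := by
  have h := (Λ.summable_kloosterman β γ n hs).hasSum.mul_left
    ((τ.im : ℂ) ^ s * eulerTransform (κ + s) s τ.im n * e (n * τ.re))
  exact h.congr_fun fun c => rfl

/-- Poisson summation over the rows with a fixed `c ≠ 0`. -/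
theorem sum_rows_eq (hsig : (w - Λ.bNeg + Λ.bPos : ℤ) ≡ 0 [ZMOD 4]) {κ : ℝ}
    (hw : (w : ℝ) = 2 * κ) {β : Λ.Disc} (hβ : Λ.discForm β = 0) (γ : Λ.Disc) {q : ℝ}
    (hq : (q : UnitAddCircle) = Λ.discForm γ) {s : ℂ} (hs : 1 - κ / 2 < s.re) (τ : ℍ)
    (c : {c : ℤ // c ≠ 0}) :
    ∑ d : primitiveResidues c.1, ∑' k : ℤ,
      Λ.slash w (Λ.eisensteinSeed β s) (rowMap (Sum.inr ⟨c, d, k⟩)).toMp2Z τ γ =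
    ∑' m : ℤ, Λ.frequencyTerm κ s β γ τ (m - q) c := by
  have hab : 1 < ((κ : ℂ) + s + s).re := by simp; linarith
  have h1 : ∀ d : primitiveResidues c.1, ∑' k : ℤ,
      Λ.slash w (Λ.eisensteinSeed β s) (rowMap (Sum.inr ⟨c, d, k⟩)).toMp2Z τ γ =
      ∑' m : ℤ, Λ.rowFactor κ s β γ c.1 d.1 * (τ.im : ℂ) ^ s *
        (eulerTransform (κ + s) s τ.im (m - q) *
          e (((m - q : ℝ) : ℂ) * ((τ.re + d.1 / c.1 : ℝ) : ℂ))) := fun d => by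
    simp_rw [Λ.slash_seed_row hsig hw hβ γ hq s τ c d]
    rw [tsum_mul_left, tsum_eulerKernel τ.im_pos hab, tsum_mul_left]
  simp_rw [h1]
  rw [← Summable.tsum_finsetSum]
  · refine tsum_congr fun m => ?_
    rw [frequencyTerm, ← Λ.sum_rowFactor κ s β γ c.2, Finset.mul_sum]
    refine Finset.sum_congr rfl fun d _ => ?_
    have : e (((m - q : ℝ) : ℂ) * ((τ.re + d.1 / c.1 : ℝ) : ℂ)) =
        e (((m - q : ℝ) : ℂ) * τ.re) * e (((m - q : ℝ) : ℂ) * (d.1 / c.1)) := by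
      rw [← Mp2Z.e_add]; congr 1; push_cast; ring
    rw [this]
    ring
  · intro d _
    refine Summable.mul_left _ ?_
    refine (summable_eulerTransform τ.im_pos hab q).of_norm_bounded fun m => ?_
    have := norm_e_ofReal ((m - q) * (τ.re + d.1 / c.1))
    rw [Complex.ofReal_mul] at this
    rw [norm_mul, this, mul_one]

/-- The contribution `(δ_{β,γ} + δ_{-β,γ}) y^s` of the rows with `c = 0`. -/
noncomputable def constantTerm (β γ : Λ.Disc) (s : ℂ) (y : ℝ) : ℂ :=
  ((if β = γ then 1 else 0) + (if -β = γ then 1 else 0)) * (y : ℂ) ^ s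

theorem eisenstein_eq_tsum (hsig : (w - Λ.bNeg + Λ.bPos : ℤ) ≡ 0 [ZMOD 4]) {κ : ℝ}
    (hw : (w : ℝ) = 2 * κ) {β : Λ.Disc} (hβ : Λ.discForm β = 0) (γ : Λ.Disc) {s : ℂ}
    (hs : 1 - κ / 2 < s.re) (τ : ℍ) : Λ.eisenstein w β hβ s τ γ =
      ∑' p : CoprimePair, Λ.slash w (Λ.eisensteinSeed β s) p.toMp2Z τ γ := by
  have hsumm := Λ.summable_slash_seed hw β hs τ
  rw [Λ.eisenstein_eq_of_hasSum hsig hβ s τ hsumm.hasSum]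
  exact tsum_apply hsumm

theorem eisenstein_eq_constantTerm_add (hsig : (w - Λ.bNeg + Λ.bPos : ℤ) ≡ 0 [ZMOD 4]) {κ : ℝ}
    (hw : (w : ℝ) = 2 * κ) {β : Λ.Disc} (hβ : Λ.discForm β = 0) (γ : Λ.Disc) {q : ℝ}
    (hq : (q : UnitAddCircle) = Λ.discForm γ) {s : ℂ} (hs : 1 - κ / 2 < s.re) (τ : ℍ) :
    Λ.eisenstein w β hβ s τ γ = Λ.constantTerm β γ s τ.im +
      ∑' c : {c : ℤ // c ≠ 0}, ∑' m : ℤ, Λ.frequencyTerm κ s β γ τ (m - q) c := by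
  have h0 : Λ.eisensteinSeed β s τ γ + Λ.eisensteinSeed (-β) s τ γ =
      Λ.constantTerm β γ s τ.im := by
    simp only [constantTerm, eisensteinSeed, Pi.smul_apply, Pi.single_apply, smul_eq_mul,
      eq_comm (a := γ)]
    ring
  rw [Λ.eisenstein_eq_tsum hsig hw hβ γ hs τ,
    tsum_coprimePair (Pi.summable.mp (Λ.summable_slash_seed hw β hs τ) γ),
    Λ.slash_seed_zero_one hsig hβ, Λ.slash_seed_zero_neg_one hsig hβ, h0]
  exact congrArg _ (tsum_congr fun c => Λ.sum_rows_eq hsig hw hβ γ hq hs τ c)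

/-- The rows with `c ≠ 0`, summed over `c` for each frequency. The double series over `c` and the
frequency converges absolutely, so that the order of summation may be exchanged. -/
theorem hasSum_frequencies (hsig : (w - Λ.bNeg + Λ.bPos : ℤ) ≡ 0 [ZMOD 4]) {κ : ℝ}
    (hw : (w : ℝ) = 2 * κ) {β : Λ.Disc} (hβ : Λ.discForm β = 0) (γ : Λ.Disc) {q : ℝ}
    (hq : (q : UnitAddCircle) = Λ.discForm γ) {s : ℂ} (hs : 1 - κ / 2 < s.re) (τ : ℍ) :
    HasSum (fun m : ℤ => (τ.im : ℂ) ^ s * eulerTransform (κ + s) s τ.im (m - q) *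
        e (((m - q : ℝ) : ℂ) * τ.re) * Λ.kloostermanSeries κ β γ (m - q) s)
      (Λ.eisenstein w β hβ s τ γ - Λ.constantTerm β γ s τ.im) := by
  have hG := Λ.summable_frequencyTerm hs β γ τ q
  rw [Λ.eisenstein_eq_constantTerm_add hsig hw hβ γ hq hs τ, add_sub_cancel_left, ← hG.tsum_prod]
  have hG' : HasSum (fun p : ℤ × {c : ℤ // c ≠ 0} => Λ.frequencyTerm κ s β γ τ (p.1 - q) p.2)
      (∑' p : {c : ℤ // c ≠ 0} × ℤ, Λ.frequencyTerm κ s β γ τ (p.2 - q) p.1) :=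
    (Equiv.prodComm ℤ {c : ℤ // c ≠ 0}).hasSum_iff.mpr hG.hasSum
  exact hG'.prod_fiberwise fun m => Λ.hasSum_frequencyTerm β γ hs τ (m - q)

theorem discForm_neg (γ : Λ.Disc) : Λ.discForm (-γ) = Λ.discForm γ := by
  obtain ⟨x, rfl⟩ := Λ.toDisc_surjective γ
  rw [← map_neg, discForm_mk, discForm_mk, Submodule.coe_neg, QuadraticMap.map_neg]

theorem constantTerm_eq_zero {β γ : Λ.Disc} (hβ : Λ.discForm β = 0) (hγ : Λ.discForm γ ≠ 0)
    (s : ℂ) (y : ℝ) : Λ.constantTerm β γ s y = 0 := by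
  rw [constantTerm, if_neg, if_neg, add_zero, zero_mul]
  · rintro rfl
    exact hγ ((Λ.discForm_neg β).trans hβ)
  · rintro rfl
    exact hγ hβ

open Classical in
theorem hasSum_constantTerm {β γ : Λ.Disc} (hβ : Λ.discForm β = 0) {q : ℝ}
    (hq : (q : UnitAddCircle) = Λ.discForm γ) (s : ℂ) (y x : ℝ) :
    HasSum (fun m : ℤ => (if (m - q : ℝ) = 0 then Λ.constantTerm β γ s y else 0) *
      e (((m - q : ℝ) : ℂ) * x)) (Λ.constantTerm β γ s y) := by
  by_cases h0 : Λ.discForm γ = 0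
  · rw [h0, AddCircle.coe_eq_zero_iff] at hq
    obtain ⟨m, hm⟩ := hq
    have hm : (m : ℝ) = q := by simpa using hm
    convert hasSum_single m ?_ using 1
    · rw [hm, sub_self, if_pos rfl]; simp [e]
    · intro k hk
      rw [if_neg, zero_mul]
      rw [← hm, sub_eq_zero]
      exact_mod_cast hk
  · rw [Λ.constantTerm_eq_zero hβ h0]
    simp

/-- The expansion of one component, with the frequencies `n ∈ ℤ - q(γ)` written as `m - q`. -/
theorem hasSum_component (hsig : (w - Λ.bNeg + Λ.bPos : ℤ) ≡ 0 [ZMOD 4]) {κ : ℝ} (hκ : 2 ≤ κ)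
    (hw : (w : ℝ) = 2 * κ) {β : Λ.Disc} (hβ : Λ.discForm β = 0) (γ : Λ.Disc) {q : ℝ}
    (hq : (q : UnitAddCircle) = Λ.discForm γ) {s : ℂ} (hs : 1 - κ / 2 < s.re) (τ : ℍ) :
    HasSum (fun m : ℤ => Λ.eisensteinCoeff κ β γ (m - q) s τ.im * e (((m - q : ℝ) : ℂ) * τ.re))
      (Λ.eisenstein w β hβ s τ γ) := by
  classical
  have h := (Λ.hasSum_constantTerm hβ hq s τ.im τ.re).add
    (Λ.hasSum_frequencies hsig hw hβ γ hq hs τ)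
  rw [add_sub_cancel] at h
  refine h.congr_fun fun m => ?_
  rw [Λ.eisensteinCoeff_eq hκ β γ _ hs τ.im_pos, constantTerm]
  split_ifs <;> ring

/-- The frequencies `n ∈ ℤ - q(γ)`, indexed by `ℤ`. -/
noncomputable def frequencyEquiv (γ : Λ.Disc) {q : ℝ} (hq : (q : UnitAddCircle) = Λ.discForm γ) :
    ℤ ≃ {n : ℝ // (n : UnitAddCircle) = -Λ.discForm γ} :=
  Equiv.ofBijective (fun m => ⟨m - q, by
    rw [AddCircle.coe_sub, hq, sub_eq_neg_self, AddCircle.coe_eq_zero_iff]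
    exact ⟨m, by simp⟩⟩) (by
    constructor
    · intro m m' h
      have := congrArg Subtype.val h
      simp only [sub_left_inj] at this
      exact_mod_cast this
    · rintro ⟨n, hn⟩
      have h : ((n + q : ℝ) : UnitAddCircle) = 0 := by
        rw [AddCircle.coe_add, hn, hq, neg_add_cancel]
      obtain ⟨m, hm⟩ := (AddCircle.coe_eq_zero_iff _).mp h
      refine ⟨m, Subtype.ext ?_⟩
      have hm : (m : ℝ) = n + q := by simpa using hm
      simp only [hm, add_sub_cancel_right])

theorem coe_frequencyEquiv (γ : Λ.Disc) {q : ℝ} (hq : (q : UnitAddCircle) = Λ.discForm γ) (m : ℤ) :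
    (Λ.frequencyEquiv γ hq m : ℝ) = m - q := rfl

end EvenLattice
end Expansion

theorem proposition2 {V : Type*} [AddCommGroup V] [Module ℝ V] (Λ : EvenLattice V)
    (κ : ℝ) (w : ℤ) (hw : (w : ℝ) = 2 * κ) (hκ : 2 ≤ κ)
    (hsig : (w - Λ.bNeg + Λ.bPos : ℤ) ≡ 0 [ZMOD 4])
    (β : Λ.Disc) (hβ : Λ.discForm β = 0) (s : ℂ) (hs : 1 - κ / 2 < s.re) :
    (∀ (γ : Λ.Disc) (n : ℝ), (n : UnitAddCircle) = -Λ.discForm γ →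
      Summable fun c : {c : ℤ // c ≠ 0} =>
        (((|c.1| : ℤ) : ℂ) ^ (1 - κ - 2 * s)) * Λ.kloosterman κ c β 0 γ n) ∧
    ∀ τ : ℍ,
      Summable (Λ.eisensteinTerm w β hβ s τ) ∧
      HasSum
        (fun p : Σ γ : Λ.Disc, {n : ℝ // (n : UnitAddCircle) = -Λ.discForm γ} =>
          Λ.eisensteinCoeff κ β p.1 p.2 s τ.im •
            (e ((p.2 : ℝ) * τ.re) • (Pi.single p.1 1 : Λ.Disc → ℂ)))
        (Λ.eisenstein w β hβ s τ) := by
  refine ⟨fun γ n _ => Λ.summable_kloosterman β γ n hs, fun τ => ⟨?_, ?_⟩⟩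
  · exact (Λ.hasSum_eisensteinTerm hsig hβ s τ (Λ.summable_slash_seed hw β hs τ).hasSum).summable
  · rw [Pi.hasSum]
    intro γ
    obtain ⟨q, hq⟩ := QuotientAddGroup.mk_surjective (Λ.discForm γ)
    have h := Λ.hasSum_component hsig hκ hw hβ γ hq hs τ
    -- Only the frequencies of the component `γ` contribute to its value.
    refine ((sigma_mk_injective (i := γ)).hasSum_iff ?_).mp ?_
    · rintro ⟨δ, n⟩ hn
      have hne : γ ≠ δ := by
        rintro rfl
        exact hn ⟨n, rfl⟩
      simp [hne]
    · rw [← (Λ.frequencyEquiv γ hq).hasSum_iff]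
      refine h.congr_fun fun m => ?_
      simp only [Function.comp_apply]
      rw [Pi.smul_apply, Pi.smul_apply, Pi.single_eq_same,
        Λ.coe_frequencyEquiv, smul_eq_mul, smul_eq_mul, mul_one]
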